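/- Let $H:\mathbb R\to\mathbb R$ be even, $H\in L^1(\mathbb R)\cap L^2(\mathbb R)$, and suppose that $$1+\widetilde H(k)>0\quad\text{for all }k\in\mathbb R,\qquad \widetilde H(k):=\int_{-\infty}^{\infty}H(t)e^{ikt}\,dt .$$ Then for every $x\ge 0$ the equation $$\Gamma_x(t,s)+\int_0^x H(t-u)\,\Gamma_x(u,s)\,du=H(t-s),\qquad 0\le t,s\le x,$$ has exactly one solution $\Gamma_x$ with $\Gamma_x(\cdot,s)\in L^2(0,x)$ for each $s\in[0,x]$. The limit $\Gamma(s):=\lim_{x\to\infty}\Gamma_x(s,0)$ exists for every $s\ge 0$, and $\Gamma\in L^1(0,\infty)$. Put $$f(k):=1-\int_0^\infty\Gamma(s)e^{iks}\,ds,\quad \operatorname{Im}k\ge 0,\qquad A(x):=2\Gamma_{2x}(2x,0).$$ Suppose that $A$ is locally absolutely continuous on $(0,\infty)$, so that the potential $$q(x):=A(x)^2+A'(x)$$ is defined for almost every $x>0$ and locally integrable on $(0,\infty)$. Then $f$ is the Jost function of $q$. That is, for every $k\in\mathbb C$ with $\operatorname{Im}k\ge 0$ there is exactly one function $f(\cdot,k)$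 that is continuous on $[0,\infty)$ and differentiable on $(0,\infty)$, has a locally absolutely continuous derivative on $(0,\infty)$, satisfies $$f''(x,k)+k^2f(x,k)-q(x)f(x,k)=0\quad\text{for almost every }x>0,$$ and has the asymptotics $f(x,k)=e^{ikx}(1+o(1))$ as $x\to+\infty$ (for real $k$: $f(x,k)=e^{ikx}+o(1)$); and it satisfies $f(0,k)=f(k)$. -/

import Mathlib

open MeasureTheory Set Filter Topology Asymptotics

noncomputable section

/-- The Fourier transform `∫ H(t) e^{ikt} dt` of a function on the line, without normalisation. For
a real even `H` it is the real number `2 ∫_0^∞ cos(kt) H(t) dt`. -/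
def kreinTransform (H : ℝ → ℝ) (k : ℝ) : ℂ :=
  ∫ t : ℝ, (H t : ℂ) * Complex.exp (Complex.I * k * t)

/-- `G` solves Krein's equation on `[0, x]`:
`G(t,s) + ∫_0^x H(t-u) G(u,s) du = H(t-s)` for all `0 ≤ t, s ≤ x`, each `G(·,s)` being square
integrable on `[0, x]`. If `H` is square integrable, the integrand is integrable for every `t`. -/
def IsKreinKernel (H : ℝ → ℝ) (x : ℝ) (G : ℝ → ℝ → ℝ) : Prop :=
  ∀ s ∈ Icc 0 x,
    MemLp (fun t => G t s) 2 (volume.restrict (Icc 0 x)) ∧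
    ∀ t ∈ Icc 0 x, G t s + ∫ u in (0 : ℝ)..x, H (t - u) * G u s = H (t - s)

/-- `A(x) = 2 Γ_{2x}(2x, 0)`, where `Γ x t s` stands for `Γ_x(t,s)`. -/
def kreinA (Γ : ℝ → ℝ → ℝ → ℝ) (x : ℝ) : ℝ :=
  2 * Γ (2 * x) (2 * x) 0

/-- The potential `q = A² + A'`. -/
def kreinPotential (Γ : ℝ → ℝ → ℝ → ℝ) (x : ℝ) : ℝ :=
  kreinA Γ x ^ 2 + deriv (kreinA Γ) x

/-- `f(k) = 1 - ∫_0^∞ g(s) e^{iks} ds`. -/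
def kreinF (g : ℝ → ℝ) (k : ℂ) : ℂ :=
  1 - ∫ s in Ioi (0 : ℝ), (g s : ℂ) * Complex.exp (Complex.I * k * s)

/-- Local absolute continuity on the open half-line `(0, ∞)`. -/
def LocallyACOnPos {X : Type*} [PseudoMetricSpace X] (u : ℝ → X) : Prop :=
  ∀ a b : ℝ, 0 < a → a < b → AbsolutelyContinuousOnInterval u a b

/-- `y` is a solution of `y'' + k² y - q y = 0` on the half-line, in the usual sense for a locally
integrable potential: `y` is continuous on `[0, ∞)` and differentiable on `(0, ∞)`, `y'` is locally
absolutely continuous on `(0, ∞)`, and the equation holds almost everywhere there. -/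
structure IsSchrodingerSolution (q : ℝ → ℝ) (k : ℂ) (y : ℝ → ℂ) : Prop where
  continuousOn : ContinuousOn y (Ici 0)
  differentiableAt : ∀ x : ℝ, 0 < x → DifferentiableAt ℝ y x
  deriv_ac : LocallyACOnPos (deriv y)
  equation : ∀ᵐ x ∂(volume.restrict (Ioi (0 : ℝ))),
    deriv (deriv y) x + k ^ 2 * y x - (q x : ℂ) * y x = 0

/-- `y` is a Jost solution: `y(x) = e^{ikx} (1 + o(1))` as `x → +∞`. For real `k` this is
`y(x) = e^{ikx} + o(1)`, because then `|e^{ikx}| = 1`. -/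
structure IsJostSolution (q : ℝ → ℝ) (k : ℂ) (y : ℝ → ℂ) : Prop where
  solution : IsSchrodingerSolution q k y
  asymptotics : (fun x : ℝ => y x - Complex.exp (Complex.I * k * x)) =o[atTop]
    fun x : ℝ => Complex.exp (Complex.I * k * x)

/-- `f` is the Jost function of `q` on the closed upper half-plane: for every `k` with
`Im k ≥ 0` (in particular for every real `k`) there is exactly one Jost solution `f(·,k)` on
`[0, ∞)`, and `f(k) = f(0,k)`. -/
def IsJostFunction (q : ℝ → ℝ) (f : ℂ → ℂ) : Prop :=
  ∀ k : ℂ, 0 ≤ k.im →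
    ∃ y : ℝ → ℂ, IsJostSolution q k y ∧
      (∀ z : ℝ → ℂ, IsJostSolution q k z → EqOn z y (Ici 0)) ∧
      f k = y 0

end

/-! On `L²(ℝ)` let `T` be convolution with `H`. Plancherel and the Riemann-Lebesgue lemma turn
positivity of the symbol into `1 + T ≥ δ > 0` as a quadratic form. This bound passes to every
truncation `1 + P T P`, so Lax-Milgram gives existence and uniqueness of `Γ_x`, and convergence of
the projections gives `Γ_x(·,0) → Γ` in `L²`. Since `H ∈ L²`, the value of `H * u` at a point is an
inner product, so `L²` statements become statements at every point.

The hard analytic input is an `L¹` bound for truncated solutions that is uniform in the truncation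
(`exists_integral_abs_bound`). It comes from exponential weights, whose commutators with `T` are
small. It gives `Γ ∈ L¹` and `Γ_x(·,0) → Γ` in `L¹`. A Gronwall-type absorption then shows that
`a(x) = Γ_x(x,0)` is integrable on `(0,∞)` (`integrableOn_a`), hence so is `A`.

Krein's identity `∂_x Γ_x(t,0) = -Γ_x(t,x) Γ_x(x,0)`, used in weak form (`hasDerivAt_inner_g`),
together with `Γ_x(t,x) = Γ_x(x-t,0)`, says that `Q(x) = 1 - ∫_0^x Γ_x(s,0) e^{iks} ds` and `P(x) =
e^{ikx}(1 - ∫_0^x Γ_x(s,0) e^{-iks} ds)` solve the Krein system `Q' = -aP`, `P' = ikP - aQ` with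
`P(0) = Q(0) = 1`. Moreover `Q(x) → f(k)`, and `P` stays bounded.

The operator `d²/dx² - q` factors as `(d/dx + A)(d/dx - A)`. For integrable `A` the Jost solution is
therefore `e^{ikx}(α - β)`, where `α' = -Aβ`, `β' = -2ikβ - Aα` and `(α,β) → (1,0)` at infinity.
Existence is a contraction argument for Volterra operators. Uniqueness works under the stated
asymptotics of the solution alone, without any on its derivative. The expression `P(2x)β(x) -
Q(2x)α(x)` is constant; comparing its limits at `0` and at infinity gives `α(0) - β(0) = f(k)`
(`kreinF_eq`). -/

namespace Krein

open scoped RealInnerProductSpace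

/-- The real Hilbert space `L²(ℝ)`. -/
abbrev L2R : Type := Lp ℝ 2 (volume : Measure ℝ)

theorem memLp_coe (u : L2R) : MemLp u 2 (volume : Measure ℝ) := Lp.memLp u

theorem inner_eq_integral (u v : L2R) : ⟪u, v⟫ = ∫ t, u t * v t := by
  rw [L2.inner_def]
  refine integral_congr_ae (Eventually.of_forall fun t => ?_)
  simp [mul_comm]

theorem integrable_mul_coe (u v : L2R) : Integrable fun t => u t * v t :=
  (memLp_coe u).integrable_mul (memLp_coe v)

/-! ### Multiplication by bounded functions -/

/-- A measurable function with values in `[-1, 1]`. -/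
def IsMultiplier (m : ℝ → ℝ) : Prop := Measurable m ∧ ∀ t, |m t| ≤ 1

theorem IsMultiplier.memLp {m : ℝ → ℝ} (hm : IsMultiplier m) {u : ℝ → ℝ} {p : ENNReal}
    (hu : MemLp u p) : MemLp (fun t => m t * u t) p :=
  hu.of_le (hm.1.aestronglyMeasurable.mul hu.1) (Eventually.of_forall fun t => by
    rw [norm_mul, Real.norm_eq_abs]
    exact mul_le_of_le_one_left (norm_nonneg _) (hm.2 t))

/-- Multiplication by a bounded measurable function on `L²(ℝ)`. -/
noncomputable def mulOp (m : ℝ → ℝ) (hm : IsMultiplier m) : L2R →L[ℝ] L2R :=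
  LinearMap.mkContinuous
    { toFun := fun u => (hm.memLp (memLp_coe u)).toLp _
      map_add' := fun u v => by
        rw [← MemLp.toLp_add]
        refine MemLp.toLp_congr _ _ ?_
        filter_upwards [Lp.coeFn_add u v] with t ht
        rw [ht, Pi.add_apply, Pi.add_apply, mul_add]
      map_smul' := fun c u => by
        rw [← MemLp.toLp_const_smul]
        refine MemLp.toLp_congr _ _ ?_
        filter_upwards [Lp.coeFn_smul c u] with t ht
        simp [ht, mul_left_comm] } 1 (fun u => by
      refine Lp.norm_le_mul_norm_of_ae_le_mul ?_
      filter_upwards [(hm.memLp (memLp_coe u)).coeFn_toLp] with t ht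
      simp only [LinearMap.coe_mk, AddHom.coe_mk, ht, norm_mul, Real.norm_eq_abs]
      exact mul_le_mul_of_nonneg_right (hm.2 t) (abs_nonneg _))

theorem mulOp_coe {m : ℝ → ℝ} (hm : IsMultiplier m) (u : L2R) :
    mulOp m hm u =ᵐ[volume] fun t => m t * u t :=
  (hm.memLp (memLp_coe u)).coeFn_toLp

theorem mulOp_norm_le {m : ℝ → ℝ} (hm : IsMultiplier m) (u : L2R) : ‖mulOp m hm u‖ ≤ ‖u‖ := by
  have := LinearMap.mkContinuous_norm_le (𝕜 := ℝ) (E := L2R) (F := L2R) _ zero_le_one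
    (fun u => by
      refine Lp.norm_le_mul_norm_of_ae_le_mul ?_
      filter_upwards [mulOp_coe hm u] with t ht
      simp only [ContinuousLinearMap.coe_coe, ht, norm_mul, Real.norm_eq_abs]
      exact mul_le_mul_of_nonneg_right (hm.2 t) (abs_nonneg _) :
      ∀ u, ‖(mulOp m hm : L2R →ₗ[ℝ] L2R) u‖ ≤ 1 * ‖u‖)
  simpa using ((mulOp m hm).le_opNorm u).trans (mul_le_mul_of_nonneg_right this (norm_nonneg _))

theorem mulOp_inner {m : ℝ → ℝ} (hm : IsMultiplier m) (u v : L2R) :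
    ⟪mulOp m hm u, v⟫ = ⟪u, mulOp m hm v⟫ := by
  rw [inner_eq_integral, inner_eq_integral]
  refine integral_congr_ae ?_
  filter_upwards [mulOp_coe hm u, mulOp_coe hm v] with t h1 h2
  rw [h1, h2]; ring

theorem mulOp_comm {m m' : ℝ → ℝ} (hm : IsMultiplier m) (hm' : IsMultiplier m') (u : L2R) :
    mulOp m hm (mulOp m' hm' u) = mulOp m' hm' (mulOp m hm u) := by
  refine Lp.ext ?_
  filter_upwards [mulOp_coe hm u, mulOp_coe hm' u, mulOp_coe hm (mulOp m' hm' u),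
    mulOp_coe hm' (mulOp m hm u)] with t h1 h2 h3 h4
  rw [h3, h4, h1, h2]; ring

theorem isMultiplier_indicator {S : Set ℝ} (hS : MeasurableSet S) :
    IsMultiplier (S.indicator 1) :=
  ⟨measurable_one.indicator hS, fun t => by by_cases h : t ∈ S <;> simp [h]⟩

/-- Restriction to a measurable set, as a projection of `L²(ℝ)`. -/
noncomputable def proj (S : Set ℝ) (hS : MeasurableSet S) : L2R →L[ℝ] L2R :=
  mulOp _ (isMultiplier_indicator hS)

theorem proj_coe {S : Set ℝ} (hS : MeasurableSet S) (u : L2R) :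
    proj S hS u =ᵐ[volume] S.indicator u := by
  filter_upwards [mulOp_coe (isMultiplier_indicator hS) u] with t ht
  rw [proj, ht]
  by_cases h : t ∈ S <;> simp [h]

theorem proj_norm_le {S : Set ℝ} (hS : MeasurableSet S) (u : L2R) : ‖proj S hS u‖ ≤ ‖u‖ :=
  mulOp_norm_le _ u

theorem proj_inner {S : Set ℝ} (hS : MeasurableSet S) (u v : L2R) :
    ⟪proj S hS u, v⟫ = ⟪u, proj S hS v⟫ := mulOp_inner _ u v

theorem proj_proj_of_subset {S T : Set ℝ} (hS : MeasurableSet S) (hT : MeasurableSet T)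
    (hST : S ⊆ T) (u : L2R) : proj T hT (proj S hS u) = proj S hS u := by
  refine Lp.ext ?_
  filter_upwards [proj_coe hS u, proj_coe hT (proj S hS u)] with t h1 h2
  rw [h2]
  by_cases h : t ∈ T
  · simp [h]
  · have : t ∉ S := fun h' => h (hST h')
    simp [h, h1, this]

theorem proj_proj {S : Set ℝ} (hS : MeasurableSet S) (u : L2R) :
    proj S hS (proj S hS u) = proj S hS u := proj_proj_of_subset hS hS subset_rfl u

/-! ### Translations -/

theorem measurePreserving_translate (r : ℝ) :
    MeasurePreserving (fun t : ℝ => t - r) volume volume :=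
  measurePreserving_sub_right volume r

/-- Translation `u ↦ u(· - r)` on `L²(ℝ)`. -/
noncomputable def trans (r : ℝ) : L2R →ₗᵢ[ℝ] L2R :=
  Lp.compMeasurePreservingₗᵢ ℝ (fun t : ℝ => t - r) (measurePreserving_translate r)

theorem trans_coe (r : ℝ) (u : L2R) : trans r u =ᵐ[volume] fun t => u (t - r) :=
  Lp.coeFn_compMeasurePreserving u (measurePreserving_translate r)

theorem continuous_trans_pair : Continuous fun p : ℝ × L2R => trans p.1 p.2 := by
  have hg : Continuous fun p : ℝ × L2R => (⟨fun t => t - p.1, by fun_prop⟩ : C(ℝ, ℝ)) :=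
    ContinuousMap.continuous_of_continuous_uncurry _ (by
      simp only [Function.uncurry_def, ContinuousMap.coe_mk]
      fun_prop)
  exact Continuous.compMeasurePreservingLp (μ := volume) (ν := volume) continuous_snd hg
    (fun p => measurePreserving_translate p.1) (by simp)

theorem continuous_trans (u : L2R) : Continuous fun r => trans r u :=
  continuous_trans_pair.comp (by fun_prop : Continuous fun r : ℝ => (r, u))

theorem mulOp_trans {m : ℝ → ℝ} (hm : IsMultiplier m) (r : ℝ)
    (hm' : IsMultiplier fun t => m (t + r)) (u : L2R) :
    mulOp m hm (trans r u) = trans r (mulOp _ hm' u) := by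
  refine Lp.ext ?_
  have h := (measurePreserving_translate r).quasiMeasurePreserving.ae (mulOp_coe hm' u)
  filter_upwards [mulOp_coe hm (trans r u), trans_coe r u, trans_coe r (mulOp _ hm' u), h]
    with t h1 h2 h3 h4
  rw [h1, h2, h3, h4, sub_add_cancel]

/-! ### Convolution operators -/

theorem integrable_smul_trans {H : ℝ → ℝ} (hH : Integrable H) (u : L2R) :
    Integrable fun r => H r • trans r u := by
  refine (hH.norm.mul_const ‖u‖).mono'
    (hH.1.smul (continuous_trans u).aestronglyMeasurable) (Eventually.of_forall fun r => ?_)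
  rw [norm_smul, LinearIsometry.norm_map]

/-- Convolution with an integrable function, as an operator on `L²(ℝ)`. -/
noncomputable def convOp (H : ℝ → ℝ) (hH : Integrable H) : L2R →L[ℝ] L2R :=
  LinearMap.mkContinuous
    { toFun := fun u => ∫ r, H r • trans r u
      map_add' := fun u v => by
        rw [← integral_add (integrable_smul_trans hH u) (integrable_smul_trans hH v)]
        simp [smul_add]
      map_smul' := fun c u => by
        simp only [map_smul, RingHom.id_apply]
        rw [← integral_smul]
        simp_rw [smul_comm c] } (∫ r, |H r|) (fun u => by
      refine (norm_integral_le_integral_norm _).trans (le_of_eq ?_)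
      simp_rw [norm_smul, LinearIsometry.norm_map, Real.norm_eq_abs]
      rw [integral_mul_const])

theorem convOp_apply {H : ℝ → ℝ} (hH : Integrable H) (u : L2R) :
    convOp H hH u = ∫ r, H r • trans r u := rfl

theorem convOp_norm_le {H : ℝ → ℝ} (hH : Integrable H) (u : L2R) :
    ‖convOp H hH u‖ ≤ (∫ r, |H r|) * ‖u‖ := by
  rw [convOp_apply]
  refine (norm_integral_le_integral_norm _).trans (le_of_eq ?_)
  simp_rw [norm_smul, LinearIsometry.norm_map, Real.norm_eq_abs]
  rw [integral_mul_const]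

theorem inner_convOp {H : ℝ → ℝ} (hH : Integrable H) (u v : L2R) :
    ⟪v, convOp H hH u⟫ = ∫ r, H r * ⟪v, trans r u⟫ := by
  rw [convOp_apply, ← integral_inner (integrable_smul_trans hH u)]
  simp_rw [inner_smul_right]

/-- As `u` is only square integrable, Fubini is available only over sets of finite measure in `t`.
There Cauchy-Schwarz against the indicator bounds the inner integral uniformly in the shift. -/
theorem convOp_integrand {H : ℝ → ℝ} (hH : Integrable H) (u : L2R) {A : Set ℝ}
    (hA : MeasurableSet A) (hAf : volume A < ⊤) :
    Integrable (fun p : ℝ × ℝ => H p.2 * u (p.1 - p.2)) ((volume.restrict A).prod volume) := by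
  have hmeas : AEStronglyMeasurable (fun p : ℝ × ℝ => H p.2 * u (p.1 - p.2))
      ((volume.restrict A).prod volume) := by
    have h1 : AEStronglyMeasurable (fun p : ℝ × ℝ => H p.2) ((volume.restrict A).prod volume) :=
      hH.1.comp_snd
    have h2 : AEStronglyMeasurable (fun p : ℝ × ℝ => u (p.1 - p.2)) (volume.prod volume) :=
      (memLp_coe u).1.comp_quasiMeasurePreserving (quasiMeasurePreserving_sub volume volume)
    exact h1.mul (h2.mono_measure (Measure.prod_mono Measure.restrict_le_self le_rfl))
  have key : ∀ r, IntegrableOn (fun t => u (t - r)) A := fun r => by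
    have h : MemLp (fun t => u (t - r)) 2 (volume.restrict A) :=
      ((memLp_coe u).comp_measurePreserving (measurePreserving_translate r)).restrict A
    have : IsFiniteMeasure (volume.restrict A) := ⟨by simpa using hAf⟩
    exact h.integrable (by norm_num)
  have bound : ∀ r, ∫ t in A, |u (t - r)| ≤ ‖indicatorConstLp 2 hA hAf.ne (1 : ℝ)‖ * ‖u‖ := by
    intro r
    have habs : MemLp (fun t => |u (t - r)|) 2 volume :=
      ((memLp_coe u).comp_measurePreserving (measurePreserving_translate r)).norm
    have h1 : ∫ t in A, |u (t - r)| = ⟪indicatorConstLp 2 hA hAf.ne (1 : ℝ), habs.toLp _⟫ := by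
      rw [L2.inner_indicatorConstLp_one]
      exact (setIntegral_congr_ae hA (habs.coeFn_toLp.mono fun t ht _ => ht.symm))
    rw [h1]
    refine (real_inner_le_norm _ _).trans (mul_le_mul_of_nonneg_left ?_ (norm_nonneg _))
    refine le_of_le_of_eq ?_ (LinearIsometry.norm_map (trans r) u)
    refine Lp.norm_le_norm_of_ae_le ?_
    filter_upwards [habs.coeFn_toLp, trans_coe r u] with t h1 h2
    rw [h1, h2]; simp
  rw [integrable_prod_iff' hmeas]
  refine ⟨Eventually.of_forall fun r => (key r).const_mul (H r), ?_⟩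
  refine (hH.norm.mul_const (‖indicatorConstLp 2 hA hAf.ne (1 : ℝ)‖ * ‖u‖)).mono'
    hmeas.prod_swap.norm.integral_prod_right' (Eventually.of_forall fun r => ?_)
  simp only [norm_mul, integral_const_mul]
  rw [norm_norm]
  refine mul_le_mul_of_nonneg_left ?_ (norm_nonneg (H r))
  rw [Real.norm_of_nonneg (integral_nonneg fun t => norm_nonneg (u (t - r)))]
  exact bound r

/-- The Bochner integral of translates is identified with the pointwise convolution by pairing both
with indicators of sets of finite measure. -/
theorem convOp_ae' {H : ℝ → ℝ} (hH : Integrable H) (u : L2R) :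
    convOp H hH u =ᵐ[volume] fun t => ∫ r, H r * u (t - r) := by
  refine ae_eq_of_forall_setIntegral_eq_of_sigmaFinite (fun A hA hAf => ?_) (fun A hA hAf => ?_)
    (fun A hA hAf => ?_)
  · have : IsFiniteMeasure (volume.restrict A) := ⟨by simpa using hAf⟩
    exact ((memLp_coe _).restrict A).integrable (by norm_num)
  · exact (convOp_integrand hH u hA hAf).integral_prod_left
  · rw [← L2.inner_indicatorConstLp_one (𝕜 := ℝ) hA hAf.ne, inner_convOp,
      integral_integral_swap (convOp_integrand hH u hA hAf)]
    refine integral_congr_ae (Eventually.of_forall fun r => ?_)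
    simp only [integral_const_mul]
    rw [L2.inner_indicatorConstLp_one]
    congr 1
    exact setIntegral_congr_ae hA ((trans_coe r u).mono fun t ht _ => ht)

theorem convOp_ae {H : ℝ → ℝ} (hH : Integrable H) (u : L2R) :
    convOp H hH u =ᵐ[volume] fun t => ∫ s, H (t - s) * u s := by
  filter_upwards [convOp_ae' hH u] with t ht
  rw [ht, ← integral_sub_left_eq_self _ volume t]
  simp

/-- For even `H` convolution is symmetric. -/
theorem convOp_symm {H : ℝ → ℝ} (hH : Integrable H) (heven : ∀ t, H (-t) = H t) (u v : L2R) :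
    ⟪convOp H hH u, v⟫ = ⟪u, convOp H hH v⟫ := by
  rw [real_inner_comm, inner_convOp, inner_convOp, ← integral_neg_eq_self]
  refine integral_congr_ae (Eventually.of_forall fun r => ?_)
  simp only [heven]
  congr 1
  rw [inner_eq_integral, inner_eq_integral, ← integral_sub_right_eq_self _ r]
  have h1 := (measurePreserving_translate r).quasiMeasurePreserving.ae (trans_coe (-r) u)
  refine integral_congr_ae ?_
  filter_upwards [trans_coe r v, h1] with t h2 h3
  rw [h3, h2]; ring_nf

/-- Needed later to let an integrable solution act as the kernel on a fixed, well localized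
function. -/
theorem convOp_comm {f g : ℝ → ℝ} (hf : Integrable f) (hf2 : MemLp f 2) (hg : Integrable g)
    (hg2 : MemLp g 2) : convOp f hf (hg2.toLp g) = convOp g hg (hf2.toLp f) := by
  refine Lp.ext ?_
  filter_upwards [convOp_ae hf (hg2.toLp g), convOp_ae' hg (hf2.toLp f)] with t h1 h2
  rw [h1, h2]
  have h3 := (quasiMeasurePreserving_sub_left volume t).ae hf2.coeFn_toLp
  refine integral_congr_ae ?_
  filter_upwards [hg2.coeFn_toLp, h3] with s h4 h5
  rw [h4, h5, mul_comm]

end Krein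

namespace Krein

open scoped RealInnerProductSpace FourierTransform SchwartzMap

/-! ### Positivity of `1 + H` from the positivity of its symbol -/

theorem kreinTransform_eq_fourier (H : ℝ → ℝ) (k : ℝ) :
    kreinTransform H k = 𝓕 (fun t => (H t : ℂ)) (-k / (2 * Real.pi)) := by
  rw [Real.fourier_real_eq_integral_exp_smul, kreinTransform]
  refine integral_congr_ae (Eventually.of_forall fun t => ?_)
  simp only [smul_eq_mul]
  rw [mul_comm]
  congr 2
  push_cast
  have : (Real.pi : ℂ) ≠ 0 := by exact_mod_cast Real.pi_ne_zero
  field_simp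

theorem continuous_fourier_of_integrable {f : ℝ → ℂ} (hf : Integrable f) : Continuous (𝓕 f) :=
  VectorFourier.fourierIntegral_continuous (L := innerₗ ℝ) Real.continuous_fourierChar
    (by exact continuous_inner) hf

/-- The symbol is continuous and tends to `1` at infinity by the Riemann-Lebesgue lemma: it exceeds
`1/2` off a compact set and attains a positive minimum on that set. -/
theorem exists_symbol_lower_bound {H : ℝ → ℝ} (hH : Integrable H)
    (hpos : ∀ k : ℝ, 0 < 1 + (kreinTransform H k).re) :
    ∃ δ : ℝ, 0 < δ ∧ δ ≤ 1 ∧ ∀ ξ : ℝ, δ ≤ 1 + (𝓕 (fun t => (H t : ℂ)) ξ).re := by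
  set φ : ℝ → ℝ := fun ξ => 1 + (𝓕 (fun t => (H t : ℂ)) ξ).re
  have hφ : Continuous φ := continuous_const.add
    (Complex.continuous_re.comp (continuous_fourier_of_integrable hH.ofReal))
  have hφpos : ∀ ξ, 0 < φ ξ := fun ξ => by
    have h := hpos (-(2 * Real.pi * ξ))
    rw [kreinTransform_eq_fourier] at h
    have h2 : - -(2 * Real.pi * ξ) / (2 * Real.pi) = ξ := by
      field_simp [Real.pi_ne_zero]
    rwa [h2] at h
  have hlim : Tendsto φ (cocompact ℝ) (𝓝 (1 + (0 : ℂ).re)) :=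
    tendsto_const_nhds.add ((Complex.continuous_re.tendsto 0).comp
      (Real.zero_at_infty_fourier fun t => (H t : ℂ)))
  have hev : ∀ᶠ ξ in cocompact ℝ, (1 / 2 : ℝ) < φ ξ :=
    hlim.eventually (lt_mem_nhds (by norm_num))
  obtain ⟨K, hK, hKc⟩ := mem_cocompact.1 hev
  rcases K.eq_empty_or_nonempty with rfl | hne
  · exact ⟨1 / 2, by norm_num, by norm_num, fun ξ => (hKc (by simp : ξ ∈ (∅ : Set ℝ)ᶜ)).le⟩
  · obtain ⟨ξ₀, -, hmin⟩ := hK.exists_isMinOn hne hφ.continuousOn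
    refine ⟨min (φ ξ₀) (1 / 2), lt_min (hφpos _) (by norm_num),
      (min_le_right _ _).trans (by norm_num), fun ξ => ?_⟩
    by_cases h : ξ ∈ K
    · exact (min_le_left _ _).trans (hmin h)
    · exact (min_le_right _ _).trans (hKc h).le

/-- Parseval, with the translation turned into a modulation on the Fourier side. -/
theorem schwartz_autocorrelation (f : 𝓢(ℝ, ℂ)) (r : ℝ) :
    ∫ t, (starRingEnd ℂ) (f t) * f (t - r) =
      ∫ ξ, ((‖𝓕 f ξ‖ ^ 2 : ℝ) : ℂ) * Complex.exp (((-2 * Real.pi * r * ξ : ℝ) : ℂ) * Complex.I) := by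
  set g : ℝ → ℂ := fun ξ =>
    Complex.exp (((-2 * Real.pi * r * ξ : ℝ) : ℂ) * Complex.I) * 𝓕 f ξ
  have hg : Integrable g := by
    refine (𝓕 f).integrable.bdd_mul (c := 1) (by fun_prop) (Eventually.of_forall fun ξ => ?_)
    rw [Complex.norm_exp_ofReal_mul_I]
  have key : ∫ ξ, innerSL ℂ (𝓕 (⇑f) ξ) (g ξ) = ∫ x, innerSL ℂ (f x) (𝓕⁻ g x) := by
    simpa using! VectorFourier.integral_sesq_fourierIntegral_eq_neg_flip (innerSL ℂ)
      (L := innerₗ ℝ) Real.continuous_fourierChar continuous_inner f.integrable hg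
  have hinv : ∀ x, 𝓕⁻ g x = f (x - r) := fun x => by
    have h1 : 𝓕⁻ (𝓕 f) (x - r) = f (x - r) := by simp
    rw [← h1, SchwartzMap.fourierInv_coe, Real.fourierInv_eq', Real.fourierInv_eq']
    refine integral_congr_ae (Eventually.of_forall fun ξ => ?_)
    simp only [smul_eq_mul, g, ← mul_assoc, ← Complex.exp_add]
    congr 2
    simp only [RCLike.inner_apply, conj_trivial]
    push_cast; ring
  have e1 : ∫ t, (starRingEnd ℂ) (f t) * f (t - r) = ∫ x, innerSL ℂ (f x) (𝓕⁻ g x) := by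
    refine integral_congr_ae (Eventually.of_forall fun x => ?_)
    simp only [hinv, innerSL_apply_apply, RCLike.inner_apply]
    rw [mul_comm]
  rw [e1, ← key]
  refine integral_congr_ae (Eventually.of_forall fun ξ => ?_)
  simp only [g, innerSL_apply_apply, RCLike.inner_apply, ← SchwartzMap.fourier_coe]
  rw [mul_assoc, RCLike.mul_conj, mul_comm]
  push_cast; rfl

/-- Integrating the autocorrelation against `H` and applying Fubini gives `⟪f, H * f⟫ = ∫ |𝓕 f|² 𝓕
H`; the symbol bound and Plancherel finish. -/
theorem schwartz_coercive {H : ℝ → ℝ} (hH : Integrable H) {δ : ℝ}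
    (hδ : ∀ ξ : ℝ, δ ≤ 1 + (𝓕 (fun t => (H t : ℂ)) ξ).re) (f : 𝓢(ℝ, ℝ)) :
    (δ - 1) * ‖f.toLp 2‖ ^ 2 ≤ ⟪(f.toLp 2 : L2R), convOp H hH (f.toLp 2)⟫ := by
  set F : 𝓢(ℝ, ℂ) := f.postcompCLM Complex.ofRealCLM
  have hF : ∀ t, F t = (f t : ℂ) := fun t => by
    rw [SchwartzMap.postcompCLM_apply]; rfl
  set e : ℝ → ℝ → ℂ := fun r ξ => Complex.exp (((-2 * Real.pi * r * ξ : ℝ) : ℂ) * Complex.I)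
  have he : ∀ r ξ, ‖e r ξ‖ = 1 := fun r ξ => Complex.norm_exp_ofReal_mul_I _
  have hsq : Integrable fun ξ => ‖𝓕 F ξ‖ ^ 2 := by
    have := ((𝓕 F).memLp 2 volume).integrable_norm_pow (by norm_num)
    simpa using this
  have hcorr : ∀ r, ((⟪(f.toLp 2 : L2R), trans r (f.toLp 2)⟫ : ℝ) : ℂ) =
      ∫ ξ, ((‖𝓕 F ξ‖ ^ 2 : ℝ) : ℂ) * e r ξ := fun r => by
    rw [← schwartz_autocorrelation, inner_eq_integral, ← integral_complex_ofReal]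
    have h1 := f.coeFn_toLp 2 volume
    have h2 := (measurePreserving_translate r).quasiMeasurePreserving.ae h1
    refine integral_congr_ae ?_
    filter_upwards [h1, h2, trans_coe r (f.toLp 2)] with t h1 h2 h3
    rw [h3, h1, h2, hF, hF, Complex.conj_ofReal]; push_cast; rfl
  have hprod : Integrable (fun p : ℝ × ℝ => (H p.1 : ℂ) * (((‖𝓕 F p.2‖ ^ 2 : ℝ) : ℂ) * e p.1 p.2))
      (volume.prod volume) := by
    have h1 := (hH.ofReal (𝕜 := ℂ)).mul_prod (hsq.ofReal (𝕜 := ℂ))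
    have h2 := h1.bdd_mul (c := 1) (f := fun p : ℝ × ℝ => e p.1 p.2)
      (by fun_prop) (Eventually.of_forall fun p => (he _ _).le)
    refine h2.congr (Eventually.of_forall fun p => ?_)
    simp only [RCLike.ofReal_pow, Complex.coe_algebraMap, Complex.ofReal_pow]
    ring
  have hval : ((⟪(f.toLp 2 : L2R), convOp H hH (f.toLp 2)⟫ : ℝ) : ℂ) =
      ∫ ξ, ((‖𝓕 F ξ‖ ^ 2 : ℝ) : ℂ) * 𝓕 (fun t => (H t : ℂ)) ξ := by
    rw [inner_convOp, ← integral_complex_ofReal]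
    simp_rw [Complex.ofReal_mul, hcorr, ← integral_const_mul]
    rw [integral_integral_swap hprod]
    refine integral_congr_ae (Eventually.of_forall fun ξ => ?_)
    simp only
    rw [Real.fourier_real_eq_integral_exp_smul, ← integral_const_mul]
    refine integral_congr_ae (Eventually.of_forall fun r => ?_)
    simp only [e, smul_eq_mul]; ring
  have hint : Integrable fun ξ => ((‖𝓕 F ξ‖ ^ 2 : ℝ) : ℂ) * 𝓕 (fun t => (H t : ℂ)) ξ := by
    refine (hprod.integral_prod_right).congr (Eventually.of_forall fun ξ => ?_)
    simp only
    rw [Real.fourier_real_eq_integral_exp_smul, ← integral_const_mul]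
    refine integral_congr_ae (Eventually.of_forall fun r => ?_)
    simp only [e, smul_eq_mul]; ring
  have hnorm : ‖f.toLp 2‖ ^ 2 = ∫ ξ, ‖𝓕 F ξ‖ ^ 2 := by
    rw [SchwartzMap.integral_norm_sq_fourier, ← real_inner_self_eq_norm_sq, inner_eq_integral]
    refine integral_congr_ae ?_
    filter_upwards [f.coeFn_toLp 2 volume] with t h1
    rw [h1, hF, Complex.norm_real, Real.norm_eq_abs, sq_abs, sq]
  have hre := congrArg Complex.re hval
  rw [Complex.ofReal_re] at hre
  rw [hre, ← RCLike.re_eq_complex_re, ← integral_re hint, hnorm, ← integral_const_mul]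
  refine integral_mono (hsq.const_mul _) hint.re fun ξ => ?_
  simp only [RCLike.re_eq_complex_re, Complex.re_ofReal_mul]
  nlinarith [hδ ξ, sq_nonneg ‖𝓕 F ξ‖]

/-- If the symbol `1 + 𝓕 H` is positive then `1 + H` is bounded below on `L²(ℝ)`. -/
theorem exists_coercive {H : ℝ → ℝ} (hH : Integrable H)
    (hpos : ∀ k : ℝ, 0 < 1 + (kreinTransform H k).re) :
    ∃ δ : ℝ, 0 < δ ∧ δ ≤ 1 ∧ ∀ u : L2R, (δ - 1) * ‖u‖ ^ 2 ≤ ⟪u, convOp H hH u⟫ := by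
  obtain ⟨δ, h0, h1, h⟩ := exists_symbol_lower_bound hH hpos
  refine ⟨δ, h0, h1, fun u => ?_⟩
  refine DenseRange.induction_on (SchwartzMap.denseRange_toLpCLM (p := 2) (F := ℝ) (E := ℝ)
    (μ := volume) (by simp)) (p := fun u : L2R => (δ - 1) * ‖u‖ ^ 2 ≤ ⟪u, convOp H hH u⟫) u ?_ ?_
  · exact isClosed_le (by fun_prop) (by fun_prop)
  · intro f
    exact schwartz_coercive hH h f

end Krein

/-! ### Truncated convolution equations: `L²` solvability and weighted estimates -/

namespace Krein

open scoped RealInnerProductSpace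

/-! ### Truncated equations `u + P_S T u = v` -/

/-- `1 + T ≥ δ` in the sense of quadratic forms. -/
def IsBoundedBelow (δ : ℝ) (T : L2R →L[ℝ] L2R) : Prop :=
  ∀ u : L2R, (δ - 1) * ‖u‖ ^ 2 ≤ ⟪u, T u⟫

/-- `u` is supported in `S` and satisfies `u + T u = v` on `S`. -/
structure IsTruncSol (T : L2R →L[ℝ] L2R) (S : Set ℝ) (hS : MeasurableSet S) (v u : L2R) :
    Prop where
  supp : proj S hS u = u
  eq : u + proj S hS (T u) = proj S hS v

variable {T : L2R →L[ℝ] L2R} {δ : ℝ} {S : Set ℝ} {hS : MeasurableSet S}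

theorem IsTruncSol.sub {v u v' u' : L2R} (h : IsTruncSol T S hS v u) (h' : IsTruncSol T S hS v' u') :
    IsTruncSol T S hS (v - v') (u - u') :=
  ⟨by rw [map_sub, h.supp, h'.supp], by rw [map_sub, map_sub, map_sub, ← h.eq, ← h'.eq]; abel⟩

/-- Pairing the equation with `u` removes the projection in front of `T u`, because `u` is supported
in `S`. The constant does not depend on `S`. -/
theorem IsTruncSol.norm_le (hT : IsBoundedBelow δ T) {v u : L2R}
    (h : IsTruncSol T S hS v u) : δ * ‖u‖ ≤ ‖proj S hS v‖ := by
  rcases eq_or_ne u 0 with rfl | hu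
  · simp
  have h1 : δ * ‖u‖ ^ 2 ≤ ⟪u, proj S hS v⟫ := by
    rw [← h.eq, inner_add_right, ← proj_inner, h.supp, real_inner_self_eq_norm_sq]
    linarith [hT u]
  have h2 := h1.trans (real_inner_le_norm _ _)
  have h3 : 0 < ‖u‖ := norm_pos_iff.2 hu
  nlinarith

theorem IsTruncSol.unique (hδ : 0 < δ) (hT : IsBoundedBelow δ T) {v u u' : L2R}
    (h : IsTruncSol T S hS v u) (h' : IsTruncSol T S hS v u') : u = u' := by
  have h1 := (h.sub h').norm_le hT
  rw [sub_self, map_zero, norm_zero] at h1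
  have h2 : ‖u - u'‖ ≤ 0 := by nlinarith [norm_nonneg (u - u')]
  exact sub_eq_zero.1 (norm_le_zero_iff.1 h2)

/-- Lax-Milgram for `1 + P T P` on all of `L²(ℝ)`. Coercivity with the same `δ` follows from `‖P u‖
≤ ‖u‖` and `δ ≤ 1`. -/
theorem exists_isTruncSol (hδ : 0 < δ) (hδ1 : δ ≤ 1) (hT : IsBoundedBelow δ T) (S : Set ℝ)
    (hS : MeasurableSet S) (v : L2R) : ∃ u, IsTruncSol T S hS v u := by
  set P := proj S hS
  set L : L2R →L[ℝ] L2R := ContinuousLinearMap.id ℝ L2R + P.comp (T.comp P)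
  set B : L2R →L[ℝ] L2R →L[ℝ] ℝ := (innerSL ℝ : L2R →L[ℝ] L2R →L[ℝ] ℝ).comp L
  have hB : ∀ u w, B u w = ⟪u + P (T (P u)), w⟫ := fun u w => rfl
  have hco : IsCoercive B := by
    refine ⟨δ, hδ, fun u => ?_⟩
    rw [hB, inner_add_left, proj_inner, real_inner_self_eq_norm_sq, real_inner_comm]
    have h1 := hT (P u)
    have h2 : ‖P u‖ ≤ ‖u‖ := proj_norm_le hS u
    have h3 : ‖P u‖ ^ 2 ≤ ‖u‖ ^ 2 := by gcongr
    nlinarith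
  obtain ⟨u, hu⟩ := hco.continuousLinearEquivOfBilin.surjective (P v)
  have h1 : u + P (T (P u)) = P v := by
    refine ext_inner_right ℝ fun w => ?_
    rw [← hu, hco.continuousLinearEquivOfBilin_apply, hB]
  -- Applying `P` to the equation and comparing with the equation itself shows that the solution is
  -- supported in `S`.
  have h2 : P u = u := by
    have h3 : P u + P (P (T (P u))) = P (P v) := by rw [← map_add, h1]
    have h4 : ∀ w, P (P w) = P w := proj_proj hS
    rw [h4, h4, ← h1] at h3
    exact add_right_cancel h3
  exact ⟨u, h2, by rw [h2] at h1; exact h1⟩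

theorem isBoundedBelow_convOp_of_integral_le {H : ℝ → ℝ} (hH : Integrable H)
    (h : ∫ r, |H r| ≤ 1 - δ) : IsBoundedBelow δ (convOp H hH) := fun u => by
  have h1 := abs_real_inner_le_norm u (convOp H hH u)
  have h2 := convOp_norm_le hH u
  have h3 := neg_abs_le ⟪u, convOp H hH u⟫
  have h4 : ‖u‖ * ‖convOp H hH u‖ ≤ ‖u‖ * ((∫ r, |H r|) * ‖u‖) := by gcongr
  nlinarith [sq_nonneg ‖u‖, mul_le_mul_of_nonneg_right h (sq_nonneg ‖u‖)]

/-! ### Integrability -/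

theorem integrable_of_proj_eq {S : Set ℝ} {hS : MeasurableSet S} (hSf : volume S < ⊤) {u : L2R}
    (hu : proj S hS u = u) : Integrable u := by
  have : IsFiniteMeasure (volume.restrict S) := ⟨by simpa using hSf⟩
  have h1 : IntegrableOn u S := ((memLp_coe u).restrict S).integrable (by norm_num)
  refine (h1.integrable_indicator hS).congr ?_
  have := proj_coe hS u
  rw [hu] at this
  exact this.symm

theorem integrable_proj {S : Set ℝ} {hS : MeasurableSet S} {u : L2R} (hu : Integrable u) :
    Integrable (proj S hS u) :=
  (hu.indicator hS).congr (proj_coe hS u).symm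

theorem integral_abs_proj_le {S : Set ℝ} {hS : MeasurableSet S} {u : L2R} (hu : Integrable u) :
    ∫ t, |proj S hS u t| ≤ ∫ t, |u t| := by
  refine integral_mono_ae (integrable_proj hu).abs hu.abs ?_
  filter_upwards [proj_coe hS u] with t ht
  rw [ht]
  by_cases h : t ∈ S <;> simp [h]

theorem integrable_convolution_pair {H f : ℝ → ℝ} (hH : Integrable H) (hf : Integrable f) :
    Integrable (fun p : ℝ × ℝ => H p.2 * f (p.1 - p.2)) (volume.prod volume) :=
  hH.convolution_integrand (ContinuousLinearMap.mul ℝ ℝ) hf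

theorem integral_abs_convolution_le {H f : ℝ → ℝ} (hH : Integrable H) (hf : Integrable f) :
    Integrable (fun t => ∫ r, H r * f (t - r)) ∧
      ∫ t, |∫ r, H r * f (t - r)| ≤ (∫ r, |H r|) * ∫ t, |f t| := by
  have h := integrable_convolution_pair hH hf
  refine ⟨h.integral_prod_left, ?_⟩
  calc ∫ t, |∫ r, H r * f (t - r)| ≤ ∫ t, ∫ r, |H r * f (t - r)| :=
        integral_mono h.integral_prod_left.abs h.abs.integral_prod_left
          fun t => abs_integral_le_integral_abs
    _ = ∫ r, ∫ t, |H r * f (t - r)| := integral_integral_swap h.abs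
    _ = ∫ r, |H r| * ∫ t, |f t| := by
        refine integral_congr_ae (Eventually.of_forall fun r => ?_)
        simp only [abs_mul, integral_const_mul]
        rw [integral_sub_right_eq_self (fun t => |f t|) r]
    _ = _ := integral_mul_const _ _

theorem convOp_integrable {H : ℝ → ℝ} (hH : Integrable H) {f : L2R} (hf : Integrable f) :
    Integrable (convOp H hH f) ∧ ∫ t, |convOp H hH f t| ≤ (∫ r, |H r|) * ∫ t, |f t| := by
  obtain ⟨h1, h2⟩ := integral_abs_convolution_le hH hf
  refine ⟨h1.congr (convOp_ae' hH f).symm, le_of_eq_of_le ?_ h2⟩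
  refine integral_congr_ae ?_
  filter_upwards [convOp_ae' hH f] with t ht
  rw [ht]

/-! ### Exponential localization -/

/-- The weight `e^{-ε|t-τ|}`. -/
noncomputable def expWeight (ε τ t : ℝ) : ℝ := Real.exp (-(ε * |t - τ|))

theorem isMultiplier_expWeight {ε : ℝ} (hε : 0 < ε) (τ : ℝ) : IsMultiplier (expWeight ε τ) := by
  refine ⟨by unfold expWeight; fun_prop, fun t => ?_⟩
  rw [expWeight, Real.abs_exp, Real.exp_le_one_iff, neg_nonpos]
  positivity

theorem expWeight_nonneg (ε τ t : ℝ) : 0 ≤ expWeight ε τ t := (Real.exp_pos _).le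

theorem expWeight_add (ε τ t r : ℝ) : expWeight ε τ (t + r) = expWeight ε (τ - r) t := by
  rw [expWeight, expWeight]; congr 4; ring

theorem expWeight_le {ε : ℝ} (hε : 0 < ε) (σ τ t : ℝ) :
    expWeight ε σ t ≤ Real.exp (ε * |σ - τ|) * expWeight ε τ t := by
  rw [expWeight, expWeight, ← Real.exp_add, Real.exp_le_exp]
  have : |t - τ| ≤ |t - σ| + |σ - τ| := abs_sub_le _ _ _
  nlinarith

/-- Moving the centre changes the weight by a small relative amount when `ε |σ - τ|` is small; this
makes commutators with convolutions small. -/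
theorem abs_expWeight_sub_le {ε : ℝ} (hε : 0 < ε) (σ τ t : ℝ) :
    |expWeight ε σ t - expWeight ε τ t| ≤ (Real.exp (ε * |σ - τ|) - 1) * expWeight ε τ t := by
  have h1 := expWeight_le hε σ τ t
  have h2 := expWeight_le hε τ σ t
  rw [abs_sub_comm] at h2
  have h3 : 1 ≤ Real.exp (ε * |σ - τ|) := Real.one_le_exp (by positivity)
  have h5 := expWeight_nonneg ε τ t
  have h6 := expWeight_nonneg ε σ t
  rw [abs_sub_le_iff]
  constructor
  · linarith
  · by_cases h7 : expWeight ε τ t ≤ expWeight ε σ t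
    · nlinarith
    · nlinarith

/-- `localNorm ε u τ` is the `L²`-norm of `e^{-ε|·-τ|} u`. -/
noncomputable def localNorm {ε : ℝ} (hε : 0 < ε) (u : L2R) (τ : ℝ) : ℝ :=
  ‖mulOp _ (isMultiplier_expWeight hε τ) u‖

variable {ε : ℝ} (hε : 0 < ε)

theorem localNorm_nonneg (u : L2R) (τ : ℝ) : 0 ≤ localNorm hε u τ := norm_nonneg _

theorem norm_mulOp_expWeight_sub_le (u : L2R) (σ τ : ℝ) :
    ‖mulOp _ (isMultiplier_expWeight hε σ) u - mulOp _ (isMultiplier_expWeight hε τ) u‖ ≤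
      (Real.exp (ε * |σ - τ|) - 1) * localNorm hε u τ := by
  refine Lp.norm_le_mul_norm_of_ae_le_mul ?_
  filter_upwards [mulOp_coe (isMultiplier_expWeight hε σ) u,
    mulOp_coe (isMultiplier_expWeight hε τ) u, Lp.coeFn_sub
      (mulOp _ (isMultiplier_expWeight hε σ) u) (mulOp _ (isMultiplier_expWeight hε τ) u)]
    with t h1 h2 h3
  rw [h3, Pi.sub_apply, h1, h2, ← sub_mul, norm_mul, norm_mul, ← mul_assoc,
    Real.norm_of_nonneg (expWeight_nonneg ε τ t)]
  exact mul_le_mul_of_nonneg_right (abs_expWeight_sub_le hε σ τ t) (norm_nonneg _)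

theorem continuous_mulOp_expWeight (u : L2R) :
    Continuous fun τ => mulOp _ (isMultiplier_expWeight hε τ) u := by
  rw [continuous_iff_continuousAt]
  intro τ
  rw [ContinuousAt, tendsto_iff_norm_sub_tendsto_zero]
  refine squeeze_zero (fun _ => norm_nonneg _) (fun σ => norm_mulOp_expWeight_sub_le hε u σ τ) ?_
  have : Continuous fun σ => (Real.exp (ε * |σ - τ|) - 1) * localNorm hε u τ := by fun_prop
  simpa using this.tendsto τ

theorem continuous_localNorm (u : L2R) : Continuous (localNorm hε u) :=
  (continuous_mulOp_expWeight hε u).norm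

theorem localNorm_proj_le {S : Set ℝ} {hS : MeasurableSet S} (u : L2R) (τ : ℝ) :
    localNorm hε (proj S hS u) τ ≤ localNorm hε u τ := by
  unfold localNorm; unfold proj
  rw [mulOp_comm]
  exact mulOp_norm_le _ _

theorem mulOp_expWeight_trans (u : L2R) (r τ : ℝ) :
    mulOp _ (isMultiplier_expWeight hε τ) (trans r u) =
      trans r (mulOp _ (isMultiplier_expWeight hε (τ - r)) u) := by
  have h : (fun t => expWeight ε τ (t + r)) = expWeight ε (τ - r) :=
    funext fun t => expWeight_add ε τ t r
  have hm : IsMultiplier fun t => expWeight ε τ (t + r) := by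
    rw [h]; exact isMultiplier_expWeight hε (τ - r)
  rw [mulOp_trans (isMultiplier_expWeight hε τ) r hm]
  simp only [h]

theorem localNorm_trans (u : L2R) (r τ : ℝ) :
    localNorm hε (trans r u) τ = localNorm hε u (τ - r) := by
  rw [localNorm, mulOp_expWeight_trans hε, LinearIsometry.norm_map]; rfl

theorem integrable_exp_neg_abs {c : ℝ} (hc : 0 < c) : Integrable fun t : ℝ => Real.exp (-(c * |t|)) := by
  rw [← integrableOn_univ, ← Iic_union_Ioi (a := (0 : ℝ))]
  refine IntegrableOn.union ?_ ?_
  · refine (integrableOn_exp_mul_Iic hc 0).congr_fun (fun t ht => ?_) measurableSet_Iic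
    simp only; rw [abs_of_nonpos ht]; ring_nf
  · refine (integrableOn_exp_mul_Ioi (neg_neg_of_pos hc) 0).congr_fun (fun t ht => ?_)
      measurableSet_Ioi
    simp only; rw [abs_of_pos ht]; ring_nf

/-- A function of bounded support has local norms decaying like `e^{-ε|τ|}`. The bound depends on
`R` and serves only to make later absorptions legitimate. -/
theorem integrable_localNorm {S : Set ℝ} {hS : MeasurableSet S} {R : ℝ} (hR : S ⊆ Icc (-R) R)
    {u : L2R} (hu : proj S hS u = u) : Integrable (localNorm hε u) := by
  refine ((integrable_exp_neg_abs hε).const_mul (Real.exp (ε * R) * ‖u‖)).mono'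
    (continuous_localNorm hε u).aestronglyMeasurable (Eventually.of_forall fun τ => ?_)
  rw [Real.norm_of_nonneg (localNorm_nonneg hε u τ)]
  have h : localNorm hε u τ ≤ (Real.exp (ε * R) * Real.exp (-(ε * |τ|))) * ‖u‖ := by
    refine Lp.norm_le_mul_norm_of_ae_le_mul ?_
    have h1 := proj_coe hS u
    rw [hu] at h1
    filter_upwards [mulOp_coe (isMultiplier_expWeight hε τ) u, h1] with t h1 h2
    rw [h1, norm_mul]
    by_cases ht : t ∈ S
    · refine mul_le_mul_of_nonneg_right ?_ (norm_nonneg _)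
      rw [Real.norm_of_nonneg (expWeight_nonneg ε τ t), expWeight, ← Real.exp_add, Real.exp_le_exp]
      have h3 : |t| ≤ R := abs_le.2 (hR ht)
      have h4 : |τ| ≤ |t| + |t - τ| := by
        have := abs_sub_le τ t 0
        rw [sub_zero, sub_zero, abs_sub_comm τ t] at this
        linarith
      nlinarith
    · rw [h2]; simp [ht]
  linarith [h]

/-- Localized control of the `L¹` norm. -/
theorem integral_abs_le_integral_localNorm : ∃ c : ℝ, 0 < c ∧ ∀ u : L2R, Integrable u →
    Integrable (localNorm hε u) → ∫ t, |u t| ≤ c * ∫ τ, localNorm hε u τ := by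
  have hw2 : ∀ τ, Integrable fun t => expWeight ε τ t ^ 2 := fun τ => by
    refine ((integrable_exp_neg_abs (by positivity : 0 < 2 * ε)).comp_sub_right τ).congr
      (Eventually.of_forall fun t => ?_)
    simp only [expWeight]
    rw [← Real.exp_nat_mul]; congr 1; push_cast; ring
  have hwL : ∀ τ, MemLp (expWeight ε τ) 2 volume := fun τ =>
    (memLp_two_iff_integrable_sq (isMultiplier_expWeight hε τ).1.aestronglyMeasurable).2 (hw2 τ)
  set K : ℝ := ∫ t, expWeight ε 0 t ^ 2
  have hK : 0 < K := by
    refine (integral_pos_iff_support_of_nonneg (fun t => sq_nonneg _) (hw2 0)).2 ?_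
    have : Function.support (fun t => expWeight ε 0 t ^ 2) = univ :=
      Function.support_eq_univ fun t => (pow_pos (Real.exp_pos _) 2).ne'
    rw [this]; simp
  have hKτ : ∀ t, ∫ τ, expWeight ε τ t ^ 2 = K := fun t => by
    rw [← integral_sub_left_eq_self _ volume t]
    refine integral_congr_ae (Eventually.of_forall fun τ => ?_)
    simp only [expWeight]; congr 5; ring
  have hKt : ∀ τ, ‖(hwL τ).toLp _‖ = √K := fun τ => by
    rw [← Real.sqrt_sq (norm_nonneg _), ← real_inner_self_eq_norm_sq, inner_eq_integral]
    congr 1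
    rw [show K = ∫ t, expWeight ε 0 t ^ 2 from rfl, ← integral_sub_right_eq_self (fun t => expWeight ε 0 t ^ 2) τ]
    refine integral_congr_ae ?_
    filter_upwards [(hwL τ).coeFn_toLp] with t ht
    rw [ht, ← sq]; simp [expWeight]
  -- With `K` the integral of the squared weight, `K ∫ |u| = ∫∫ |u(t)| w_τ(t)² dt dτ`. One factor
  -- `w_τ` stays with `u`; the other is paired with it by Cauchy-Schwarz and costs `√K`.
  refine ⟨(√K)⁻¹, by positivity, fun u hu hn => ?_⟩
  have hprod : Integrable (fun p : ℝ × ℝ => |u p.1| * expWeight ε p.2 p.1 ^ 2)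
      (volume.prod volume) := by
    have hm : AEStronglyMeasurable (fun p : ℝ × ℝ => |u p.1| * expWeight ε p.2 p.1 ^ 2)
        (volume.prod volume) := by
      refine (hu.abs.1.comp_fst).mul (Continuous.aestronglyMeasurable ?_)
      unfold expWeight; fun_prop
    rw [integrable_prod_iff hm]
    refine ⟨Eventually.of_forall fun t => ?_, ?_⟩
    · change Integrable fun τ => |u t| * expWeight ε τ t ^ 2
      refine Integrable.const_mul ?_ _
      refine Integrable.congr ((hw2 t)) (Eventually.of_forall fun τ => ?_)
      simp only [expWeight]; rw [abs_sub_comm]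
    · refine (hu.abs.mul_const K).congr (Eventually.of_forall fun t => ?_)
      simp only
      rw [← hKτ t, ← integral_const_mul]
      refine integral_congr_ae (Eventually.of_forall fun τ => ?_)
      simp
  have h1 : K * ∫ t, |u t| = ∫ τ, ∫ t, |u t| * expWeight ε τ t ^ 2 := by
    rw [← integral_integral_swap hprod, ← integral_const_mul]
    refine integral_congr_ae (Eventually.of_forall fun t => ?_)
    simp only
    rw [integral_const_mul, hKτ, mul_comm]
  have h2 : ∀ τ, ∫ t, |u t| * expWeight ε τ t ^ 2 ≤ √K * localNorm hε u τ := fun τ => by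
    have hm : MemLp (fun t => |u t|) 2 volume := (memLp_coe u).norm
    have h3 : ∫ t, |u t| * expWeight ε τ t ^ 2 =
        ⟪(hwL τ).toLp _, mulOp _ (isMultiplier_expWeight hε τ) (hm.toLp _)⟫ := by
      rw [inner_eq_integral]
      refine integral_congr_ae ?_
      filter_upwards [(hwL τ).coeFn_toLp, mulOp_coe (isMultiplier_expWeight hε τ) (hm.toLp _),
        hm.coeFn_toLp] with t h1 h2 h3
      rw [h1, h2, h3]; ring
    rw [h3]
    refine (real_inner_le_norm _ _).trans ?_
    rw [hKt]
    refine mul_le_mul_of_nonneg_left ?_ (Real.sqrt_nonneg _)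
    refine Lp.norm_le_norm_of_ae_le ?_
    filter_upwards [mulOp_coe (isMultiplier_expWeight hε τ) (hm.toLp _),
      hm.coeFn_toLp, mulOp_coe (isMultiplier_expWeight hε τ) u] with t h1 h2 h3
    rw [h1, h2, h3]; simp
  have h4 : K * ∫ t, |u t| ≤ √K * ∫ τ, localNorm hε u τ := by
    rw [h1, ← integral_const_mul]
    exact integral_mono hprod.integral_prod_right (hn.const_mul _) h2
  have h5 : √K * √K = K := Real.mul_self_sqrt hK.le
  have h6 : 0 < √K := Real.sqrt_pos.2 hK
  rw [← div_eq_inv_mul, le_div_iff₀ h6]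
  refine le_of_mul_le_mul_left ?_ h6
  calc √K * ((∫ t, |u t|) * √K) = (√K * √K) * ∫ t, |u t| := by ring
    _ = K * ∫ t, |u t| := by rw [h5]
    _ ≤ _ := h4

end Krein

namespace Krein

open scoped RealInnerProductSpace

/-! ### Commutators of convolutions with exponential weights -/

/-- `‖(X_{τ-r} - X_τ) u‖`, where `X_τ` is multiplication by the weight centred at `τ`. -/
noncomputable def weightShift {ε : ℝ} (hε : 0 < ε) (u : L2R) (τ r : ℝ) : ℝ :=
  ‖mulOp _ (isMultiplier_expWeight hε (τ - r)) u - mulOp _ (isMultiplier_expWeight hε τ) u‖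

variable {ε : ℝ} (hε : 0 < ε)

theorem weightShift_nonneg (u : L2R) (τ r : ℝ) : 0 ≤ weightShift hε u τ r := norm_nonneg _

theorem continuous_weightShift (u : L2R) :
    Continuous fun p : ℝ × ℝ => weightShift hε u p.1 p.2 := by
  have h := continuous_mulOp_expWeight hε u
  exact ((h.comp (by fun_prop : Continuous fun p : ℝ × ℝ => p.1 - p.2)).sub
    (h.comp continuous_fst)).norm

theorem weightShift_le_add (u : L2R) (τ r : ℝ) :
    weightShift hε u τ r ≤ localNorm hε u (τ - r) + localNorm hε u τ := norm_sub_le _ _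

theorem weightShift_le_mul (u : L2R) (τ r : ℝ) :
    weightShift hε u τ r ≤ (Real.exp (ε * |r|) - 1) * localNorm hε u τ := by
  have := norm_mulOp_expWeight_sub_le hε u (τ - r) τ
  rwa [show τ - r - τ = -r by ring, abs_neg] at this

theorem integrable_mul_weightShift {H : ℝ → ℝ} (hH : Integrable H) {u : L2R}
    (hu : Integrable (localNorm hε u)) :
    Integrable (fun p : ℝ × ℝ => |H p.2| * weightShift hε u p.1 p.2) (volume.prod volume) := by
  have h1 := integrable_convolution_pair hH.abs hu
  have h2 : Integrable (fun p : ℝ × ℝ => localNorm hε u p.1 * |H p.2|) (volume.prod volume) :=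
    hu.mul_prod hH.abs
  refine (h1.add h2).mono' ((hH.abs.1.comp_snd).mul
    (continuous_weightShift hε u).aestronglyMeasurable) (Eventually.of_forall fun p => ?_)
  rw [Real.norm_of_nonneg (mul_nonneg (abs_nonneg _) (weightShift_nonneg hε u _ _)), Pi.add_apply,
    mul_comm (localNorm hε u p.1), ← mul_add]
  exact mul_le_mul_of_nonneg_left (weightShift_le_add hε u _ _) (abs_nonneg _)

/-- Passing a weight through the translation by `r` moves its centre from `τ` to `τ - r`, and
translations are isometries. -/
theorem norm_commutator_le {H : ℝ → ℝ} (hH : Integrable H) (u : L2R) (τ : ℝ) :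
    ‖mulOp _ (isMultiplier_expWeight hε τ) (convOp H hH u) -
      convOp H hH (mulOp _ (isMultiplier_expWeight hε τ) u)‖ ≤
      ∫ r, |H r| * weightShift hε u τ r := by
  set X := mulOp _ (isMultiplier_expWeight hε τ)
  have h1 : X (convOp H hH u) = ∫ r, H r • X (trans r u) := by
    rw [convOp_apply, ← X.integral_comp_comm (integrable_smul_trans hH u)]
    simp_rw [map_smul]
  have hi : Integrable fun r => H r • X (trans r u) := by
    simpa using X.integrable_comp (integrable_smul_trans hH u)
  rw [h1, convOp_apply, ← integral_sub hi (integrable_smul_trans hH _)]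
  refine (norm_integral_le_integral_norm _).trans (le_of_eq ?_)
  refine integral_congr_ae (Eventually.of_forall fun r => ?_)
  simp only
  rw [← smul_sub, norm_smul, Real.norm_eq_abs, mulOp_expWeight_trans hε, ← map_sub,
    LinearIsometry.norm_map]
  rfl

/-- Shifts with `|r| ≤ N` are estimated by the relative change of the weight, larger ones by the
triangle inequality. The factor becomes small by taking `N` large and then `ε` small. -/
theorem integral_mul_weightShift_le {H : ℝ → ℝ} (hH : Integrable H) {u : L2R}
    (hu : Integrable (localNorm hε u)) {N : ℝ} (hN : 0 ≤ N) :
    ∫ τ, ∫ r, |H r| * weightShift hε u τ r ≤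
      ((Real.exp (ε * N) - 1) * (∫ r, |H r|) + 2 * ∫ r, |(Icc (-N) N)ᶜ.indicator H r|) *
        ∫ τ, localNorm hε u τ := by
  set I := ∫ τ, localNorm hε u τ
  have hI : 0 ≤ I := integral_nonneg fun τ => localNorm_nonneg hε u τ
  have hF := integrable_mul_weightShift hε hH hu
  have hH1 : Integrable ((Icc (-N) N)ᶜ.indicator H) := hH.indicator measurableSet_Icc.compl
  have hR : ((Real.exp (ε * N) - 1) * (∫ r, |H r|) +
      2 * ∫ r, |(Icc (-N) N)ᶜ.indicator H r|) * I =
      ∫ r, ((Real.exp (ε * N) - 1) * |H r| + 2 * |(Icc (-N) N)ᶜ.indicator H r|) * I := by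
    rw [integral_mul_const, integral_add (hH.abs.const_mul _) (hH1.abs.const_mul _),
      integral_const_mul, integral_const_mul]
  rw [integral_integral_swap hF, hR]
  refine integral_mono hF.integral_prod_right
    (((hH.abs.const_mul _).add (hH1.abs.const_mul _)).mul_const _) fun r => ?_
  simp only [integral_const_mul]
  have hsh : Integrable fun τ => localNorm hε u (τ - r) := hu.comp_sub_right r
  have hmeas : AEStronglyMeasurable (fun τ => weightShift hε u τ r) volume :=
    ((continuous_weightShift hε u).comp
      (by fun_prop : Continuous fun τ : ℝ => (τ, r))).aestronglyMeasurable
  have hD : Integrable fun τ => weightShift hε u τ r := by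
    refine (hsh.add hu).mono' hmeas (Eventually.of_forall fun τ => ?_)
    rw [Real.norm_of_nonneg (weightShift_nonneg hε u _ _)]
    exact weightShift_le_add hε u _ _
  by_cases hr : r ∈ Icc (-N) N
  · have h1 : ∫ τ, weightShift hε u τ r ≤ (Real.exp (ε * N) - 1) * I := by
      rw [← integral_const_mul]
      refine integral_mono hD (hu.const_mul _) fun τ => ?_
      refine (weightShift_le_mul hε u τ r).trans ?_
      have h3 : |r| ≤ N := abs_le.2 hr
      have h4 := localNorm_nonneg hε u τ
      gcongr
    have : (Icc (-N) N)ᶜ.indicator H r = 0 := by simp [hr.1, hr.2]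
    rw [this, abs_zero, mul_zero, add_zero]
    calc _ ≤ |H r| * ((Real.exp (ε * N) - 1) * I) := by gcongr
      _ = _ := by ring
  · have h1 : ∫ τ, weightShift hε u τ r ≤ 2 * I := by
      calc _ ≤ ∫ τ, (localNorm hε u (τ - r) + localNorm hε u τ) :=
            integral_mono hD (hsh.add hu) fun τ => weightShift_le_add hε u τ r
        _ = 2 * I := by
            rw [integral_add hsh hu, integral_sub_right_eq_self (localNorm hε u) r]; ring
    have : (Icc (-N) N)ᶜ.indicator H r = H r := indicator_of_mem hr H
    rw [this]
    have h5 : 0 ≤ Real.exp (ε * N) - 1 := by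
      have := Real.one_le_exp (by positivity : 0 ≤ ε * N); linarith
    calc _ ≤ |H r| * (2 * I) := by gcongr
      _ ≤ (Real.exp (ε * N) - 1) * |H r| * I + |H r| * (2 * I) := by
          have := mul_nonneg (mul_nonneg h5 (abs_nonneg (H r))) hI
          linarith
      _ = _ := by ring

theorem exists_tail_le {H : ℝ → ℝ} (hH : Integrable H) {η : ℝ} (hη : 0 < η) :
    ∃ N : ℝ, 0 < N ∧ ∫ r, |(Icc (-N) N)ᶜ.indicator H r| ≤ η := by
  have h : Tendsto (fun n : ℕ => ∫ r, |(Icc (-(n : ℝ)) n)ᶜ.indicator H r|) atTop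
      (𝓝 (∫ _ : ℝ, (0 : ℝ))) := by
    refine tendsto_integral_of_dominated_convergence (fun r => |H r|)
      (fun n => (hH.indicator measurableSet_Icc.compl).abs.1) hH.abs
      (fun n => Eventually.of_forall fun r => ?_) (Eventually.of_forall fun r => ?_)
    · rw [Real.norm_eq_abs, abs_abs]
      by_cases hr : r ∈ (Icc (-(n : ℝ)) n)ᶜ
      · rw [indicator_of_mem hr]
      · rw [indicator_of_notMem hr, abs_zero]; positivity
    · obtain ⟨n, hn⟩ := exists_nat_ge |r|
      refine tendsto_const_nhds.congr' ?_
      filter_upwards [eventually_ge_atTop n] with m hm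
      have : r ∈ Icc (-(m : ℝ)) m := abs_le.1 (hn.trans (by exact_mod_cast hm))
      simp [this.1, this.2]
  rw [integral_zero] at h
  obtain ⟨n, hn1, hn2⟩ := ((h.eventually (ge_mem_nhds hη)).and (eventually_gt_atTop 0)).exists
  exact ⟨n, by exact_mod_cast hn2, hn1⟩

/-- Bounds for solutions of truncated equations in a Wiener amalgam norm, uniform in the
truncation. -/
theorem exists_localNorm_bound {H : ℝ → ℝ} (hH : Integrable H) {δ : ℝ} (hδ : 0 < δ)
    (hT : IsBoundedBelow δ (convOp H hH)) :
    ∃ (ε : ℝ) (hε : 0 < ε), ∀ (S : Set ℝ) (hS : MeasurableSet S) (R : ℝ), S ⊆ Icc (-R) R →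
      ∀ v u : L2R, IsTruncSol (convOp H hH) S hS v u →
        ∫ τ, localNorm hε u τ ≤ (2 / δ) * ∫ τ, localNorm hε (proj S hS v) τ := by
  -- The commutator will cost `η M ≤ δ/4` from shifts up to `N` and `2 · δ/8` from the tail: `δ/2`
  -- in total, half of the lower bound.
  obtain ⟨N, hN, hNη⟩ := exists_tail_le hH (by positivity : 0 < δ / 8)
  set M := ∫ r, |H r|
  have hM : 0 ≤ M := integral_nonneg fun _ => abs_nonneg _
  set η := δ / (4 * (M + 1))
  have hη : 0 < η := by positivity
  have hηM : η * M ≤ δ / 4 := by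
    rw [div_mul_eq_mul_div, div_le_iff₀ (by positivity)]
    nlinarith
  set ε := Real.log (1 + η) / N
  have hε : 0 < ε := div_pos (Real.log_pos (by linarith)) hN
  have hεN : Real.exp (ε * N) - 1 = η := by
    rw [div_mul_cancel₀ _ hN.ne', Real.exp_log (by linarith)]; ring
  refine ⟨ε, hε, fun S hS R hSR v u h => ?_⟩
  set I := ∫ τ, localNorm hε u τ
  have hI : 0 ≤ I := integral_nonneg fun τ => localNorm_nonneg hε u τ
  have hu : Integrable (localNorm hε u) := integrable_localNorm hε hSR h.supp
  have hv : Integrable (localNorm hε (proj S hS v)) :=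
    integrable_localNorm hε hSR (proj_proj hS v)
  have hpt : ∀ τ, δ * localNorm hε u τ ≤
      localNorm hε (proj S hS v) τ + ∫ r, |H r| * weightShift hε u τ r := fun τ => by
    set X := mulOp _ (isMultiplier_expWeight hε τ)
    have hXP : ∀ w, X (proj S hS w) = proj S hS (X w) := fun w => mulOp_comm _ _ w
    -- Weights commute with projections, so `X u` solves the same truncated equation with the
    -- commutator as an additional source; the `L²` bound then applies at each centre `τ`.
    have hsol : IsTruncSol (convOp H hH) S hS
        (X (proj S hS v) - (X (convOp H hH u) - convOp H hH (X u))) (X u) := by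
      refine ⟨by rw [← hXP, h.supp], ?_⟩
      rw [map_sub, map_sub, ← hXP, ← hXP, proj_proj, ← h.eq, map_add]
      abel
    refine (hsol.norm_le hT).trans ((proj_norm_le hS _).trans ((norm_sub_le _ _).trans ?_))
    exact add_le_add le_rfl (norm_commutator_le hε hH u τ)
  have hint : δ * I ≤ (∫ τ, localNorm hε (proj S hS v) τ) +
      ∫ τ, ∫ r, |H r| * weightShift hε u τ r := by
    have h1 : Integrable fun τ => ∫ r, |H r| * weightShift hε u τ r :=
      (integrable_mul_weightShift hε hH hu).integral_prod_left
    rw [← integral_add hv h1, ← integral_const_mul]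
    exact integral_mono (hu.const_mul _) (hv.add h1) hpt
  have hcomm := integral_mul_weightShift_le hε hH hu hN.le
  rw [hεN] at hcomm
  have h2 : (η * M + 2 * ∫ r, |(Icc (-N) N)ᶜ.indicator H r|) * I ≤ (δ / 2) * I := by
    refine mul_le_mul_of_nonneg_right ?_ hI
    linarith
  have h3 : δ / 2 * I ≤ ∫ τ, localNorm hε (proj S hS v) τ := by linarith
  calc I = (2 / δ) * (δ / 2 * I) := by field_simp
    _ ≤ _ := by gcongr

/-- Young's inequality for the amalgam norm: translating `h` by `s` translates its local norms by
`s`. -/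
theorem integral_localNorm_convOp_le {f : ℝ → ℝ} (hf : Integrable f) {h : L2R}
    (hh : Integrable (localNorm hε h)) :
    Integrable (localNorm hε (convOp f hf h)) ∧
      ∫ τ, localNorm hε (convOp f hf h) τ ≤ (∫ s, |f s|) * ∫ τ, localNorm hε h τ := by
  have hF := integrable_convolution_pair hf.abs hh
  have hpt : ∀ τ, localNorm hε (convOp f hf h) τ ≤ ∫ s, |f s| * localNorm hε h (τ - s) :=
    fun τ => by
    rw [localNorm, convOp_apply, ← ContinuousLinearMap.integral_comp_comm _
      (integrable_smul_trans hf h)]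
    refine (norm_integral_le_integral_norm _).trans (le_of_eq ?_)
    refine integral_congr_ae (Eventually.of_forall fun s => ?_)
    simp only [map_smul, norm_smul, Real.norm_eq_abs]
    rw [← localNorm_trans]; rfl
  have hI : Integrable (localNorm hε (convOp f hf h)) := by
    refine hF.integral_prod_left.mono' (continuous_localNorm hε _).aestronglyMeasurable
      (Eventually.of_forall fun τ => ?_)
    rw [Real.norm_of_nonneg (localNorm_nonneg hε _ τ)]
    exact hpt τ
  refine ⟨hI, ?_⟩
  calc _ ≤ ∫ τ, ∫ s, |f s| * localNorm hε h (τ - s) := integral_mono hI hF.integral_prod_left hpt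
    _ = ∫ s, ∫ τ, |f s| * localNorm hε h (τ - s) := integral_integral_swap hF
    _ = _ := by
        simp_rw [integral_const_mul, integral_sub_right_eq_self (localNorm hε h)]
        rw [integral_mul_const]

theorem convOp_add_apply {f g H : ℝ → ℝ} (hf : Integrable f) (hg : Integrable g)
    (hH : Integrable H) (hfg : ∀ t, H t = f t + g t) (u : L2R) :
    convOp H hH u = convOp f hf u + convOp g hg u := by
  rw [convOp_apply, convOp_apply, convOp_apply, ← integral_add (integrable_smul_trans hf u)
    (integrable_smul_trans hg u)]
  simp_rw [hfg, add_smul]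

/-- Solutions of truncated equations are bounded in `L¹`, uniformly in the truncation. -/
theorem exists_integral_abs_bound {H : ℝ → ℝ} (hH : Integrable H) (hH2 : MemLp H 2) {δ : ℝ}
    (hδ : 0 < δ) (hT : IsBoundedBelow δ (convOp H hH)) :
    ∃ C : ℝ, 0 < C ∧ ∀ (S : Set ℝ) (hS : MeasurableSet S) (R : ℝ), S ⊆ Icc (-R) R →
      ∀ v u : L2R, IsTruncSol (convOp H hH) S hS v u →
        ∫ t, |u t| ≤ C * ∫ t, |proj S hS v t| := by
  obtain ⟨ε, hε, hloc⟩ := exists_localNorm_bound hH hδ hT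
  obtain ⟨c, hc, hcL⟩ := integral_abs_le_integral_localNorm hε
  -- `H` splits as `H0 + H1`, with `H0` of bounded support and `‖H1‖₁ ≤ 1/2`. The part `H1` is
  -- inverted by contraction in `L¹`; the amalgam estimate handles the correction due to `H0`.
  obtain ⟨N, hN, hNη⟩ := exists_tail_le hH (by norm_num : (0 : ℝ) < 1 - 1 / 2)
  set H1 := (Icc (-N) N)ᶜ.indicator H
  set H0 := (Icc (-N) N).indicator H
  have hH1 : Integrable H1 := hH.indicator measurableSet_Icc.compl
  have hH0 : Integrable H0 := hH.indicator measurableSet_Icc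
  have hH02 : MemLp H0 2 := hH2.indicator measurableSet_Icc
  have hsum : ∀ t, H t = H0 t + H1 t := fun t => by
    simp only [H0, H1]
    rw [← Pi.add_apply, indicator_self_add_compl]
  have hT1 : IsBoundedBelow (1 / 2) (convOp H1 hH1) :=
    isBoundedBelow_convOp_of_integral_le hH1 hNη
  set h0 : L2R := hH02.toLp H0
  have hh0 : Integrable (localNorm hε h0) := by
    refine integrable_localNorm hε (S := Icc (-N) N) (hS := measurableSet_Icc) subset_rfl ?_
    refine Lp.ext ?_
    filter_upwards [proj_coe (measurableSet_Icc (a := -N) (b := N)) h0, hH02.coeFn_toLp]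
      with t h1 h2
    rw [h1]
    by_cases ht : t ∈ Icc (-N) N
    · rw [indicator_of_mem ht]
    · rw [indicator_of_notMem ht, h2]; exact (indicator_of_notMem ht H).symm
  set J := ∫ τ, localNorm hε h0 τ
  have hJ : 0 ≤ J := integral_nonneg fun τ => localNorm_nonneg hε h0 τ
  -- The outer `2` is the cost of inverting `1 + P H1`. In the bracket, `1` accounts for `v'` and
  -- the other summand for the correction `v' - u`.
  refine ⟨2 * (1 + c * (2 / δ) * J), by positivity, fun S hS R hSR v u h => ?_⟩
  have hSf : volume S < ⊤ := (measure_mono hSR).trans_lt (by simp)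
  obtain ⟨v', hv'⟩ := exists_isTruncSol (by norm_num) (by norm_num) hT1 S hS v
  have hv'i : Integrable v' := integrable_of_proj_eq hSf hv'.supp
  have hui : Integrable u := integrable_of_proj_eq hSf h.supp
  have hPv : Integrable (proj S hS v) := integrable_of_proj_eq hSf (proj_proj hS v)
  obtain ⟨hCi, hC⟩ := convOp_integrable hH1 hv'i
  have hv'L : ∫ t, |v' t| ≤ 2 * ∫ t, |proj S hS v t| := by
    have h1 : ∫ t, |v' t| ≤ ∫ t, (|proj S hS v t| + |proj S hS (convOp H1 hH1 v') t|) := by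
      refine integral_mono_ae hv'i.abs (hPv.abs.add (integrable_proj hCi).abs) ?_
      have h2 : v' = proj S hS v - proj S hS (convOp H1 hH1 v') := by
        rw [← hv'.eq]; abel
      have h3 := Lp.coeFn_sub (proj S hS v) (proj S hS (convOp H1 hH1 v'))
      rw [← h2] at h3
      filter_upwards [h3] with t ht
      rw [ht, Pi.sub_apply]
      exact abs_sub _ _
    rw [integral_add hPv.abs (integrable_proj hCi).abs] at h1
    have h4 := integral_abs_proj_le (hS := hS) hCi
    have h5 : 0 ≤ ∫ t, |v' t| := integral_nonneg fun _ => abs_nonneg _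
    have h6 := mul_le_mul_of_nonneg_right hNη h5
    linarith
  set u' := v' - u
  -- Subtracting the equations for `v'` and `u` leaves only `H0 * v'` as source.
  have hu' : IsTruncSol (convOp H hH) S hS (convOp H0 hH0 v') u' := by
    refine ⟨by rw [map_sub, hv'.supp, h.supp], ?_⟩
    have h1 := hv'.eq
    have h2 := h.eq
    have h3 : proj S hS (convOp H hH v') =
        proj S hS (convOp H0 hH0 v') + proj S hS (convOp H1 hH1 v') := by
      rw [← map_add, convOp_add_apply hH0 hH1 hH hsum]
    rw [map_sub, map_sub, h3]
    rw [← h1] at h2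
    have h4 : u' + (proj S hS (convOp H0 hH0 v') + proj S hS (convOp H1 hH1 v') -
        proj S hS (convOp H hH u)) = proj S hS (convOp H0 hH0 v') +
        ((v' + proj S hS (convOp H1 hH1 v')) - (u + proj S hS (convOp H hH u))) := by
      simp only [u']; abel
    rw [h4, h2, sub_self, add_zero]
  -- Swapping the factors bounds the amalgam norm of the source by `‖v'‖₁` times that of `H0`,
  -- independently of the size of `S`.
  have hcomm : convOp H0 hH0 v' = convOp v' hv'i h0 := by
    rw [← convOp_comm hH0 hH02 hv'i (memLp_coe v'), Lp.toLp_coeFn]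
  obtain ⟨hni, hn⟩ := integral_localNorm_convOp_le hε hv'i hh0
  have hu'i : Integrable u' := integrable_of_proj_eq hSf hu'.supp
  have hu'L : ∫ t, |u' t| ≤ c * ((2 / δ) * ((∫ t, |v' t|) * J)) := by
    refine (hcL u' hu'i (integrable_localNorm hε hSR hu'.supp)).trans ?_
    refine mul_le_mul_of_nonneg_left ((hloc S hS R hSR _ _ hu').trans ?_) hc.le
    refine mul_le_mul_of_nonneg_left (le_trans ?_ hn) (by positivity)
    rw [hcomm]
    exact integral_mono (integrable_localNorm hε hSR (proj_proj hS _)) hni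
      fun τ => localNorm_proj_le hε _ τ
  have hfin : ∫ t, |u t| ≤ (∫ t, |v' t|) + ∫ t, |u' t| := by
    rw [← integral_add hv'i.abs hu'i.abs]
    refine integral_mono_ae hui.abs (hv'i.abs.add hu'i.abs) ?_
    filter_upwards [Lp.coeFn_sub v' u] with t ht
    simp only [u', ht, Pi.sub_apply]
    calc |u t| = |v' t - (v' t - u t)| := by ring_nf
      _ ≤ _ := abs_sub _ _
  have hpos : 0 ≤ 1 + c * (2 / δ) * J := by positivity
  calc ∫ t, |u t| ≤ (1 + c * (2 / δ) * J) * ∫ t, |v' t| := by linarith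
    _ ≤ (1 + c * (2 / δ) * J) * (2 * ∫ t, |proj S hS v t|) := by gcongr
    _ = _ := by ring

end Krein

/-! ### Existence, uniqueness and limit of Krein's kernel -/

namespace Krein

open scoped RealInnerProductSpace

/-! ### Accelerants and the resolvent of truncated convolutions -/

/-- An even function in `L¹ ∩ L²` with `1 + H ≥ δ > 0` as a convolution operator. -/
structure IsAccelerant (H : ℝ → ℝ) (δ : ℝ) : Prop where
  even : ∀ t, H (-t) = H t
  integrable : Integrable H
  memLp : MemLp H 2
  pos : 0 < δ
  le_one : δ ≤ 1
  bddBelow : IsBoundedBelow δ (convOp H integrable)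

variable {H : ℝ → ℝ} {δ : ℝ}

namespace IsAccelerant

variable (h : IsAccelerant H δ)
include h

/-- `H` as an element of `L²(ℝ)`. -/
noncomputable def toL2 : L2R := h.memLp.toLp H

/-- Convolution with `H`. -/
noncomputable def op : L2R →L[ℝ] L2R := convOp H h.integrable

/-- The continuous representative of the convolution `H * u`. -/
noncomputable def conv (u : L2R) (t : ℝ) : ℝ := ⟪trans t h.toL2, u⟫

theorem trans_toL2_coe (t : ℝ) : trans t h.toL2 =ᵐ[volume] fun s => H (t - s) := by
  have h1 := (measurePreserving_translate t).quasiMeasurePreserving.ae h.memLp.coeFn_toLp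
  filter_upwards [trans_coe t h.toL2, h1] with s h2 h3
  rw [h2, toL2, h3, ← h.even, neg_sub]

theorem conv_eq (u : L2R) (t : ℝ) : h.conv u t = ∫ s, H (t - s) * u s := by
  rw [conv, inner_eq_integral]
  refine integral_congr_ae ?_
  filter_upwards [h.trans_toL2_coe t] with s hs
  rw [hs]

theorem op_coe (u : L2R) : h.op u =ᵐ[volume] h.conv u := by
  filter_upwards [convOp_ae h.integrable u] with t ht
  rw [op, ht, conv_eq]

theorem continuous_conv_pair : Continuous fun p : ℝ × L2R => h.conv p.2 p.1 := by
  unfold conv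
  exact ((continuous_trans h.toL2).comp continuous_fst).inner continuous_snd

theorem continuous_conv (u : L2R) : Continuous (h.conv u) :=
  h.continuous_conv_pair.comp (by fun_prop : Continuous fun t : ℝ => (t, u))

theorem op_inner (u v : L2R) : ⟪h.op u, v⟫ = ⟪u, h.op v⟫ := convOp_symm h.integrable h.even u v

theorem op_bddBelow : IsBoundedBelow δ h.op := h.bddBelow

theorem exists_sol (S : Set ℝ) (hS : MeasurableSet S) (v : L2R) :
    ∃ u, IsTruncSol h.op S hS v u := exists_isTruncSol h.pos h.le_one h.op_bddBelow S hS v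

/-- The solution of `u + H u = v` on `S`, supported in `S`. -/
noncomputable def sol (S : Set ℝ) (hS : MeasurableSet S) (v : L2R) : L2R :=
  (h.exists_sol S hS v).choose

theorem sol_spec (S : Set ℝ) (hS : MeasurableSet S) (v : L2R) :
    IsTruncSol h.op S hS v (h.sol S hS v) := (h.exists_sol S hS v).choose_spec

theorem eq_sol {S : Set ℝ} {hS : MeasurableSet S} {v u : L2R} (hu : IsTruncSol h.op S hS v u) :
    u = h.sol S hS v := hu.unique h.pos h.op_bddBelow (h.sol_spec S hS v)

theorem sol_ae {S : Set ℝ} {hS : MeasurableSet S} (v : L2R) :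
    ∀ᵐ t, t ∈ S → h.sol S hS v t = v t - h.conv (h.sol S hS v) t := by
  set u := h.sol S hS v
  have h1 := (h.sol_spec S hS v).eq
  have h2 := Lp.coeFn_add u (proj S hS (h.op u))
  rw [h1] at h2
  filter_upwards [h2, proj_coe hS v, proj_coe hS (h.op u), h.op_coe u] with t h2 h3 h4 h5 ht
  rw [h3, Pi.add_apply, h4, indicator_of_mem ht, indicator_of_mem ht, h5] at h2
  linarith

theorem sol_ae_zero {S : Set ℝ} {hS : MeasurableSet S} (v : L2R) :
    ∀ᵐ t, t ∉ S → h.sol S hS v t = 0 := by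
  have h1 := proj_coe hS (h.sol S hS v)
  rw [(h.sol_spec S hS v).supp] at h1
  filter_upwards [h1] with t h2 ht
  rw [h2, indicator_of_notMem ht]

omit h in
theorem tendsto_proj {ι : Type*} {l : Filter ι} [l.IsCountablyGenerated] {s : ι → Set ℝ}
    {S : Set ℝ} (hs : ∀ i, MeasurableSet (s i)) (hS : MeasurableSet S)
    (hlim : ∀ᵐ t : ℝ, ∀ᶠ i in l, (t ∈ s i ↔ t ∈ S)) (w : L2R) :
    Tendsto (fun i => proj (s i) (hs i) w) l (𝓝 (proj S hS w)) := by
  rw [tendsto_iff_norm_sub_tendsto_zero]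
  have hsq : Tendsto (fun i => ∫ t, ((s i).indicator w t - S.indicator w t) ^ 2) l
      (𝓝 (∫ _ : ℝ, (0 : ℝ))) := by
    have hw2 : Integrable fun t => w t ^ 2 := by
      simpa [sq] using integrable_mul_coe w w
    refine tendsto_integral_filter_of_dominated_convergence (fun t => w t ^ 2)
      (Eventually.of_forall fun i => ?_) (Eventually.of_forall fun i =>
        Eventually.of_forall fun t => ?_) hw2 ?_
    · exact (((memLp_coe w).1.indicator (hs i)).sub ((memLp_coe w).1.indicator hS)).pow 2
    · rw [Real.norm_of_nonneg (sq_nonneg _)]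
      by_cases h1 : t ∈ s i <;> by_cases h2 : t ∈ S <;> simp [h1, h2, sq_nonneg]
    · filter_upwards [hlim] with t ht
      refine tendsto_const_nhds.congr' ?_
      filter_upwards [ht] with i hi
      by_cases h2 : t ∈ S
      · simp [h2, hi.2 h2]
      · simp [h2, mt hi.1 h2]
  rw [integral_zero] at hsq
  have hn : ∀ i, ‖proj (s i) (hs i) w - proj S hS w‖ =
      √(∫ t, ((s i).indicator w t - S.indicator w t) ^ 2) := fun i => by
    rw [← Real.sqrt_sq (norm_nonneg _), ← real_inner_self_eq_norm_sq, inner_eq_integral]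
    congr 1
    refine integral_congr_ae ?_
    filter_upwards [proj_coe (hs i) w, proj_coe hS w,
      Lp.coeFn_sub (proj (s i) (hs i) w) (proj S hS w)] with t h1 h2 h3
    rw [h3, Pi.sub_apply, h1, h2, sq]
  simp_rw [hn]
  simpa using hsq.sqrt

/-- The truncation `P_i u` of the limiting solution almost solves the `i`-th equation: its residual
`P_i w_i` tends to `P (v - u - H u) = 0`. The bound `δ⁻¹`, uniform in `i`, turns small residuals
into small errors. -/
theorem tendsto_sol {ι : Type*} {l : Filter ι} [l.IsCountablyGenerated] {s : ι → Set ℝ}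
    {S : Set ℝ} (hs : ∀ i, MeasurableSet (s i)) (hS : MeasurableSet S)
    (hlim : ∀ᵐ t : ℝ, ∀ᶠ i in l, (t ∈ s i ↔ t ∈ S)) (v : L2R) :
    Tendsto (fun i => h.sol (s i) (hs i) v) l (𝓝 (h.sol S hS v)) := by
  have hP := tendsto_proj hs hS hlim
  set u := h.sol S hS v
  have hu := h.sol_spec S hS v
  have hPu : Tendsto (fun i => proj (s i) (hs i) u) l (𝓝 u) := by
    have := hP u; rwa [hu.supp] at this
  set w : ι → L2R := fun i => v - u - h.op (proj (s i) (hs i) u)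
  have hw : Tendsto w l (𝓝 (v - u - h.op u)) :=
    tendsto_const_nhds.sub ((h.op.continuous.tendsto u).comp hPu)
  have hPw : Tendsto (fun i => proj (s i) (hs i) (w i)) l (𝓝 0) := by
    have h0 : proj S hS (v - u - h.op u) = 0 := by
      rw [map_sub, map_sub, hu.supp, ← hu.eq]; abel
    have h1 : Tendsto (fun i => proj (s i) (hs i) (w i - (v - u - h.op u))) l (𝓝 0) := by
      refine squeeze_zero_norm (fun i => proj_norm_le (hs i) _) ?_
      exact tendsto_iff_norm_sub_tendsto_zero.1 hw
    have h2 := h1.add (hP (v - u - h.op u))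
    rw [h0, add_zero] at h2
    refine h2.congr fun i => ?_
    rw [← map_add, sub_add_cancel]
  have hdiff : Tendsto (fun i => h.sol (s i) (hs i) v - proj (s i) (hs i) u) l (𝓝 0) := by
    have h3 : Tendsto (fun i => δ⁻¹ * ‖proj (s i) (hs i) (w i)‖) l (𝓝 0) := by
      simpa using hPw.norm.const_mul δ⁻¹
    refine squeeze_zero_norm (fun i => ?_) h3
    have hi := h.sol_spec (s i) (hs i) v
    have : IsTruncSol h.op (s i) (hs i) (w i) (h.sol (s i) (hs i) v - proj (s i) (hs i) u) := by
      refine ⟨by rw [map_sub, hi.supp, proj_proj], ?_⟩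
      simp only [w, map_sub]
      rw [← hi.eq]; abel
    have h4 := this.norm_le h.op_bddBelow
    rw [inv_mul_eq_div, le_div_iff₀ h.pos]
    linarith
  simpa using hdiff.add hPu

/-! ### Solutions on `[0, x]` -/

/-- The solution of `u + H u = v` on `[0, x]`. -/
noncomputable def solIcc (x : ℝ) (v : L2R) : L2R := h.sol (Icc 0 x) measurableSet_Icc v

theorem continuous_solIcc (v : L2R) : Continuous fun x => h.solIcc x v := by
  rw [continuous_iff_continuousAt]
  intro x
  refine h.tendsto_sol (fun y => measurableSet_Icc) measurableSet_Icc ?_ v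
  -- Membership of `t` in `[0, y]` is locally constant in `y` near `x` except at the single point `t
  -- = x`.
  filter_upwards [compl_mem_ae_iff.2 (measure_singleton x)] with t ht
  have ht : t ≠ x := ht
  rcases lt_or_gt_of_ne ht with h1 | h1
  · filter_upwards [eventually_gt_nhds h1] with y hy
    simp [mem_Icc, hy.le, h1.le]
  · filter_upwards [eventually_lt_nhds h1] with y hy
    simp [mem_Icc, not_le.2 hy, not_le.2 h1]

theorem tendsto_solIcc_atTop (v : L2R) :
    Tendsto (fun x => h.solIcc x v) atTop (𝓝 (h.sol (Ici 0) measurableSet_Ici v)) := by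
  refine h.tendsto_sol (fun y => measurableSet_Icc) measurableSet_Ici
    (Eventually.of_forall fun t => ?_) v
  filter_upwards [eventually_ge_atTop t] with y hy
  simp [mem_Icc, hy]

/-- `Γ_x(·, 0)` as an element of `L²(ℝ)`. -/
noncomputable def g (x : ℝ) : L2R := h.solIcc x h.toL2

/-- `Γ(·) = lim Γ_x(·, 0)` as an element of `L²(ℝ)`. -/
noncomputable def gLim : L2R := h.sol (Ici 0) measurableSet_Ici h.toL2

theorem continuous_g : Continuous h.g := h.continuous_solIcc _

theorem tendsto_g : Tendsto h.g atTop (𝓝 h.gLim) := h.tendsto_solIcc_atTop _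

theorem solIcc_ae (x : ℝ) (v : L2R) :
    ∀ᵐ t, t ∈ Icc 0 x → h.solIcc x v t = v t - h.conv (h.solIcc x v) t := h.sol_ae v

theorem integral_conv_eq {x : ℝ} (hx : 0 ≤ x) {G : ℝ → ℝ} {u : L2R}
    (hu : u =ᵐ[volume] (Icc 0 x).indicator G) (t : ℝ) :
    ∫ s in (0 : ℝ)..x, H (t - s) * G s = h.conv u t := by
  rw [intervalIntegral.integral_of_le hx, ← integral_Icc_eq_integral_Ioc, conv_eq,
    ← integral_indicator measurableSet_Icc]
  refine integral_congr_ae ?_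
  filter_upwards [hu] with s hs
  rw [hs]
  by_cases h1 : s ∈ Icc 0 x
  · rw [indicator_of_mem h1, indicator_of_mem h1]
  · rw [indicator_of_notMem h1, indicator_of_notMem h1, mul_zero]

/-- A pointwise solution gives a class in `L²`, which is unique. That class determines the
convolution at every point, so the equation recovers `G` everywhere on `[0, x]`, not merely almost
everywhere. -/
theorem eq_solIcc {x : ℝ} (hx : 0 ≤ x) {G φ : ℝ → ℝ} (hφ : MemLp φ 2)
    (hG : MemLp G 2 (volume.restrict (Icc 0 x)))
    (heq : ∀ t ∈ Icc 0 x, G t + ∫ s in (0 : ℝ)..x, H (t - s) * G s = φ t) :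
    h.solIcc x (hφ.toLp φ) =ᵐ[volume] (Icc 0 x).indicator G ∧
      ∀ t ∈ Icc 0 x, G t = φ t - h.conv (h.solIcc x (hφ.toLp φ)) t := by
  have hG' : MemLp ((Icc 0 x).indicator G) 2 volume :=
    (memLp_indicator_iff_restrict measurableSet_Icc).2 hG
  set u : L2R := hG'.toLp _
  have hu : u =ᵐ[volume] (Icc 0 x).indicator G := hG'.coeFn_toLp
  have hc := h.integral_conv_eq hx hu
  have hsol : IsTruncSol h.op (Icc 0 x) measurableSet_Icc (hφ.toLp φ) u := by
    constructor
    · refine Lp.ext ?_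
      filter_upwards [proj_coe (measurableSet_Icc (a := (0 : ℝ)) (b := x)) u, hu] with t h1 h2
      rw [h1]
      by_cases ht : t ∈ Icc 0 x
      · rw [indicator_of_mem ht]
      · rw [indicator_of_notMem ht, h2, indicator_of_notMem ht]
    · refine Lp.ext ?_
      filter_upwards [Lp.coeFn_add u (proj (Icc 0 x) measurableSet_Icc (h.op u)), hu,
        proj_coe (measurableSet_Icc (a := (0 : ℝ)) (b := x)) (h.op u), h.op_coe u,
        proj_coe (measurableSet_Icc (a := (0 : ℝ)) (b := x)) (hφ.toLp φ), hφ.coeFn_toLp]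
        with t h1 h2 h3 h4 h5 h6
      rw [h1, Pi.add_apply, h2, h3, h5]
      by_cases ht : t ∈ Icc 0 x
      · rw [indicator_of_mem ht, indicator_of_mem ht, indicator_of_mem ht, h4, h6, ← heq t ht, hc]
      · rw [indicator_of_notMem ht, indicator_of_notMem ht, indicator_of_notMem ht, add_zero]
  have hus : u = h.solIcc x (hφ.toLp φ) := h.eq_sol hsol
  rw [← hus]
  exact ⟨hu, fun t ht => by rw [← hc, ← heq t ht]; ring⟩

theorem solIcc_solves {x : ℝ} (hx : 0 ≤ x) {φ : ℝ → ℝ} (hφ : MemLp φ 2) :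
    let G := fun t => φ t - h.conv (h.solIcc x (hφ.toLp φ)) t
    MemLp G 2 (volume.restrict (Icc 0 x)) ∧
      ∀ t ∈ Icc 0 x, G t + ∫ s in (0 : ℝ)..x, H (t - s) * G s = φ t := by
  intro G
  set u := h.solIcc x (hφ.toLp φ)
  have hGu : u =ᵐ[volume] (Icc 0 x).indicator G := by
    filter_upwards [h.solIcc_ae x (hφ.toLp φ), h.sol_ae_zero (S := Icc 0 x)
      (hS := measurableSet_Icc) (hφ.toLp φ), hφ.coeFn_toLp] with t h1 h2 h3
    by_cases ht : t ∈ Icc 0 x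
    · rw [indicator_of_mem ht, h1 ht, h3]
    · rw [indicator_of_notMem ht]; exact h2 ht
  refine ⟨(memLp_indicator_iff_restrict measurableSet_Icc).1 ((memLp_coe u).ae_eq hGu),
    fun t _ => ?_⟩
  rw [h.integral_conv_eq hx hGu]
  exact sub_add_cancel _ _

theorem memLp_shift (s : ℝ) : MemLp (fun t => H (t - s)) 2 volume :=
  h.memLp.comp_measurePreserving (measurePreserving_translate s)

theorem exists_unique_kernel {x : ℝ} (hx : 0 ≤ x) : ∃ G : ℝ → ℝ → ℝ, IsKreinKernel H x G ∧
    ∀ G' : ℝ → ℝ → ℝ, IsKreinKernel H x G' →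
      ∀ t ∈ Icc 0 x, ∀ s ∈ Icc 0 x, G' t s = G t s :=
  ⟨fun t s => H (t - s) - h.conv (h.solIcc x ((h.memLp_shift s).toLp _)) t,
    fun s _ => h.solIcc_solves hx (h.memLp_shift s),
    fun _ hG' t ht s hs => (h.eq_solIcc hx (h.memLp_shift s) (hG' s hs).1 (hG' s hs).2).2 t ht⟩

theorem kernel_zero {Γ : ℝ → ℝ → ℝ} {x : ℝ} (hx : 0 ≤ x) (hΓ : IsKreinKernel H x Γ) :
    h.g x =ᵐ[volume] (Icc 0 x).indicator (fun t => Γ t 0) ∧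
      ∀ t ∈ Icc 0 x, Γ t 0 = H t - h.conv (h.g x) t := by
  have h0 := hΓ 0 ⟨le_rfl, hx⟩
  simp only [sub_zero] at h0
  exact h.eq_solIcc hx h.memLp h0.1 h0.2

/-! ### The limit `x → ∞` -/

/-- The pointwise limit of `Γ_x(s, 0)`. -/
noncomputable def gammaLim (s : ℝ) : ℝ := H s - h.conv h.gLim s

/-- Convergence in `L²` suffices for convergence at each point, since the convolution at `s` is the
inner product with a fixed translate of `H`. -/
theorem tendsto_kernel {Γ : ℝ → ℝ → ℝ → ℝ} (hΓ : ∀ x : ℝ, 0 ≤ x → IsKreinKernel H x (Γ x))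
    {s : ℝ} (hs : 0 ≤ s) : Tendsto (fun x => Γ x s 0) atTop (𝓝 (h.gammaLim s)) := by
  have h1 : Tendsto (fun x => H s - h.conv (h.g x) s) atTop (𝓝 (h.gammaLim s)) :=
    tendsto_const_nhds.sub (tendsto_const_nhds.inner h.tendsto_g)
  refine h1.congr' ?_
  filter_upwards [eventually_ge_atTop s] with x hx
  exact ((h.kernel_zero (hs.trans hx) (hΓ x (hs.trans hx))).2 s ⟨hs, hx⟩).symm

theorem gLim_ae : h.gLim =ᵐ[volume] (Ici 0).indicator h.gammaLim := by
  filter_upwards [h.sol_ae (S := Ici 0) (hS := measurableSet_Ici) h.toL2,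
    h.sol_ae_zero (S := Ici 0) (hS := measurableSet_Ici) h.toL2, h.memLp.coeFn_toLp]
    with t h1 h2 h3
  by_cases ht : t ∈ Ici (0 : ℝ)
  · rw [indicator_of_mem ht]; rw [toL2, h3] at h1; exact h1 ht
  · rw [indicator_of_notMem ht]; exact h2 ht

theorem exists_sol_bound : ∃ C : ℝ, 0 < C ∧ ∀ x, ∀ v u : L2R,
    IsTruncSol h.op (Icc 0 x) measurableSet_Icc v u →
      Integrable u ∧ ∫ t, |u t| ≤ C * ∫ t, |proj (Icc 0 x) measurableSet_Icc v t| := by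
  obtain ⟨C, hC, hb⟩ := exists_integral_abs_bound h.integrable h.memLp h.pos h.bddBelow
  refine ⟨C, hC, fun x v u hu => ⟨integrable_of_proj_eq (by simp) hu.supp,
    hb _ _ |x| (fun t ht => ?_) v u hu⟩⟩
  exact ⟨(neg_nonpos.2 (abs_nonneg x)).trans ht.1, ht.2.trans (le_abs_self x)⟩

theorem integrable_toL2 : Integrable h.toL2 := h.integrable.congr h.memLp.coeFn_toLp.symm

theorem integral_abs_toL2 : ∫ t, |h.toL2 t| = ∫ t, |H t| :=
  integral_congr_ae (h.memLp.coeFn_toLp.mono fun t ht => by simp only [toL2, ht])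

theorem integrable_g (x : ℝ) : Integrable (h.g x) :=
  integrable_of_proj_eq (by simp) (h.sol_spec (Icc 0 x) measurableSet_Icc h.toL2).supp

theorem exists_integral_g_le : ∃ K : ℝ, 0 < K ∧ ∀ x, ∫ t, |h.g x t| ≤ K := by
  obtain ⟨C, hC, hb⟩ := h.exists_sol_bound
  have hI : 0 ≤ ∫ t, |H t| := integral_nonneg fun _ => abs_nonneg _
  refine ⟨C * (∫ t, |H t|) + 1, by positivity, fun x => ?_⟩
  have h1 := (hb x _ _ (h.sol_spec (Icc 0 x) measurableSet_Icc h.toL2)).2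
  have h2 := integral_abs_proj_le (S := Icc 0 x) (hS := measurableSet_Icc) h.integrable_toL2
  rw [h.integral_abs_toL2] at h2
  have h3 := mul_le_mul_of_nonneg_left h2 hC.le
  exact (h1.trans h3).trans (by linarith)

omit h in
theorem setIntegral_abs_le (R : ℝ) (w : L2R) : ∫ t in Icc 0 R, |w t| ≤
    ‖indicatorConstLp 2 (measurableSet_Icc (a := 0) (b := R)) (by simp) (1 : ℝ)
      (μ := (volume : Measure ℝ))‖ * ‖w‖ := by
  have hw : MemLp (fun t => |w t|) 2 volume := (memLp_coe w).norm
  have h1 : ∫ t in Icc 0 R, |w t| = ⟪indicatorConstLp 2 (measurableSet_Icc (a := 0) (b := R))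
      (by simp) (1 : ℝ), hw.toLp _⟫ := by
    rw [L2.inner_indicatorConstLp_one]
    exact setIntegral_congr_ae measurableSet_Icc (hw.coeFn_toLp.mono fun t ht _ => ht.symm)
  rw [h1]
  refine (real_inner_le_norm _ _).trans (mul_le_mul_of_nonneg_left ?_ (norm_nonneg _))
  refine Lp.norm_le_norm_of_ae_le ?_
  filter_upwards [hw.coeFn_toLp] with t ht
  rw [ht]; simp

/-- On `[0, R]` the `L²` convergence implies `L¹` convergence, so the limit inherits the `L¹` bound
`K` of `Γ_x(·,0)`. As `K` does not depend on `R`, integrability on the half-line follows. -/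
theorem integrable_gLim : Integrable h.gLim := by
  obtain ⟨K, hK, hg⟩ := h.exists_integral_g_le
  have hloc : ∀ (w : L2R) (R : ℝ), IntegrableOn w (Icc 0 R) := fun w R =>
    ((memLp_coe w).restrict _).integrable (by norm_num)
  have hb : ∀ R, ∫ t in Icc 0 R, |h.gLim t| ≤ K := fun R => by
    set c := ‖indicatorConstLp 2 (measurableSet_Icc (a := 0) (b := R)) (by simp) (1 : ℝ)
      (μ := (volume : Measure ℝ))‖
    have hlim : Tendsto (fun x => K + c * ‖h.gLim - h.g x‖) atTop (𝓝 (K + c * 0)) := by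
      refine tendsto_const_nhds.add (Tendsto.const_mul _ ?_)
      have := (tendsto_const_nhds (x := h.gLim)).sub h.tendsto_g
      simpa using this.norm
    rw [mul_zero, add_zero] at hlim
    refine ge_of_tendsto' hlim fun x => ?_
    calc ∫ t in Icc 0 R, |h.gLim t| ≤
          ∫ t in Icc 0 R, (|h.g x t| + |(h.gLim - h.g x) t|) := by
          refine integral_mono_ae (hloc _ R).abs ((hloc _ R).abs.add (hloc _ R).abs) ?_
          filter_upwards [ae_restrict_of_ae (Lp.coeFn_sub h.gLim (h.g x))] with t ht
          simp only [ht, Pi.sub_apply]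
          calc |h.gLim t| = |h.g x t + (h.gLim t - h.g x t)| := by ring_nf
            _ ≤ _ := abs_add_le _ _
      _ = (∫ t in Icc 0 R, |h.g x t|) + ∫ t in Icc 0 R, |(h.gLim - h.g x) t| :=
          integral_add (hloc _ R).abs (hloc _ R).abs
      _ ≤ _ := by
          refine add_le_add ((setIntegral_le_integral (h.integrable_g x).abs
            (Eventually.of_forall fun _ => abs_nonneg _)).trans (hg x)) ?_
          exact setIntegral_abs_le R _
  have hIoi : IntegrableOn h.gLim (Ioi 0) := by
    refine integrableOn_Ioi_of_intervalIntegral_norm_bounded K 0 (l := atTop) (b := fun x : ℝ => x)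
      (fun R => (hloc _ R).mono_set Ioc_subset_Icc_self) tendsto_id ?_
    filter_upwards [eventually_ge_atTop 0] with R hR
    rw [intervalIntegral.integral_of_le hR, ← integral_Icc_eq_integral_Ioc]
    exact hb R
  rw [← integrableOn_Ici_iff_integrableOn_Ioi] at hIoi
  refine (hIoi.integrable_indicator measurableSet_Ici).congr ?_
  have := proj_coe (measurableSet_Ici (a := (0 : ℝ))) h.gLim
  rw [gLim, (h.sol_spec (Ici 0) measurableSet_Ici h.toL2).supp] at this
  exact this.symm

theorem integrableOn_gammaLim : IntegrableOn h.gammaLim (Ici 0) := by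
  have h1 : IntegrableOn h.gLim (Ici 0) := h.integrable_gLim.integrableOn
  refine h1.congr ?_
  filter_upwards [ae_restrict_of_ae h.gLim_ae, ae_restrict_mem measurableSet_Ici] with t h1 h2
  rw [h1, indicator_of_mem h2]

omit h in
theorem integral_abs_sub_proj_tendsto {f : L2R} (hf : Integrable f)
    (hsupp : proj (Ici 0) measurableSet_Ici f = f) :
    Tendsto (fun x => ∫ t, |(f - proj (Icc 0 x) measurableSet_Icc f) t|) atTop (𝓝 0) := by
  have h1 : Tendsto (fun x : ℝ => ∫ t, |(Iic x)ᶜ.indicator f t|) atTop (𝓝 (∫ _ : ℝ, (0 : ℝ))) := by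
    refine tendsto_integral_filter_of_dominated_convergence (fun t => |f t|)
      (Eventually.of_forall fun x => (hf.indicator measurableSet_Iic.compl).abs.1)
      (Eventually.of_forall fun x => Eventually.of_forall fun t => ?_) hf.abs
      (Eventually.of_forall fun t => ?_)
    · by_cases ht : t ∈ (Iic x)ᶜ
      · rw [indicator_of_mem ht]; simp
      · rw [indicator_of_notMem ht]; simp
    · refine tendsto_const_nhds.congr' ?_
      filter_upwards [eventually_ge_atTop t] with x hx
      simp [hx]
  rw [integral_zero] at h1
  refine h1.congr fun x => integral_congr_ae ?_
  have hs := proj_coe (measurableSet_Ici (a := (0 : ℝ))) f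
  rw [hsupp] at hs
  filter_upwards [Lp.coeFn_sub f (proj (Icc 0 x) measurableSet_Icc f), hs,
    proj_coe (measurableSet_Icc (a := (0 : ℝ)) (b := x)) f] with t h1 h2 h3
  rw [h1, Pi.sub_apply, h3]
  by_cases ht : t ∈ Ici (0 : ℝ)
  · have h0 : 0 ≤ t := ht
    by_cases hx : t ≤ x
    · simp [indicator, h0, hx]
    · simp [indicator, h0, hx, not_le.1 hx]
  · rw [indicator_of_notMem ht] at h2
    simp [indicator, h2]

/-- The equation for the error of the finite section approximation. -/
theorem isTruncSol_gLim_sub (x : ℝ) : IsTruncSol h.op (Icc 0 x) measurableSet_Icc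
    (-h.op (h.gLim - proj (Icc 0 x) measurableSet_Icc h.gLim))
    (proj (Icc 0 x) measurableSet_Icc h.gLim - h.g x) := by
  set γ := h.gLim
  have hγ := h.sol_spec (Ici 0) measurableSet_Ici h.toL2
  set P := proj (Icc 0 x) measurableSet_Icc
  have hg := h.sol_spec (Icc 0 x) measurableSet_Icc h.toL2
  have hPP : ∀ w, P (P w) = P w := proj_proj measurableSet_Icc
  have hPQ : ∀ w, P (proj (Ici 0) measurableSet_Ici w) = P w := fun w => by
    have h1 : proj (Ici (0 : ℝ)) measurableSet_Ici (P w) = P w :=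
      proj_proj_of_subset _ _ Icc_subset_Ici_self w
    rw [← h1]
    exact mulOp_comm _ _ _
  have hgx : P (h.g x) = h.g x := hg.supp
  refine ⟨by rw [map_sub]; exact congrArg₂ _ (hPP _) hgx, ?_⟩
  have h2 : P γ + P (h.op γ) = P h.toL2 := by
    have := congrArg P hγ.eq
    rw [map_add, hPQ, hPQ] at this
    exact this
  have h3 : h.g x + P (h.op (h.g x)) = P h.toL2 := hg.eq
  change P γ - h.g x + P (h.op (P γ - h.g x)) = P (-h.op (γ - P γ))
  simp only [map_sub, map_neg]
  calc P γ - h.g x + (P (h.op (P γ)) - P (h.op (h.g x)))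
      = (P γ + P (h.op γ)) - (h.g x + P (h.op (h.g x))) - (P (h.op γ) - P (h.op (P γ))) := by
        abel
    _ = -(P (h.op γ) - P (h.op (P γ))) := by rw [h2, h3]; abel

/-- `Γ_x(·, 0) → Γ` in `L¹`. -/
theorem tendsto_integral_abs_sub :
    Tendsto (fun x => ∫ t, |(h.gLim - h.g x) t|) atTop (𝓝 0) := by
  obtain ⟨C, hC, hb⟩ := h.exists_sol_bound
  set γ := h.gLim
  have hγi := h.integrable_gLim
  have htail := integral_abs_sub_proj_tendsto hγi
    (h.sol_spec (Ici 0) measurableSet_Ici h.toL2).supp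
  set M := ∫ r, |H r|
  -- The error is the tail `d` of `Γ` beyond `x` plus the solution of a truncated equation with
  -- source `-H * d`, whose `L¹` norm is at most `C M ‖d‖₁`.
  have hlim : Tendsto (fun x => (1 + C * M) *
      ∫ t, |(γ - proj (Icc 0 x) measurableSet_Icc γ) t|) atTop (𝓝 0) := by
    simpa using htail.const_mul (1 + C * M)
  refine squeeze_zero (fun x => integral_nonneg fun _ => abs_nonneg _) (fun x => ?_) hlim
  set P := proj (Icc 0 x) measurableSet_Icc
  set d := γ - P γ
  have hPi : Integrable (P γ) := integrable_proj hγi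
  have hdi : Integrable d := (hγi.sub hPi).congr (Lp.coeFn_sub γ (P γ)).symm
  have he : IsTruncSol h.op (Icc 0 x) measurableSet_Icc (-h.op d) (P γ - h.g x) :=
    h.isTruncSol_gLim_sub x
  obtain ⟨hei, heb⟩ := hb x _ _ he
  have hop := convOp_integrable h.integrable hdi
  have hopn : ∫ t, |(-h.op d : L2R) t| ≤ M * ∫ t, |d t| := by
    refine le_trans (le_of_eq (integral_congr_ae ?_)) hop.2
    filter_upwards [Lp.coeFn_neg (h.op d)] with t ht
    rw [ht, Pi.neg_apply, abs_neg]; rfl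
  have hopi : Integrable (-h.op d : L2R) := hop.1.neg.congr (Lp.coeFn_neg (h.op d)).symm
  have h6 : ∫ t, |(P γ - h.g x : L2R) t| ≤ C * (M * ∫ t, |d t|) :=
    heb.trans (mul_le_mul_of_nonneg_left ((integral_abs_proj_le hopi).trans hopn) hC.le)
  have h7 : ∫ t, |(γ - h.g x : L2R) t| ≤ (∫ t, |d t|) + ∫ t, |(P γ - h.g x : L2R) t| := by
    have hi : Integrable (γ - h.g x : L2R) :=
      (hγi.sub (h.integrable_g x)).congr (Lp.coeFn_sub γ (h.g x)).symm
    rw [← integral_add hdi.abs hei.abs]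
    refine integral_mono_ae hi.abs (hdi.abs.add hei.abs) ?_
    filter_upwards [Lp.coeFn_sub γ (h.g x), Lp.coeFn_sub γ (P γ), Lp.coeFn_sub (P γ) (h.g x)]
      with t h1 h2 h3
    simp only [d, h1, h2, h3, Pi.sub_apply]
    exact abs_sub_le _ _ _
  linarith

end IsAccelerant

end Krein

/-! ### Dependence of `Γ_x(·,0)` on `x` -/

namespace Krein

open scoped RealInnerProductSpace

/-! ### Reflections -/

theorem measurePreserving_reflect (x : ℝ) :
    MeasurePreserving (fun t : ℝ => x - t) volume volume :=
  Measure.measurePreserving_sub_left volume x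

/-- Reflection `u ↦ u(x - ·)` on `L²(ℝ)`. -/
noncomputable def refl (x : ℝ) : L2R →ₗᵢ[ℝ] L2R :=
  Lp.compMeasurePreservingₗᵢ ℝ (fun t : ℝ => x - t) (measurePreserving_reflect x)

theorem refl_coe (x : ℝ) (u : L2R) : refl x u =ᵐ[volume] fun t => u (x - t) :=
  Lp.coeFn_compMeasurePreserving u (measurePreserving_reflect x)

theorem ae_reflect (x : ℝ) {p : ℝ → Prop} (hp : ∀ᵐ t, p t) : ∀ᵐ t, p (x - t) :=
  (measurePreserving_reflect x).quasiMeasurePreserving.ae hp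

theorem refl_eq_trans (x : ℝ) (u : L2R) : refl x u = trans x (refl 0 u) := by
  refine Lp.ext ?_
  have h1 := (measurePreserving_translate x).quasiMeasurePreserving.ae (refl_coe 0 u)
  filter_upwards [refl_coe x u, trans_coe x (refl 0 u), h1] with t h1 h2 h3
  rw [h1, h2, h3]; congr 1; ring

theorem continuous_refl_pair : Continuous fun p : ℝ × L2R => refl p.1 p.2 := by
  have : (fun p : ℝ × L2R => refl p.1 p.2) = fun p => trans p.1 (refl 0 p.2) :=
    funext fun p => refl_eq_trans p.1 p.2
  rw [this]
  exact continuous_trans_pair.comp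
    (continuous_fst.prodMk ((refl 0).continuous.comp continuous_snd))

theorem inner_refl (x : ℝ) (u v : L2R) : ⟪refl x u, v⟫ = ⟪u, refl x v⟫ := by
  rw [inner_eq_integral, inner_eq_integral, ← integral_sub_left_eq_self _ volume x]
  refine integral_congr_ae ?_
  filter_upwards [refl_coe x v, ae_reflect x (refl_coe x u)] with t h1 h2
  rw [h2, h1]; ring_nf

namespace IsAccelerant

variable {H : ℝ → ℝ} {δ : ℝ} (h : IsAccelerant H δ)
include h

theorem conv_refl (x t : ℝ) (u : L2R) : h.conv (refl x u) t = h.conv u (x - t) := by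
  rw [conv_eq, conv_eq, ← integral_sub_left_eq_self _ volume x]
  refine integral_congr_ae ?_
  filter_upwards [ae_reflect x (refl_coe x u)] with s hs
  rw [hs, ← h.even]; ring_nf

theorem op_refl (x : ℝ) (u : L2R) : h.op (refl x u) = refl x (h.op u) := by
  refine Lp.ext ?_
  filter_upwards [h.op_coe (refl x u), refl_coe x (h.op u), ae_reflect x (h.op_coe u)]
    with t h1 h2 h3
  rw [h1, h2, h3, conv_refl]

theorem refl_toL2 (x : ℝ) : refl x h.toL2 = trans x h.toL2 := by
  refine Lp.ext ?_
  filter_upwards [refl_coe x h.toL2, h.trans_toL2_coe x, ae_reflect x h.memLp.coeFn_toLp]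
    with t h1 h2 h3
  rw [h1, h2, ← h3]; rfl

omit h in
theorem proj_refl (x : ℝ) (u : L2R) : proj (Icc 0 x) measurableSet_Icc (refl x u) =
    refl x (proj (Icc 0 x) measurableSet_Icc u) := by
  refine Lp.ext ?_
  have hP := proj_coe (measurableSet_Icc (a := (0 : ℝ)) (b := x))
  filter_upwards [hP (refl x u), refl_coe x (proj (Icc 0 x) measurableSet_Icc u), refl_coe x u,
    ae_reflect x (hP u)] with t h1 h2 h3 h4
  rw [h1, h2, h4]
  have : t ∈ Icc 0 x ↔ x - t ∈ Icc 0 x := by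
    simp only [mem_Icc]; constructor <;> rintro ⟨h1, h2⟩ <;> constructor <;> linarith
  by_cases ht : t ∈ Icc 0 x
  · rw [indicator_of_mem ht, indicator_of_mem (this.1 ht), h3]
  · rw [indicator_of_notMem ht, indicator_of_notMem (mt this.2 ht)]

theorem g_spec (x : ℝ) : IsTruncSol h.op (Icc 0 x) measurableSet_Icc h.toL2 (h.g x) :=
  h.sol_spec _ _ _

/-- `Γ_x(x - ·, 0) = Γ_x(·, x)`. -/
theorem refl_g_spec (x : ℝ) :
    IsTruncSol h.op (Icc 0 x) measurableSet_Icc (trans x h.toL2) (refl x (h.g x)) := by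
  have hg := h.g_spec x
  refine ⟨by rw [proj_refl, hg.supp], ?_⟩
  rw [op_refl, proj_refl, ← map_add, hg.eq, ← proj_refl, refl_toL2]

/-- The weak form of the truncated equation, with the symmetric operator moved onto the test
function. Using it twice yields the symmetry of the truncated resolvent. -/
theorem inner_proj_eq {S : Set ℝ} {hS : MeasurableSet S} {v u w : L2R}
    (hu : IsTruncSol h.op S hS v u) (hw : proj S hS w = w) :
    ⟪v, w⟫ = ⟪u, w⟫ + ⟪u, h.op w⟫ := by
  rw [← hw, ← proj_inner, ← hu.eq, inner_add_left, proj_inner, hw, op_inner]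

/-- The value at the endpoint `x` is the pairing of `u` with `H(x - ·)`. The truncated solution for
this source is the reflected `Γ_x(·,0)`, and symmetry of the resolvent transfers the pairing to `v`.
-/
theorem conv_self_eq {x : ℝ} {v u : L2R}
    (hu : IsTruncSol h.op (Icc 0 x) measurableSet_Icc v u) :
    h.conv u x = ⟪refl x (h.g x), proj (Icc 0 x) measurableSet_Icc v⟫ := by
  have hr := h.refl_g_spec x
  rw [conv, h.inner_proj_eq hr hu.supp, ← hu.eq, inner_add_right, ← proj_inner, hr.supp]

theorem inner_refl_g_proj (x : ℝ) (v : L2R) :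
    ⟪refl x (h.g x), proj (Icc 0 x) measurableSet_Icc v⟫ = ⟪refl x (h.g x), v⟫ := by
  rw [← proj_inner, (h.refl_g_spec x).supp]

/-! ### The derivative of `⟪Γ_x(·, 0), v⟫` -/

/-- With `ψ` the solution on `[0, x]` for the source `v`, symmetry gives `⟪g x, v⟫ = ⟪H, ψ⟫`. As `ψ`
is also supported in `[0, y]`, testing the equation of `g y` with it gives `⟪g y, ψ + H * ψ⟫` for
the same number. -/
theorem inner_g_sub {x y : ℝ} (hxy : x ≤ y) (v : L2R) :
    ⟪h.g y, v⟫ - ⟪h.g x, v⟫ = ⟪h.g y, v - h.solIcc x v - h.op (h.solIcc x v)⟫ := by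
  set ψ := h.solIcc x v
  have hψ : IsTruncSol h.op (Icc 0 x) measurableSet_Icc v ψ := h.sol_spec _ _ _
  have h1 : ⟪h.g x, v⟫ = ⟪h.toL2, ψ⟫ := by
    rw [h.inner_proj_eq (h.g_spec x) hψ.supp, real_inner_comm,
      h.inner_proj_eq hψ (h.g_spec x).supp, real_inner_comm, real_inner_comm (h.op (h.g x)),
      op_inner]
  have h2 : proj (Icc 0 y) measurableSet_Icc ψ = ψ := by
    rw [← hψ.supp]
    exact proj_proj_of_subset _ _ (Icc_subset_Icc_right hxy) ψ
  rw [h1, h.inner_proj_eq (h.g_spec y) h2, inner_sub_right, inner_sub_right]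
  ring

/-- The function `Γ_x(u, 0) = H(u) - ∫ H(u - s) Γ_x(s, 0) ds`. -/
noncomputable def gPt (x u : ℝ) : ℝ := H u - h.conv (h.g x) u

/-- The function `a(x) = Γ_x(x, 0)`. -/
noncomputable def a (x : ℝ) : ℝ := h.gPt x x

/-- The residual `v - ψ - H * ψ` vanishes on `[0, x]` and `g y` vanishes outside `[0, y]`, so only
`(x, y]` contributes; there `ψ = 0`. -/
theorem inner_g_sub_eq_integral {x y X : ℝ} (hx : 0 ≤ x) (hxy : x ≤ y) (hyX : y ≤ X) {v : L2R}
    {φ : ℝ → ℝ} (hv : ∀ᵐ t, t ∈ Icc 0 X → v t = φ t) :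
    ⟪h.g y, v⟫ - ⟪h.g x, v⟫ =
      ∫ u in x..y, h.gPt y u * (φ u - h.conv (h.solIcc x v) u) := by
  rw [h.inner_g_sub hxy, inner_eq_integral, intervalIntegral.integral_of_le hxy,
    ← integral_indicator measurableSet_Ioc]
  set ψ := h.solIcc x v
  refine integral_congr_ae ?_
  filter_upwards [h.sol_ae (S := Icc 0 y) (hS := measurableSet_Icc) h.toL2,
    h.sol_ae_zero (S := Icc 0 y) (hS := measurableSet_Icc) h.toL2, h.memLp.coeFn_toLp,
    h.sol_ae (S := Icc 0 x) (hS := measurableSet_Icc) v,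
    h.sol_ae_zero (S := Icc 0 x) (hS := measurableSet_Icc) v, hv, h.op_coe ψ,
    Lp.coeFn_sub v ψ, Lp.coeFn_sub (v - ψ) (h.op ψ)] with t h1 h2 h3 h4 h5 h6 h7 h8 h9
  rw [h9, Pi.sub_apply, h8, Pi.sub_apply, h7]
  change h.g y t * (v t - ψ t - h.conv ψ t) = _
  change _ → ψ t = _ at h4
  change _ → ψ t = _ at h5
  change _ → h.g y t = _ at h1
  change _ → h.g y t = _ at h2
  by_cases ht : t ∈ Icc 0 x
  · rw [h4 ht, indicator_of_notMem (fun hh => not_lt.2 ht.2 hh.1)]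
    simp only [solIcc, ψ]; ring
  · by_cases ht2 : t ∈ Icc 0 y
    · have ht3 : t ∈ Ioc x y := ⟨not_le.1 fun hh => ht ⟨ht2.1, hh⟩, ht2.2⟩
      rw [indicator_of_mem ht3, h5 ht, h6 ⟨ht2.1, ht2.2.trans hyX⟩, h1 ht2, gPt, sub_zero]
      rw [toL2, h3]; rfl
    · rw [h2 ht2, indicator_of_notMem (fun hh => ht2 ⟨hx.trans hh.1.le, hh.2⟩), zero_mul]

omit h in
-- A fundamental theorem of calculus for increments whose integrand depends on both endpoints: joint
-- continuity at the diagonal point is enough.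
theorem hasDerivAt_of_integral_kernel {F : ℝ → ℝ} {K : ℝ → ℝ → ℝ → ℝ} {x₀ : ℝ}
    (hK : ContinuousAt (fun p : ℝ × ℝ × ℝ => K p.1 p.2.1 p.2.2) (x₀, x₀, x₀))
    (hF : ∀ᶠ r in 𝓝 (0 : ℝ), ∀ x ∈ Icc (x₀ - |r|) (x₀ + |r|), ∀ y ∈ Icc (x₀ - |r|) (x₀ + |r|),
      x ≤ y → IntervalIntegrable (K x y) volume x y ∧ F y - F x = ∫ u in x..y, K x y u) :
    HasDerivAt F (K x₀ x₀ x₀) x₀ := by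
  rw [hasDerivAt_iff_isLittleO, isLittleO_iff]
  intro c hc
  obtain ⟨η, hη, hηK⟩ := Metric.continuousAt_iff.1 hK c hc
  obtain ⟨ρ, hρ, hρF⟩ := Metric.eventually_nhds_iff.1 hF
  have main : ∀ x y : ℝ, x ≤ y → |x - x₀| < η → |y - x₀| < η →
      IntervalIntegrable (K x y) volume x y → F y - F x = ∫ u in x..y, K x y u →
      ‖F y - F x - (y - x) * K x₀ x₀ x₀‖ ≤ c * |y - x| := by
    intro x y hxy hx hy hi hFe
    have h1 : F y - F x - (y - x) * K x₀ x₀ x₀ = ∫ u in x..y, (K x y u - K x₀ x₀ x₀) := by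
      rw [intervalIntegral.integral_sub hi (by simp), hFe]; simp
    rw [h1]
    refine intervalIntegral.norm_integral_le_of_norm_le_const fun u hu => ?_
    rw [uIoc_of_le hxy] at hu
    have hu' : |u - x₀| < η := by
      rw [abs_lt] at hx hy ⊢; constructor <;> linarith [hu.1, hu.2]
    have := hηK (x := (x, y, u)) (by
      simp only [Prod.dist_eq, Real.dist_eq]
      exact max_lt hx (max_lt hy hu'))
    rw [Real.dist_eq] at this
    exact this.le
  rw [Metric.eventually_nhds_iff]
  refine ⟨min η ρ, lt_min hη hρ, fun y hy => ?_⟩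
  rw [Real.dist_eq] at hy
  have hyη : |y - x₀| < η := hy.trans_le (min_le_left _ _)
  have h0 : |x₀ - x₀| < η := by simpa using hη
  have hF' := hρF (y := y - x₀) (by
    rw [Real.dist_eq, sub_zero]; exact hy.trans_le (min_le_right _ _))
  have hm1 : x₀ ∈ Icc (x₀ - |y - x₀|) (x₀ + |y - x₀|) := by
    constructor <;> linarith [abs_nonneg (y - x₀)]
  have hm2 : y ∈ Icc (x₀ - |y - x₀|) (x₀ + |y - x₀|) := by
    constructor <;> linarith [abs_le.1 (le_refl |y - x₀|)]
  rcases le_total x₀ y with hle | hle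
  · obtain ⟨h1, h2⟩ := hF' x₀ hm1 y hm2 hle
    simpa using main x₀ y hle h0 hyη h1 h2
  · obtain ⟨h1, h2⟩ := hF' y hm2 x₀ hm1 hle
    have := main y x₀ hle hyη h0 h1 h2
    rw [abs_sub_comm] at this
    refine le_of_eq_of_le ?_ this
    rw [← norm_neg]
    congr 1
    rw [smul_eq_mul]; ring

variable (hc : ContinuousOn H (Ioi 0))
include hc

theorem continuousAt_gPt {x u : ℝ} (hu : 0 < u) :
    ContinuousAt (fun p : ℝ × ℝ => h.gPt p.1 p.2) (x, u) := by
  unfold gPt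
  refine ContinuousAt.sub ?_ ?_
  · exact ContinuousAt.comp (f := fun p : ℝ × ℝ => p.2) (hc.continuousAt (Ioi_mem_nhds hu))
      continuousAt_snd
  · exact (h.continuous_conv_pair.comp
      (continuous_snd.prodMk (h.continuous_g.comp continuous_fst))).continuousAt

theorem continuousOn_a : ContinuousOn h.a (Ioi 0) := fun x hx =>
  (ContinuousAt.comp (f := fun y : ℝ => (y, y)) (h.continuousAt_gPt hc hx)
    (by fun_prop)).continuousWithinAt

/-- The weak form of `∂_x Γ_x(t,0) = -Γ_x(t,x) Γ_x(x,0)`, including the boundary term `a(x) φ(x)`.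
The pairing with `Γ_x(·,x)` appears through `conv_self_eq`. -/
theorem hasDerivAt_inner_g {x X : ℝ} (hx : 0 < x) (hxX : x < X) {v : L2R} {φ : ℝ → ℝ}
    (hφ : ContinuousOn φ (Ioi 0)) (hv : ∀ᵐ t, t ∈ Icc 0 X → v t = φ t) :
    HasDerivAt (fun y => ⟪h.g y, v⟫) (h.a x * (φ x - ⟪refl x (h.g x), v⟫)) x := by
  have hval : h.a x * (φ x - ⟪refl x (h.g x), v⟫) =
      h.gPt x x * (φ x - h.conv (h.solIcc x v) x) := by
    have h1 : IsTruncSol h.op (Icc 0 x) measurableSet_Icc v (h.solIcc x v) := h.sol_spec _ _ v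
    rw [h.conv_self_eq h1, inner_refl_g_proj]; rfl
  have hcφ : ∀ p : ℝ × ℝ, 0 < p.2 →
      ContinuousAt (fun p : ℝ × ℝ => φ p.2 - h.conv (h.solIcc p.1 v) p.2) p := fun p hp => by
    refine ContinuousAt.sub ?_ ?_
    · exact ContinuousAt.comp (f := fun p : ℝ × ℝ => p.2) (hφ.continuousAt (Ioi_mem_nhds hp))
        continuousAt_snd
    · exact (h.continuous_conv_pair.comp
        (continuous_snd.prodMk ((h.continuous_solIcc v).comp continuous_fst))).continuousAt
  rw [hval]
  refine hasDerivAt_of_integral_kernel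
    (K := fun x y u => h.gPt y u * (φ u - h.conv (h.solIcc x v) u)) ?_ ?_
  · refine ContinuousAt.mul ?_ ?_
    · exact ContinuousAt.comp (f := fun p : ℝ × ℝ × ℝ => (p.2.1, p.2.2))
        (h.continuousAt_gPt hc hx) (by fun_prop)
    · exact ContinuousAt.comp (x := ((x, x, x) : ℝ × ℝ × ℝ)) (f := fun p : ℝ × ℝ × ℝ => (p.1, p.2.2))
        (hcφ (x, x) hx) (by fun_prop)
  · have : ∀ᶠ r : ℝ in 𝓝 0, |r| < min x (X - x) := by
      have h1 : Continuous fun r : ℝ => |r| := continuous_abs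
      exact h1.tendsto' 0 0 abs_zero |>.eventually (gt_mem_nhds (lt_min hx (by linarith)))
    filter_upwards [this] with r hr y hy z hz hyz
    have hr1 := lt_min_iff.1 hr
    have hy0 : 0 < y := by linarith [hy.1]
    have hzX : z ≤ X := by linarith [hz.2]
    refine ⟨ContinuousOn.intervalIntegrable fun u hu => ?_,
      h.inner_g_sub_eq_integral hy0.le hyz hzX hv⟩
    rw [uIcc_of_le hyz] at hu
    have hu0 : 0 < u := hy0.trans_le hu.1
    refine (ContinuousAt.mul ?_ ?_).continuousWithinAt
    · exact ContinuousAt.comp (f := fun u : ℝ => (z, u)) (h.continuousAt_gPt hc hu0)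
        (by fun_prop)
    · exact ContinuousAt.comp (f := fun u : ℝ => (y, u)) (hcφ (y, u) hu0) (by fun_prop)

end IsAccelerant

end Krein

namespace Krein

open scoped RealInnerProductSpace

namespace IsAccelerant

variable {H : ℝ → ℝ} {δ : ℝ} (h : IsAccelerant H δ)
include h

/-! ### The Krein system -/

/-- The transform `∫_0^x Γ_x(s, 0) e^{iks} ds`. -/
noncomputable def gHat (k : ℂ) (x : ℝ) : ℂ := ∫ s, (h.g x s : ℂ) * Complex.exp (Complex.I * k * s)

theorem g_ae_zero (x : ℝ) : ∀ᵐ t, t ∉ Icc 0 x → h.g x t = 0 :=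
  h.sol_ae_zero (S := Icc 0 x) (hS := measurableSet_Icc) h.toL2

omit h in
/-- Truncation of a continuous function to `[0, X]`. -/
theorem memLp_indicator_of_continuous {φ : ℝ → ℝ} (hφ : Continuous φ) (X : ℝ) :
    MemLp ((Icc 0 X).indicator φ) 2 volume := by
  refine (memLp_indicator_iff_restrict measurableSet_Icc).2 ?_
  obtain ⟨C, hC⟩ := isCompact_Icc.exists_bound_of_continuousOn (hφ.continuousOn (s := Icc 0 X))
  refine MemLp.of_bound hφ.aestronglyMeasurable C ?_
  filter_upwards [ae_restrict_mem measurableSet_Icc] with t ht using hC t ht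

omit h in
theorem toLp_indicator_ae {φ : ℝ → ℝ} (hφ : Continuous φ) (X : ℝ) :
    ∀ᵐ t, t ∈ Icc 0 X → (memLp_indicator_of_continuous hφ X).toLp _ t = φ t := by
  filter_upwards [(memLp_indicator_of_continuous hφ X).coeFn_toLp] with t ht h1
  rw [ht, indicator_of_mem h1]

omit h in
theorem continuous_re_exp (k : ℂ) :
    Continuous fun s : ℝ => (Complex.exp (Complex.I * k * s)).re := by fun_prop

omit h in
theorem continuous_im_exp (k : ℂ) :
    Continuous fun s : ℝ => (Complex.exp (Complex.I * k * s)).im := by fun_prop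

omit h in
/-- The real part of `e^{iks}` on `[0, X]`. -/
noncomputable def expRe (k : ℂ) (X : ℝ) : L2R :=
  (memLp_indicator_of_continuous (continuous_re_exp k) X).toLp _

omit h in
/-- The imaginary part of `e^{iks}` on `[0, X]`. -/
noncomputable def expIm (k : ℂ) (X : ℝ) : L2R :=
  (memLp_indicator_of_continuous (continuous_im_exp k) X).toLp _

omit h in
theorem integrable_and_integral_mul_exp {w : L2R} {X : ℝ} (hw : ∀ᵐ t, t ∉ Icc 0 X → w t = 0)
    (k : ℂ) : Integrable (fun s => (w s : ℂ) * Complex.exp (Complex.I * k * s)) ∧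
      ∫ s, (w s : ℂ) * Complex.exp (Complex.I * k * s) =
        (⟪w, expRe k X⟫ : ℝ) + (⟪w, expIm k X⟫ : ℝ) * Complex.I := by
  have h1 := (integrable_mul_coe w (expRe k X)).ofReal (𝕜 := ℂ)
  have h2 := ((integrable_mul_coe w (expIm k X)).ofReal (𝕜 := ℂ)).mul_const Complex.I
  have hae : (fun s => (w s : ℂ) * Complex.exp (Complex.I * k * s)) =ᵐ[volume]
      fun s => ((w s * expRe k X s : ℝ) : ℂ) + ((w s * expIm k X s : ℝ) : ℂ) * Complex.I := by
    filter_upwards [hw, toLp_indicator_ae (continuous_re_exp k) X,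
      toLp_indicator_ae (continuous_im_exp k) X] with s h1 h2 h3
    by_cases hs : s ∈ Icc 0 X
    · rw [expRe, expIm, h2 hs, h3 hs]
      nth_rewrite 1 [← Complex.re_add_im (Complex.exp (Complex.I * k * s))]
      push_cast; ring
    · rw [h1 hs]; simp
  refine ⟨(h1.add h2).congr hae.symm, ?_⟩
  rw [integral_congr_ae hae, inner_eq_integral, inner_eq_integral, ← integral_complex_ofReal,
    ← integral_complex_ofReal, ← integral_mul_const]
  exact integral_add h1 h2

theorem gHat_eq {x X : ℝ} (hxX : x ≤ X) (k : ℂ) :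
    h.gHat k x = (⟪h.g x, expRe k X⟫ : ℝ) + (⟪h.g x, expIm k X⟫ : ℝ) * Complex.I := by
  refine (integrable_and_integral_mul_exp ?_ k).2
  filter_upwards [h.g_ae_zero x] with t ht h1
  exact ht fun h2 => h1 ⟨h2.1, h2.2.trans hxX⟩

theorem refl_g_ae_zero (x : ℝ) : ∀ᵐ t, t ∉ Icc 0 x → refl x (h.g x) t = 0 := by
  have h1 := proj_coe (measurableSet_Icc (a := (0 : ℝ)) (b := x)) (refl x (h.g x))
  rw [(h.refl_g_spec x).supp] at h1
  filter_upwards [h1] with t h2 ht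
  rw [h2, indicator_of_notMem ht]

theorem integral_refl_g_exp (k : ℂ) (x : ℝ) :
    ∫ s, (refl x (h.g x) s : ℂ) * Complex.exp (Complex.I * k * s) =
      Complex.exp (Complex.I * k * x) * h.gHat (-k) x := by
  rw [gHat, ← integral_const_mul, ← integral_sub_left_eq_self _ volume x]
  refine integral_congr_ae ?_
  filter_upwards [ae_reflect x (refl_coe x (h.g x))] with s hs
  rw [hs, sub_sub_cancel, mul_left_comm, ← Complex.exp_add]
  congr 2
  push_cast; ring

variable (hc : ContinuousOn H (Ioi 0))
include hc

/-- The weak derivative formula is applied to the real and imaginary parts of `e^{iks}`; the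
transform of the reflected kernel is `e^{ikx}` times the transform at `-k`. -/
theorem hasDerivAt_gHat (k : ℂ) {x : ℝ} (hx : 0 < x) :
    HasDerivAt (h.gHat k) (h.a x * (Complex.exp (Complex.I * k * x) * (1 - h.gHat (-k) x))) x := by
  have hX : x < x + 1 := by linarith
  have h1 := h.hasDerivAt_inner_g hc hx hX (continuous_re_exp k).continuousOn
    (toLp_indicator_ae (continuous_re_exp k) (x + 1))
  have h2 := h.hasDerivAt_inner_g hc hx hX (continuous_im_exp k).continuousOn
    (toLp_indicator_ae (continuous_im_exp k) (x + 1))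
  have h3 := (h1.ofReal_comp).add ((h2.ofReal_comp).mul_const Complex.I)
  have h4 := (integrable_and_integral_mul_exp (w := refl x (h.g x)) (X := x + 1) (by
    filter_upwards [h.refl_g_ae_zero x] with t ht h1
    exact ht fun h2 => h1 ⟨h2.1, h2.2.trans hX.le⟩) k).2
  rw [integral_refl_g_exp] at h4
  have hval : (h.a x : ℂ) * (Complex.exp (Complex.I * k * x) * (1 - h.gHat (-k) x)) =
      ((h.a x * ((Complex.exp (Complex.I * k * x)).re - ⟪refl x (h.g x), expRe k (x + 1)⟫) : ℝ) : ℂ)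
      + ((h.a x * ((Complex.exp (Complex.I * k * x)).im -
        ⟪refl x (h.g x), expIm k (x + 1)⟫) : ℝ) : ℂ) * Complex.I := by
    rw [mul_sub, mul_one, h4]
    nth_rewrite 1 [← Complex.re_add_im (Complex.exp (Complex.I * k * x))]
    push_cast; ring
  rw [hval]
  refine h3.congr_of_eventuallyEq ?_
  filter_upwards [eventually_lt_nhds hX] with y hy
  rw [h.gHat_eq hy.le]; rfl

omit hc

theorem g_zero : h.g 0 = 0 := by
  refine Lp.ext ?_
  filter_upwards [h.g_ae_zero 0, compl_mem_ae_iff.2 (measure_singleton (0 : ℝ)),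
    Lp.coeFn_zero ℝ 2 (volume : Measure ℝ)] with t h1 h2 h3
  rw [h3, h1 (fun h4 => h2 (le_antisymm h4.2 h4.1))]; rfl

theorem tendsto_gHat_zero (k : ℂ) : Tendsto (h.gHat k) (𝓝[>] 0) (𝓝 0) := by
  have h1 : Continuous fun y => ((⟪h.g y, expRe k 1⟫ : ℝ) : ℂ) +
      ((⟪h.g y, expIm k 1⟫ : ℝ) : ℂ) * Complex.I := by
    have := h.continuous_g
    fun_prop
  have h2 := h1.tendsto' 0 0 (by simp [h.g_zero])
  refine (h2.mono_left nhdsWithin_le_nhds).congr' ?_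
  filter_upwards [nhdsWithin_le_nhds (eventually_lt_nhds (zero_lt_one (α := ℝ)))] with y hy
  rw [h.gHat_eq hy.le]

omit h in
theorem norm_exp_le_one {k : ℂ} (hk : 0 ≤ k.im) {s : ℝ} (hs : 0 ≤ s) :
    ‖Complex.exp (Complex.I * k * s)‖ ≤ 1 := by
  rw [Complex.norm_exp, Real.exp_le_one_iff]
  have : (Complex.I * k * s).re = -(k.im * s) := by simp
  rw [this]
  have := mul_nonneg hk hs
  linarith

omit h in
theorem norm_integral_mul_exp_le {k : ℂ} (hk : 0 ≤ k.im) {w : L2R} (hw : Integrable w)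
    (hw0 : ∀ᵐ t, t ∉ Ici (0 : ℝ) → w t = 0) :
    Integrable (fun s => (w s : ℂ) * Complex.exp (Complex.I * k * s)) ∧
    ‖∫ s, (w s : ℂ) * Complex.exp (Complex.I * k * s)‖ ≤ ∫ s, |w s| := by
  have hb : ∀ᵐ s, ‖(w s : ℂ) * Complex.exp (Complex.I * k * s)‖ ≤ |w s| := by
    filter_upwards [hw0] with s hs
    rw [norm_mul, Complex.norm_real, Real.norm_eq_abs]
    by_cases h0 : s ∈ Ici (0 : ℝ)
    · exact mul_le_of_le_one_right (abs_nonneg _) (norm_exp_le_one hk h0)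
    · rw [hs h0]; simp
  have hm : AEStronglyMeasurable (fun s => (w s : ℂ) * Complex.exp (Complex.I * k * s)) volume :=
    (hw.ofReal (𝕜 := ℂ)).1.mul (Continuous.aestronglyMeasurable (by fun_prop))
  have hi := hw.abs.mono' hm hb
  exact ⟨hi, (norm_integral_le_integral_norm _).trans (integral_mono_ae hi.norm hw.abs hb)⟩

/-- The transform at `-k` may grow, but times `e^{ikx}` it is the transform at `k` of the reflected
kernel, whose exponential factor has modulus at most `1`. -/
theorem norm_exp_mul_one_sub_gHat_le {K : ℝ} (hK : ∀ x, ∫ t, |h.g x t| ≤ K) {k : ℂ}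
    (hk : 0 ≤ k.im) {x : ℝ} (hx : 0 ≤ x) :
    ‖Complex.exp (Complex.I * k * x) * (1 - h.gHat (-k) x)‖ ≤ 1 + K := by
  rw [mul_sub, mul_one, ← integral_refl_g_exp]
  have hg := h.integrable_g x
  have hi : Integrable (refl x (h.g x)) :=
    (hg.comp_sub_left x).congr (refl_coe x (h.g x)).symm
  have h1 : ∫ s, |refl x (h.g x) s| ≤ K := by
    refine le_of_eq_of_le ?_ (hK x)
    rw [← integral_sub_left_eq_self _ volume x]
    refine integral_congr_ae ?_
    filter_upwards [ae_reflect x (refl_coe x (h.g x))] with s hs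
    rw [hs, sub_sub_cancel]
  refine (norm_sub_le _ _).trans (add_le_add (norm_exp_le_one hk hx) ?_)
  refine (norm_integral_mul_exp_le hk hi ?_).2.trans h1
  filter_upwards [h.refl_g_ae_zero x] with t ht h1
  exact ht fun h2 => h1 h2.1

/-- The transform of `Γ`. -/
theorem integral_gLim_exp (k : ℂ) :
    ∫ s, (h.gLim s : ℂ) * Complex.exp (Complex.I * k * s) =
      ∫ s in Ioi (0 : ℝ), (h.gammaLim s : ℂ) * Complex.exp (Complex.I * k * s) := by
  rw [← integral_Ici_eq_integral_Ioi, ← integral_indicator measurableSet_Ici]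
  refine integral_congr_ae ?_
  filter_upwards [h.gLim_ae] with s hs
  rw [hs]
  by_cases h0 : s ∈ Ici (0 : ℝ)
  · rw [indicator_of_mem h0, indicator_of_mem h0]
  · rw [indicator_of_notMem h0, indicator_of_notMem h0]; simp

theorem tendsto_one_sub_gHat {k : ℂ} (hk : 0 ≤ k.im) :
    Tendsto (fun x => 1 - h.gHat k x) atTop (𝓝 (kreinF h.gammaLim k)) := by
  refine tendsto_const_nhds.sub ?_
  rw [← integral_gLim_exp, tendsto_iff_norm_sub_tendsto_zero]
  refine squeeze_zero (fun _ => norm_nonneg _) (fun x => ?_) h.tendsto_integral_abs_sub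
  have h0 : ∀ᵐ t, t ∉ Ici (0 : ℝ) → h.gLim t = 0 :=
    h.sol_ae_zero (S := Ici 0) (hS := measurableSet_Ici) h.toL2
  have h1 := norm_integral_mul_exp_le hk h.integrable_gLim h0
  have h2 : ∀ᵐ t, t ∉ Ici (0 : ℝ) → h.g x t = 0 := by
    filter_upwards [h.g_ae_zero x] with t ht h3 using ht fun h4 => h3 h4.1
  have h3 := norm_integral_mul_exp_le hk (h.integrable_g x) h2
  have hsub := Lp.coeFn_sub h.gLim (h.g x)
  have hi : Integrable (h.gLim - h.g x : L2R) :=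
    (h.integrable_gLim.sub (h.integrable_g x)).congr hsub.symm
  have h4 := norm_integral_mul_exp_le hk (w := h.gLim - h.g x) hi (by
    filter_upwards [h0, h2, hsub] with t h5 h6 h7 ht
    rw [h7, Pi.sub_apply, h5 ht, h6 ht, sub_zero])
  refine le_of_eq_of_le ?_ h4.2
  rw [norm_sub_rev, gHat, ← integral_sub h1.1 h3.1]
  congr 1
  refine integral_congr_ae ?_
  filter_upwards [hsub] with t ht
  rw [ht, Pi.sub_apply]; push_cast; ring

end IsAccelerant

end Krein

/-! ### Absolute values in `L²` and integrability of the diagonal values of the kernel -/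

namespace Krein

open scoped RealInnerProductSpace

theorem continuous_abs_L2R : Continuous fun u : L2R => |u| := by
  have : (fun u : L2R => |u|) = fun u => u ⊔ -u := rfl
  rw [this]
  fun_prop

theorem abs_inner_le_inner_abs {u v w : L2R} (hvw : ∀ᵐ t, |v t| ≤ w t) : |⟪u, v⟫| ≤ ⟪|u|, w⟫ := by
  rw [inner_eq_integral, inner_eq_integral]
  refine abs_integral_le_integral_abs.trans (integral_mono_ae (integrable_mul_coe u v).abs
    (integrable_mul_coe |u| w) ?_)
  filter_upwards [hvw, Lp.coeFn_abs u] with t h1 h2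
  rw [h2, abs_mul]
  exact mul_le_mul_of_nonneg_left h1 (abs_nonneg _)

namespace IsAccelerant

variable {H : ℝ → ℝ} {δ : ℝ} (h : IsAccelerant H δ)
include h

/-! ### Integrability of `a(x) = Γ_x(x, 0)` -/

/-- The part of `Γ` beyond `x`. -/
noncomputable def tail (x : ℝ) : L2R := h.gLim - proj (Icc 0 x) measurableSet_Icc h.gLim

theorem tail_ae (x : ℝ) : h.tail x =ᵐ[volume] (Ioi x).indicator h.gLim := by
  filter_upwards [Lp.coeFn_sub h.gLim (proj (Icc 0 x) measurableSet_Icc h.gLim),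
    proj_coe (measurableSet_Icc (a := (0 : ℝ)) (b := x)) h.gLim,
    h.sol_ae_zero (S := Ici 0) (hS := measurableSet_Ici) h.toL2] with t h1 h2 h3
  rw [tail, h1, Pi.sub_apply, h2]
  by_cases h0 : 0 ≤ t
  · by_cases htx : t ≤ x
    · simp [indicator, h0, htx, not_lt.2 htx]
    · simp [indicator, not_le.1 htx]
  · have : h.gLim t = 0 := h3 h0
    simp [indicator, this]

/-- A majorant for the convolutions of `H` with the tails of `Γ` beyond `x₀`. -/
noncomputable def tailConv (x₀ t : ℝ) : ℝ := ∫ s, |H (t - s)| * |h.tail x₀ s|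

theorem integrable_tail (x : ℝ) : Integrable (h.tail x) :=
  (h.integrable_gLim.sub (integrable_proj h.integrable_gLim)).congr
    (Lp.coeFn_sub h.gLim (proj (Icc 0 x) measurableSet_Icc h.gLim)).symm

theorem tailConv_nonneg (x₀ t : ℝ) : 0 ≤ h.tailConv x₀ t :=
  integral_nonneg fun _ => by positivity

theorem tailConv_eq_inner (x₀ t : ℝ) :
    h.tailConv x₀ t = ⟪|trans t h.toL2|, |h.tail x₀|⟫ := by
  rw [inner_eq_integral, tailConv]
  refine integral_congr_ae ?_
  filter_upwards [Lp.coeFn_abs (trans t h.toL2), Lp.coeFn_abs (h.tail x₀), h.trans_toL2_coe t]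
    with s h1 h2 h3
  rw [h1, h2, h3]

theorem continuous_tailConv (x₀ : ℝ) : Continuous (h.tailConv x₀) := by
  have : h.tailConv x₀ = fun t => ⟪|trans t h.toL2|, |h.tail x₀|⟫ :=
    funext fun t => h.tailConv_eq_inner x₀ t
  rw [this]
  exact (continuous_abs_L2R.comp (continuous_trans h.toL2)).inner continuous_const

/-- The convolution `|H| * |tail|` as an element of `L²(ℝ)`. -/
noncomputable def tailConvL2 (x₀ : ℝ) : L2R := convOp (fun t => |H t|) h.integrable.abs |h.tail x₀|

theorem tailConvL2_ae (x₀ : ℝ) : h.tailConvL2 x₀ =ᵐ[volume] h.tailConv x₀ := by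
  filter_upwards [convOp_ae h.integrable.abs |h.tail x₀|] with t h1
  rw [tailConvL2, h1, tailConv]
  refine integral_congr_ae ?_
  filter_upwards [Lp.coeFn_abs (h.tail x₀)] with s hs
  rw [hs]

theorem integrable_tailConv (x₀ : ℝ) : Integrable (h.tailConv x₀) ∧
    ∫ t, h.tailConv x₀ t ≤ (∫ r, |H r|) * ∫ t, |h.tail x₀ t| := by
  have habs : Integrable (|h.tail x₀| : L2R) :=
    (h.integrable_tail x₀).abs.congr (Lp.coeFn_abs _).symm
  obtain ⟨h1, h2⟩ := convOp_integrable h.integrable.abs habs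
  refine ⟨h1.congr (h.tailConvL2_ae x₀), ?_⟩
  calc ∫ t, h.tailConv x₀ t = ∫ t, |convOp (fun t => |H t|) h.integrable.abs |h.tail x₀| t| := by
        refine integral_congr_ae ?_
        filter_upwards [h.tailConvL2_ae x₀] with t ht
        rw [← abs_of_nonneg (h.tailConv_nonneg x₀ t), ← ht]; rfl
    _ ≤ _ := h2
    _ = _ := by
        simp only [abs_abs]
        congr 1
        refine integral_congr_ae ?_
        filter_upwards [Lp.coeFn_abs (h.tail x₀)] with s hs
        rw [hs, abs_abs]

theorem abs_conv_tail_le {x₀ x : ℝ} (hx : x₀ ≤ x) (t : ℝ) :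
    |h.conv (h.tail x) t| ≤ h.tailConv x₀ t := by
  rw [tailConv_eq_inner, conv]
  refine abs_inner_le_inner_abs ?_
  filter_upwards [h.tail_ae x, h.tail_ae x₀, Lp.coeFn_abs (h.tail x₀)] with s h1 h2 h3
  rw [h3, h1, h2]
  by_cases hs : s ∈ Ioi x
  · rw [indicator_of_mem hs, indicator_of_mem (show s ∈ Ioi x₀ from hx.trans_lt hs)]
  · rw [indicator_of_notMem hs, abs_zero]; exact abs_nonneg _

/-- Here `gLim - g x` is split into the tail beyond `x` and a function solving a truncated equation
with source `-H * tail`; `conv_self_eq` evaluates the convolution with the latter at `x`. -/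
theorem a_eq {x : ℝ} :
    h.a x = h.gammaLim x + h.conv (h.tail x) x - ⟪h.g x, refl x (h.op (h.tail x))⟫ := by
  have he := h.isTruncSol_gLim_sub x
  have h1 := h.conv_self_eq he
  rw [inner_refl_g_proj, inner_neg_right, inner_refl] at h1
  have h2 : h.conv (h.gLim - h.g x) x = h.conv (h.tail x) x +
      h.conv (proj (Icc 0 x) measurableSet_Icc h.gLim - h.g x) x := by
    simp only [conv, tail]
    rw [← inner_add_right]; congr 1; abel
  have h3 : h.conv (h.gLim - h.g x) x = h.conv h.gLim x - h.conv (h.g x) x := inner_sub_right _ _ _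
  have h4 : h.a x = h.gammaLim x + h.conv (h.gLim - h.g x) x := by
    rw [h3, a, gPt, gammaLim]; ring
  rw [h4, h2, h1]
  simp only [tail]; ring

/-- The kernel of the integral inequality for `a`. -/
noncomputable def gronwallKernel (x₀ r x : ℝ) : ℝ :=
  h.tailConv x₀ (x - r) + ⟪|refl r (h.g r)|, refl x (h.tailConvL2 x₀)⟫

theorem continuous_gronwallKernel (x₀ : ℝ) :
    Continuous fun p : ℝ × ℝ => h.gronwallKernel x₀ p.1 p.2 := by
  unfold gronwallKernel
  refine Continuous.add ((h.continuous_tailConv x₀).comp (by fun_prop)) (Continuous.inner ?_ ?_)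
  · exact continuous_abs_L2R.comp (continuous_refl_pair.comp
      (continuous_fst.prodMk (h.continuous_g.comp continuous_fst)))
  · exact continuous_refl_pair.comp (continuous_snd.prodMk continuous_const)

theorem inner_abs_refl_tailConvL2 (u : L2R) (x₀ x : ℝ) :
    ⟪|u|, refl x (h.tailConvL2 x₀)⟫ = ∫ s, |u s| * h.tailConv x₀ (x - s) := by
  rw [inner_eq_integral]
  refine integral_congr_ae ?_
  filter_upwards [Lp.coeFn_abs u, refl_coe x (h.tailConvL2 x₀), ae_reflect x (h.tailConvL2_ae x₀)]
    with s h1 h2 h3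
  rw [h1, h2, h3]

theorem integral_inner_abs_refl_le {u : L2R} (hu : Integrable u) (x₀ : ℝ) :
    Integrable (fun x => ⟪|u|, refl x (h.tailConvL2 x₀)⟫) ∧
      ∫ x, ⟪|u|, refl x (h.tailConvL2 x₀)⟫ ≤ (∫ s, |u s|) * ∫ t, h.tailConv x₀ t := by
  obtain ⟨h1, h2⟩ := integral_abs_convolution_le hu.abs (h.integrable_tailConv x₀).1
  simp_rw [h.inner_abs_refl_tailConvL2]
  refine ⟨h1, ?_⟩
  simp only [abs_abs, abs_of_nonneg (h.tailConv_nonneg x₀ _)] at h2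
  exact (integral_mono h1 h1.abs fun x => le_abs_self _).trans h2

theorem inner_abs_refl_nonneg (u : L2R) (x₀ x : ℝ) : 0 ≤ ⟪|u|, refl x (h.tailConvL2 x₀)⟫ := by
  rw [h.inner_abs_refl_tailConvL2]
  exact integral_nonneg fun s => mul_nonneg (abs_nonneg _) (h.tailConv_nonneg _ _)

theorem gronwallKernel_nonneg (x₀ r x : ℝ) : 0 ≤ h.gronwallKernel x₀ r x :=
  add_nonneg (h.tailConv_nonneg _ _) (h.inner_abs_refl_nonneg _ _ _)

/-- The mass in `x` is bounded independently of `r` and is small for large `x₀`, since the mass of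
`tailConv` is controlled by the `L¹` norm of the tail of `Γ`. -/
theorem integral_gronwallKernel_le {K : ℝ} (hK : ∀ x, ∫ t, |h.g x t| ≤ K) (x₀ r : ℝ) :
    Integrable (h.gronwallKernel x₀ r) ∧
      ∫ x, h.gronwallKernel x₀ r x ≤ (1 + K) * ∫ t, h.tailConv x₀ t := by
  have hi : Integrable (refl r (h.g r)) :=
    ((h.integrable_g r).comp_sub_left r).congr (refl_coe r (h.g r)).symm
  have hn : ∫ s, |refl r (h.g r) s| ≤ K := by
    refine le_of_eq_of_le ?_ (hK r)
    rw [← integral_sub_left_eq_self _ volume r]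
    refine integral_congr_ae ?_
    filter_upwards [ae_reflect r (refl_coe r (h.g r))] with s hs
    rw [hs, sub_sub_cancel]
  obtain ⟨h1, h2⟩ := h.integral_inner_abs_refl_le hi x₀
  have h3 := (h.integrable_tailConv x₀).1.comp_sub_right r
  refine ⟨h3.add h1, ?_⟩
  have h4 : ∫ x, h.gronwallKernel x₀ r x = (∫ x, h.tailConv x₀ (x - r)) +
      ∫ x, ⟪|refl r (h.g r)|, refl x (h.tailConvL2 x₀)⟫ := integral_add h3 h1
  rw [h4, integral_sub_right_eq_self (h.tailConv x₀), add_mul, one_mul]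
  have h5 : 0 ≤ ∫ t, h.tailConv x₀ t := integral_nonneg fun t => h.tailConv_nonneg x₀ t
  exact add_le_add le_rfl (h2.trans (mul_le_mul_of_nonneg_right hn h5))

variable (hc : ContinuousOn H (Ioi 0))
include hc

/-- In `a_eq` the last pairing is expanded by integrating the derivative of `y ↦ ⟪g y, v⟫` from `x₀`
to `x`, with `v` frozen at the final `x`. Each derivative carries a factor `a(r)`, so `|a|`
satisfies a linear integral inequality. -/
theorem abs_a_le {x₀ x : ℝ} (hx₀ : 0 < x₀) (hx : x₀ ≤ x) :
    |h.a x| ≤ |h.gammaLim x| + h.tailConv x₀ x + ⟪|h.g x₀|, refl x (h.tailConvL2 x₀)⟫ +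
      ∫ r in x₀..x, |h.a r| * h.gronwallKernel x₀ r x := by
  set v := refl x (h.op (h.tail x))
  set φ := fun s => h.conv (h.tail x) (x - s)
  have hφ : Continuous φ := (h.continuous_conv _).comp (by fun_prop)
  have hv : v =ᵐ[volume] φ := by
    filter_upwards [refl_coe x (h.op (h.tail x)), ae_reflect x (h.op_coe (h.tail x))] with s h1 h2
    rw [h1, h2]
  have hvW : ∀ᵐ s, |v s| ≤ refl x (h.tailConvL2 x₀) s := by
    filter_upwards [hv, refl_coe x (h.tailConvL2 x₀), ae_reflect x (h.tailConvL2_ae x₀)]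
      with s h1 h2 h3
    rw [h1, h2, h3]
    exact h.abs_conv_tail_le hx _
  have hderiv : ∀ r ∈ uIcc x₀ x, HasDerivAt (fun y => ⟪h.g y, v⟫)
      (h.a r * (φ r - ⟪refl r (h.g r), v⟫)) r := fun r hr => by
    rw [uIcc_of_le hx] at hr
    exact h.hasDerivAt_inner_g hc (hx₀.trans_le hr.1) (lt_add_one r) hφ.continuousOn
      (hv.mono fun t ht _ => ht)
  have hsub : Icc x₀ x ⊆ Ioi 0 := fun r hr => hx₀.trans_le hr.1
  have hcont : ContinuousOn (fun r => h.a r * (φ r - ⟪refl r (h.g r), v⟫)) (uIcc x₀ x) := by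
    rw [uIcc_of_le hx]
    refine ((h.continuousOn_a hc).mono hsub).mul (Continuous.continuousOn ?_)
    exact hφ.sub ((continuous_refl_pair.comp
      (continuous_id.prodMk h.continuous_g)).inner continuous_const)
  have hFTC := intervalIntegral.integral_eq_sub_of_hasDerivAt hderiv hcont.intervalIntegrable
  have hgk : Continuous fun r => h.gronwallKernel x₀ r x :=
    (h.continuous_gronwallKernel x₀).comp (by fun_prop : Continuous fun r : ℝ => (r, x))
  have hint : |∫ r in x₀..x, h.a r * (φ r - ⟪refl r (h.g r), v⟫)| ≤
      ∫ r in x₀..x, |h.a r| * h.gronwallKernel x₀ r x := by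
    refine (intervalIntegral.abs_integral_le_integral_abs hx).trans ?_
    refine intervalIntegral.integral_mono_on hx hcont.abs.intervalIntegrable ?_ fun r hr => ?_
    · refine ContinuousOn.intervalIntegrable ?_
      rw [uIcc_of_le hx]
      exact (((h.continuousOn_a hc).mono hsub).abs).mul hgk.continuousOn
    · rw [abs_mul]
      refine mul_le_mul_of_nonneg_left ((abs_sub _ _).trans (add_le_add ?_ ?_)) (abs_nonneg _)
      · exact h.abs_conv_tail_le hx _
      · exact abs_inner_le_inner_abs hvW
  have hT : ⟪h.g x, v⟫ = ⟪h.g x₀, v⟫ + ∫ r in x₀..x, h.a r * (φ r - ⟪refl r (h.g r), v⟫) := by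
    rw [hFTC]; ring
  rw [h.a_eq, hT]
  have h1 := h.abs_conv_tail_le hx x
  have h2 : |⟪h.g x₀, v⟫| ≤ ⟪|h.g x₀|, refl x (h.tailConvL2 x₀)⟫ := abs_inner_le_inner_abs hvW
  calc _ ≤ |h.gammaLim x + h.conv (h.tail x) x| + |⟪h.g x₀, v⟫ +
        ∫ r in x₀..x, h.a r * (φ r - ⟪refl r (h.g r), v⟫)| := abs_sub _ _
    _ ≤ (|h.gammaLim x| + |h.conv (h.tail x) x|) + (|⟪h.g x₀, v⟫| +
        |∫ r in x₀..x, h.a r * (φ r - ⟪refl r (h.g r), v⟫)|) :=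
        add_le_add (abs_add_le _ _) (abs_add_le _ _)
    _ ≤ _ := by linarith

/-- Beyond a large `x₀` the kernel of the inequality has mass at most `1/2`. Integrating over `[x₀,
X]` and applying Fubini, half of `∫ |a|` is absorbed; it is finite by continuity. The resulting
bound does not depend on `X`. -/
theorem integrableOn_a : IntegrableOn h.a (Ioi 0) := by
  obtain ⟨K, hK0, hK⟩ := h.exists_integral_g_le
  set M := ∫ r, |H r|
  have hM : 0 ≤ M := integral_nonneg fun _ => abs_nonneg _
  have htail : Tendsto (fun x => ∫ t, |h.tail x t|) atTop (𝓝 0) :=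
    integral_abs_sub_proj_tendsto h.integrable_gLim
      (h.sol_spec (Ici 0) measurableSet_Ici h.toL2).supp
  have htail' : Tendsto (fun x => (1 + K) * (M * ∫ t, |h.tail x t|)) atTop (𝓝 0) := by
    simpa using (htail.const_mul M).const_mul (1 + K)
  obtain ⟨x₀, hx₀s, hx₀⟩ := ((htail'.eventually (ge_mem_nhds (by norm_num : (0 : ℝ) < 1 / 2))).and
    (eventually_gt_atTop 0)).exists
  set κ := ∫ t, h.tailConv x₀ t
  have hκ0 : 0 ≤ κ := integral_nonneg fun t => h.tailConv_nonneg x₀ t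
  have hκ : (1 + K) * κ ≤ 1 / 2 :=
    (mul_le_mul_of_nonneg_left (h.integrable_tailConv x₀).2 (by positivity)).trans hx₀s
  set G := ∫ x in Ici (0 : ℝ), |h.gammaLim x|
  have hac : ∀ X, ContinuousOn h.a (Icc x₀ X) := fun X =>
    (h.continuousOn_a hc).mono fun r hr => hx₀.trans_le hr.1
  have hbound : ∀ X, x₀ ≤ X → ∫ x in Icc x₀ X, |h.a x| ≤ 2 * (G + κ + K * κ) := fun X hX => by
    set μ := (volume : Measure ℝ).restrict (Icc x₀ X)
    have hai : Integrable (fun x => |h.a x|) μ := (hac X).abs.integrableOn_Icc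
    have hγi : Integrable (fun x => |h.gammaLim x|) μ :=
      (h.integrableOn_gammaLim.mono_set fun r hr => hx₀.le.trans hr.1).abs
    have hWi : Integrable (h.tailConv x₀) μ := (h.integrable_tailConv x₀).1.restrict
    obtain ⟨hg1, hg2⟩ := h.integral_inner_abs_refl_le (h.integrable_g x₀) x₀
    have hprod : Integrable (fun p : ℝ × ℝ => |h.a p.2| * h.gronwallKernel x₀ p.2 p.1)
        (μ.prod μ) := by
      rw [Measure.prod_restrict]
      refine ContinuousOn.integrableOn_compact (isCompact_Icc.prod isCompact_Icc) ?_
      refine ContinuousOn.mul ?_ ?_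
      · exact (hac X).abs.comp continuousOn_snd fun p hp => hp.2
      · exact ((h.continuous_gronwallKernel x₀).comp
          (by fun_prop : Continuous fun p : ℝ × ℝ => (p.2, p.1))).continuousOn
    have hstep : ∫ x, |h.a x| ∂μ ≤ ∫ x, (|h.gammaLim x| + h.tailConv x₀ x +
        ⟪|h.g x₀|, refl x (h.tailConvL2 x₀)⟫ +
        ∫ r, |h.a r| * h.gronwallKernel x₀ r x ∂μ) ∂μ := by
      refine integral_mono_ae hai (((hγi.add hWi).add hg1.restrict).add hprod.integral_prod_left) ?_
      filter_upwards [ae_restrict_mem measurableSet_Icc] with x hx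
      refine (h.abs_a_le hc hx₀ hx.1).trans (add_le_add le_rfl ?_)
      rw [intervalIntegral.integral_of_le hx.1]
      refine setIntegral_mono_set ?_ (Eventually.of_forall fun r =>
        mul_nonneg (abs_nonneg _) (h.gronwallKernel_nonneg _ _ _)) ?_
      · refine ContinuousOn.integrableOn_Icc ((hac X).abs.mul ?_)
        exact ((h.continuous_gronwallKernel x₀).comp
          (by fun_prop : Continuous fun r : ℝ => (r, x))).continuousOn
      · exact LE.le.eventuallyLE
          (show Ioc x₀ x ⊆ Icc x₀ X from fun r hr => ⟨hr.1.le, hr.2.trans hx.2⟩)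
    have e1 : ∫ x, (|h.gammaLim x| + h.tailConv x₀ x + ⟪|h.g x₀|, refl x (h.tailConvL2 x₀)⟫ +
        ∫ r, |h.a r| * h.gronwallKernel x₀ r x ∂μ) ∂μ = (∫ x, |h.gammaLim x| ∂μ) +
        (∫ x, h.tailConv x₀ x ∂μ) + (∫ x, ⟪|h.g x₀|, refl x (h.tailConvL2 x₀)⟫ ∂μ) +
        ∫ x, ∫ r, |h.a r| * h.gronwallKernel x₀ r x ∂μ ∂μ := by
      have s1 : ∫ x, (|h.gammaLim x| + h.tailConv x₀ x) ∂μ = _ := integral_add hγi hWi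
      have s2 : ∫ x, (|h.gammaLim x| + h.tailConv x₀ x +
        ⟪|h.g x₀|, refl x (h.tailConvL2 x₀)⟫) ∂μ = _ := integral_add (hγi.add hWi) hg1.restrict
      rw [← s1]
      exact (integral_add ((hγi.add hWi).add hg1.restrict) hprod.integral_prod_left).trans
        (congrArg (· + _) s2)
    have b1 : ∫ x, |h.gammaLim x| ∂μ ≤ G :=
      setIntegral_mono_set h.integrableOn_gammaLim.abs (Eventually.of_forall fun _ => abs_nonneg _)
        (LE.le.eventuallyLE (show Icc x₀ X ⊆ Ici 0 from fun r hr => hx₀.le.trans hr.1))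
    have b2 : ∫ x, h.tailConv x₀ x ∂μ ≤ κ := setIntegral_le_integral (h.integrable_tailConv x₀).1
      (Eventually.of_forall fun t => h.tailConv_nonneg x₀ t)
    have b3 : ∫ x, ⟪|h.g x₀|, refl x (h.tailConvL2 x₀)⟫ ∂μ ≤ K * κ :=
      (setIntegral_le_integral hg1
        (Eventually.of_forall fun t => h.inner_abs_refl_nonneg _ x₀ t)).trans
        (hg2.trans (mul_le_mul_of_nonneg_right (hK x₀) hκ0))
    have b4 : ∫ x, ∫ r, |h.a r| * h.gronwallKernel x₀ r x ∂μ ∂μ ≤ 1 / 2 * ∫ r, |h.a r| ∂μ := by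
      rw [integral_integral_swap hprod, ← integral_const_mul]
      refine integral_mono hprod.integral_prod_right (hai.const_mul _) fun r => ?_
      simp only [integral_const_mul]
      rw [mul_comm]
      refine mul_le_mul_of_nonneg_right (le_trans ?_ hκ) (abs_nonneg _)
      obtain ⟨k1, k2⟩ := h.integral_gronwallKernel_le hK x₀ r
      exact (setIntegral_le_integral k1
        (Eventually.of_forall fun t => h.gronwallKernel_nonneg x₀ r t)).trans k2
    linarith [hstep.trans_eq e1]
  have h1 : IntegrableOn h.a (Ioi x₀) := by
    refine integrableOn_Ioi_of_intervalIntegral_norm_bounded (2 * (G + κ + K * κ)) x₀ (l := atTop)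
      (b := fun x : ℝ => x) (fun R => (hac R).integrableOn_Icc.mono_set Ioc_subset_Icc_self)
      tendsto_id ?_
    filter_upwards [eventually_ge_atTop x₀] with R hR
    rw [intervalIntegral.integral_of_le hR, ← integral_Icc_eq_integral_Ioc]
    exact hbound R hR
  -- Near the origin `a` is `H` minus a continuous function, so integrability of `H` suffices.
  have h2 : IntegrableOn h.a (Ioc 0 x₀) := by
    refine h.integrable.integrableOn.sub ?_
    have : Continuous fun x => h.conv (h.g x) x :=
      h.continuous_conv_pair.comp (continuous_id.prodMk h.continuous_g)
    exact this.integrableOn_Ioc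
  rw [← Ioc_union_Ioi_eq_Ioi hx₀.le]
  exact h2.union h1

end IsAccelerant

end Krein

/-! ### Jost solutions for `q = A² + A'` with integrable `A` -/

namespace Krein

/-! ### Volterra operators on the half-line -/

theorem hasDerivAt_integral_Ioi {E : Type*} [NormedAddCommGroup E] [NormedSpace ℝ E]
    [CompleteSpace E] {F : ℝ → E} (hF : IntegrableOn F (Ioi 0)) (hc : ContinuousOn F (Ioi 0))
    {x : ℝ} (hx : 0 < x) : HasDerivAt (fun y => ∫ t in Ioi y, F t) (-F x) x := by
  have hi : ∀ y, 0 < y → IntervalIntegrable F volume 0 y := fun y hy =>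
    (intervalIntegrable_iff_integrableOn_Ioc_of_le hy.le).2 (hF.mono_set Ioc_subset_Ioi_self)
  have h1 : HasDerivAt (fun y => ∫ t in (0 : ℝ)..y, F t) (F x) x :=
    intervalIntegral.integral_hasDerivAt_right (hi x hx)
      (hc.stronglyMeasurableAtFilter isOpen_Ioi x hx) (hc.continuousAt (Ioi_mem_nhds hx))
  refine (h1.const_sub (∫ t in Ioi 0, F t)).congr_of_eventuallyEq ?_
  filter_upwards [Ioi_mem_nhds hx] with y hy
  rw [← intervalIntegral.integral_Ioi_sub_Ioi hF (le_of_lt hy)]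
  abel

theorem tendsto_integral_Ioi_atTop {E : Type*} [NormedAddCommGroup E] [NormedSpace ℝ E]
    [CompleteSpace E] {F : ℝ → E} (hF : IntegrableOn F (Ioi 0)) :
    Tendsto (fun y => ∫ t in Ioi y, F t) atTop (𝓝 0) := by
  have h1 := (intervalIntegral_tendsto_integral_Ioi 0 hF tendsto_id).const_sub
    (∫ t in Ioi 0, F t)
  rw [sub_self] at h1
  refine h1.congr' ?_
  filter_upwards [eventually_ge_atTop 0] with y hy
  rw [id, ← intervalIntegral.integral_Ioi_sub_Ioi hF hy, sub_sub_cancel]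

variable {A : ℝ → ℝ}

/-- The remaining mass `∫_x^∞ |A|`. -/
noncomputable def tailMass (A : ℝ → ℝ) (x : ℝ) : ℝ := ∫ t in Ioi x, |A t|

/-- The Volterra operator `u ↦ ∫_x^∞ e^{iκ(t-x)} A(t) u(t) dt`. -/
noncomputable def volterra (A : ℝ → ℝ) (κ : ℂ) (u : ℝ → ℂ) (x : ℝ) : ℂ :=
  ∫ t in Ioi x, Complex.exp (Complex.I * κ * (t - x)) * (A t * u t)

theorem tailMass_nonneg (x : ℝ) : 0 ≤ tailMass A x := integral_nonneg fun _ => abs_nonneg _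

variable (hA : IntegrableOn A (Ioi 0))
include hA

theorem continuousOn_tailMass : ContinuousOn (tailMass A) (Ici 0) :=
  IntegrableOn.continuousOn_Ici_primitive_Ioi hA.abs

theorem tailMass_le {x : ℝ} (hx : 0 ≤ x) : tailMass A x ≤ tailMass A 0 :=
  setIntegral_mono_set hA.abs (Eventually.of_forall fun _ => abs_nonneg _)
    (LE.le.eventuallyLE (show Ioi x ⊆ Ioi 0 from Ioi_subset_Ioi hx))

theorem integrableOn_mul_of_bounded {u : ℝ → ℂ} {x C : ℝ} (hx : 0 ≤ x)
    (hu : ContinuousOn u (Ioi x)) (hC : ∀ t, x < t → ‖u t‖ ≤ C) :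
    IntegrableOn (fun t => (A t : ℂ) * u t) (Ioi x) :=
  Integrable.mul_bdd (c := C) (hA.mono_set (Ioi_subset_Ioi hx)).ofReal
    (hu.aestronglyMeasurable measurableSet_Ioi)
    ((ae_restrict_iff' measurableSet_Ioi).2 (Eventually.of_forall hC))

omit hA in
theorem volterra_eq (κ : ℂ) (u : ℝ → ℂ) (x : ℝ) :
    volterra A κ u x = Complex.exp (-(Complex.I * κ * x)) *
      ∫ t in Ioi x, Complex.exp (Complex.I * κ * t) * (A t * u t) := by
  rw [volterra, ← integral_const_mul]
  congr 1; ext t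
  rw [← mul_assoc (Complex.exp (-(Complex.I * κ * x))), ← Complex.exp_add]
  congr 2; ring

theorem integrableOn_exp_mul {u : ℝ → ℂ} {x C : ℝ} {κ : ℂ} (hκ : 0 ≤ κ.im) (hx : 0 ≤ x)
    (hu : ContinuousOn u (Ioi x)) (hC : ∀ t, x < t → ‖u t‖ ≤ C) :
    IntegrableOn (fun t : ℝ => Complex.exp (Complex.I * κ * t) * (A t * u t)) (Ioi x) :=
  Integrable.bdd_mul (c := 1) (integrableOn_mul_of_bounded hA hx hu hC)
    (by fun_prop : Continuous fun t : ℝ => Complex.exp (Complex.I * κ * t)).aestronglyMeasurable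
    ((ae_restrict_iff' measurableSet_Ioi).2 (Eventually.of_forall fun _ ht =>
      IsAccelerant.norm_exp_le_one hκ (hx.trans (le_of_lt ht))))

theorem continuousOn_volterra {u : ℝ → ℂ} {C : ℝ} {κ : ℂ} (hκ : 0 ≤ κ.im)
    (hu : ContinuousOn u (Ioi 0)) (hC : ∀ t, 0 < t → ‖u t‖ ≤ C) :
    ContinuousOn (volterra A κ u) (Ici 0) := by
  have h1 := IntegrableOn.continuousOn_Ici_primitive_Ioi
    (integrableOn_exp_mul hA hκ le_rfl hu hC)
  have h2 : Continuous fun x : ℝ => Complex.exp (-(Complex.I * κ * x)) := by fun_prop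
  exact (h2.continuousOn.mul h1).congr fun x _ => volterra_eq κ u x

theorem norm_volterra_le_integral {u : ℝ → ℂ} {x C : ℝ} {κ : ℂ} (hκ : 0 ≤ κ.im) (hx : 0 ≤ x)
    (hu : ContinuousOn u (Ioi x)) (hC : ∀ t, x < t → ‖u t‖ ≤ C) :
    ‖volterra A κ u x‖ ≤ ∫ t in Ioi x, ‖(A t : ℂ) * u t‖ := by
  refine norm_integral_le_of_norm_le (integrableOn_mul_of_bounded hA hx hu hC).norm ?_
  filter_upwards [ae_restrict_mem measurableSet_Ioi] with t ht
  rw [norm_mul]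
  refine mul_le_of_le_one_left (norm_nonneg _) ?_
  have := IsAccelerant.norm_exp_le_one hκ (sub_nonneg.2 (le_of_lt ht))
  push_cast at this
  exact this

theorem tendsto_volterra_atTop {u : ℝ → ℂ} {C : ℝ} {κ : ℂ} (hκ : 0 ≤ κ.im)
    (hu : ContinuousOn u (Ioi 0)) (hC : ∀ t, 0 < t → ‖u t‖ ≤ C) :
    Tendsto (volterra A κ u) atTop (𝓝 0) := by
  refine squeeze_zero_norm' ?_
    (tendsto_integral_Ioi_atTop (integrableOn_mul_of_bounded hA le_rfl hu hC).norm)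
  filter_upwards [eventually_ge_atTop 0] with x hx
  exact norm_volterra_le_integral hA hκ hx (hu.mono (Ioi_subset_Ioi hx))
    fun t ht => hC t (hx.trans_lt ht)

theorem volterra_sub {u v : ℝ → ℂ} {x C D : ℝ} {κ : ℂ} (hκ : 0 ≤ κ.im) (hx : 0 ≤ x)
    (hu : ContinuousOn u (Ioi x)) (hC : ∀ t, x < t → ‖u t‖ ≤ C)
    (hv : ContinuousOn v (Ioi x)) (hD : ∀ t, x < t → ‖v t‖ ≤ D) :
    volterra A κ (u - v) x = volterra A κ u x - volterra A κ v x := by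
  simp_rw [volterra_eq]
  rw [← mul_sub, ← integral_sub (integrableOn_exp_mul hA hκ hx hu hC)
    (integrableOn_exp_mul hA hκ hx hv hD)]
  congr 2; ext t
  simp only [Pi.sub_apply]; ring

variable (hc : ContinuousOn A (Ioi 0))
include hc

theorem hasDerivAt_tailMass {x : ℝ} (hx : 0 < x) : HasDerivAt (tailMass A) (-|A x|) x :=
  hasDerivAt_integral_Ioi hA.abs hc.abs hx

theorem integral_abs_mul_exp_tailMass {x : ℝ} (hx : 0 ≤ x) :
    IntegrableOn (fun t => |A t| * Real.exp (2 * tailMass A t)) (Ioi x) ∧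
      ∫ t in Ioi x, |A t| * Real.exp (2 * tailMass A t) ≤ 1 / 2 * Real.exp (2 * tailMass A x) := by
  have hm := continuousOn_tailMass hA
  have hi : IntegrableOn (fun t => |A t| * Real.exp (2 * tailMass A t)) (Ioi x) := by
    refine Integrable.mul_bdd (c := Real.exp (2 * tailMass A 0)) (hA.mono_set (Ioi_subset_Ioi hx)).abs
      (ContinuousOn.aestronglyMeasurable ?_ measurableSet_Ioi) ?_
    · exact Real.continuous_exp.comp_continuousOn
        ((hm.mono fun t ht => hx.trans (le_of_lt ht)).const_mul 2)
    · filter_upwards [ae_restrict_mem measurableSet_Ioi] with t ht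
      rw [Real.norm_eq_abs, Real.abs_exp]
      have := tailMass_le hA (hx.trans (le_of_lt ht))
      gcongr
  refine ⟨hi, ?_⟩
  have hlim : Tendsto (fun t => -(1 / 2) * Real.exp (2 * tailMass A t)) atTop (𝓝 (-(1 / 2))) := by
    have h1 : Tendsto (tailMass A) atTop (𝓝 0) := tendsto_integral_Ioi_atTop hA.abs
    refine (((Real.continuous_exp.tendsto _).comp (h1.const_mul 2)).const_mul (-(1 / 2))).trans ?_
    simp
  -- The integrand has the antiderivative `-(1/2) exp (2 tailMass)`, because `tailMass' = -|A|`.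
  have h2 := integral_Ioi_of_hasDerivAt_of_tendsto (a := x)
    (f := fun t => -(1 / 2) * Real.exp (2 * tailMass A t)) ?_ (fun t ht => ?_) hi hlim
  · rw [h2]; linarith
  · refine ContinuousWithinAt.const_mul ?_ _
    refine (Real.continuous_exp.continuousAt).comp_continuousWithinAt ?_
    exact (((hm x hx).mono (Ici_subset_Ici.2 hx))).const_mul 2
  · have h3 := (((hasDerivAt_tailMass hA hc (hx.trans_lt ht)).const_mul 2).exp).const_mul (-(1 / 2))
    convert! h3 using 1
    ring

/-- The weight `exp (2 ∫_x^∞ |A|)` makes the Volterra operators contract by one half. -/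
theorem norm_volterra_le {u : ℝ → ℂ} {x C : ℝ} {κ : ℂ} (hκ : 0 ≤ κ.im) (hx : 0 ≤ x) (hC0 : 0 ≤ C)
    (hu : ContinuousOn u (Ioi x)) (hC : ∀ t, x < t → ‖u t‖ ≤ C * Real.exp (2 * tailMass A t)) :
    ‖volterra A κ u x‖ ≤ C / 2 * Real.exp (2 * tailMass A x) := by
  have hC' : ∀ t, x < t → ‖u t‖ ≤ C * Real.exp (2 * tailMass A 0) := fun t ht => by
    refine (hC t ht).trans ?_
    have := tailMass_le hA (hx.trans ht.le)
    gcongr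
  obtain ⟨h1, h2⟩ := integral_abs_mul_exp_tailMass hA hc hx
  calc _ ≤ ∫ t in Ioi x, ‖(A t : ℂ) * u t‖ := norm_volterra_le_integral hA hκ hx hu hC'
    _ ≤ ∫ t in Ioi x, C * (|A t| * Real.exp (2 * tailMass A t)) := by
        refine setIntegral_mono_on (integrableOn_mul_of_bounded hA hx hu hC').norm (h1.const_mul C)
          measurableSet_Ioi fun t ht => ?_
        rw [norm_mul, Complex.norm_real, Real.norm_eq_abs, mul_left_comm]
        exact mul_le_mul_of_nonneg_left (hC t ht) (abs_nonneg _)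
    _ ≤ C * (1 / 2 * Real.exp (2 * tailMass A x)) := by
        rw [integral_const_mul]
        exact mul_le_mul_of_nonneg_left h2 hC0
    _ = _ := by ring

theorem hasDerivAt_volterra {u : ℝ → ℂ} {C : ℝ} {κ : ℂ} (hκ : 0 ≤ κ.im)
    (hu : ContinuousOn u (Ioi 0)) (hC : ∀ t, 0 < t → ‖u t‖ ≤ C) {x : ℝ} (hx : 0 < x) :
    HasDerivAt (volterra A κ u) (-(Complex.I * κ * volterra A κ u x) - A x * u x) x := by
  have hcE : Continuous fun t : ℝ => Complex.exp (Complex.I * κ * t) := by fun_prop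
  have h1 := hasDerivAt_integral_Ioi (integrableOn_exp_mul hA hκ le_rfl hu hC)
    (hcE.continuousOn.mul ((Complex.continuous_ofReal.comp_continuousOn hc).mul hu)) hx
  have h2 : HasDerivAt (fun y : ℝ => Complex.exp (-(Complex.I * κ * y)))
      (Complex.exp (-(Complex.I * κ * x)) * -(Complex.I * κ * 1)) x :=
    ((Complex.ofRealCLM.hasDerivAt (x := x)).const_mul (Complex.I * κ)).neg.cexp
  have h3 := h2.mul h1
  refine (h3.congr_of_eventuallyEq (Eventually.of_forall fun y => volterra_eq κ u y)).congr_deriv ?_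
  rw [volterra_eq]
  have h4 : Complex.exp (-(Complex.I * κ * x)) * Complex.exp (Complex.I * κ * x) = 1 := by
    rw [← Complex.exp_add]; simp
  linear_combination (-(A x * u x : ℂ)) * h4

/-- A pair of bounded functions intertwined by Volterra operators vanishes. -/
theorem eq_zero_of_norm_le_volterra {a b : ℝ → ℂ} {x₀ C : ℝ} {κ κ' : ℂ} (hκ : 0 ≤ κ.im)
    (hκ' : 0 ≤ κ'.im) (hx₀ : 0 ≤ x₀) (ha : ContinuousOn a (Ioi x₀)) (hb : ContinuousOn b (Ioi x₀))
    (haC : ∀ t, x₀ < t → ‖a t‖ ≤ C) (hbC : ∀ t, x₀ < t → ‖b t‖ ≤ C)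
    (hab : ∀ t, x₀ < t → ‖a t‖ ≤ ‖volterra A κ b t‖)
    (hba : ∀ t, x₀ < t → ‖b t‖ ≤ ‖volterra A κ' a t‖) {x : ℝ} (hx : x₀ < x) :
    a x = 0 ∧ b x = 0 := by
  have hC0 : 0 ≤ C := (norm_nonneg _).trans (haC x hx)
  -- Each use of the Volterra inequalities halves the weighted bound of both functions.
  have key : ∀ n : ℕ, ∀ t, x₀ < t → ‖a t‖ ≤ C / 2 ^ n * Real.exp (2 * tailMass A t) ∧
      ‖b t‖ ≤ C / 2 ^ n * Real.exp (2 * tailMass A t) := by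
    intro n
    induction n with
    | zero =>
      intro t ht
      have : 1 ≤ Real.exp (2 * tailMass A t) := Real.one_le_exp (by
        have := tailMass_nonneg (A := A) t; positivity)
      simp only [pow_zero, div_one]
      exact ⟨(haC t ht).trans (le_mul_of_one_le_right hC0 this),
        (hbC t ht).trans (le_mul_of_one_le_right hC0 this)⟩
    | succ n ih =>
      intro t ht
      have hsub : Ioi t ⊆ Ioi x₀ := Ioi_subset_Ioi ht.le
      have e : C / 2 ^ (n + 1) = C / 2 ^ n / 2 := by rw [pow_succ, div_div]
      rw [e]
      exact ⟨(hab t ht).trans (norm_volterra_le hA hc hκ (hx₀.trans ht.le) (by positivity)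
          (hb.mono hsub) fun s hs => (ih s (ht.trans hs)).2),
        (hba t ht).trans (norm_volterra_le hA hc hκ' (hx₀.trans ht.le) (by positivity)
          (ha.mono hsub) fun s hs => (ih s (ht.trans hs)).1)⟩
  have hlim : Tendsto (fun n : ℕ => C / 2 ^ n * Real.exp (2 * tailMass A x)) atTop (𝓝 0) := by
    have := ((tendsto_pow_atTop_nhds_zero_of_lt_one (r := (1 / 2 : ℝ)) (by norm_num)
      (by norm_num)).const_mul C).mul_const (Real.exp (2 * tailMass A x))
    simpa [div_eq_mul_inv] using this
  exact ⟨norm_le_zero_iff.1 (ge_of_tendsto' hlim fun n => (key n x hx).1),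
    norm_le_zero_iff.1 (ge_of_tendsto' hlim fun n => (key n x hx).2)⟩

omit hc in
/-- A solution of `b' = -iκ b - A u` that tends to zero is a Volterra integral. -/
theorem eq_volterra_of_hasDerivAt {b u : ℝ → ℂ} {x₀ C : ℝ} {κ : ℂ} (hκ : 0 ≤ κ.im) (hx₀ : 0 ≤ x₀)
    (hu : ContinuousOn u (Ioi x₀)) (hC : ∀ t, x₀ < t → ‖u t‖ ≤ C)
    (hb : ∀ t, x₀ < t → HasDerivAt b (-(Complex.I * κ * b t) - A t * u t) t)
    (hlim : Tendsto b atTop (𝓝 0)) {x : ℝ} (hx : x₀ < x) : b x = volterra A κ u x := by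
  have h1 : ∀ t ∈ Ici x, HasDerivAt (fun t : ℝ => Complex.exp (Complex.I * κ * t) * b t)
      (-(Complex.exp (Complex.I * κ * t) * (A t * u t))) t := fun t ht => by
    have h2 : HasDerivAt (fun y : ℝ => Complex.exp (Complex.I * κ * y))
        (Complex.exp (Complex.I * κ * t) * (Complex.I * κ * 1)) t :=
      ((Complex.ofRealCLM.hasDerivAt (x := t)).const_mul (Complex.I * κ)).cexp
    refine (h2.mul (hb t (hx.trans_le ht))).congr_deriv ?_
    ring
  have h3 : Tendsto (fun t : ℝ => Complex.exp (Complex.I * κ * t) * b t) atTop (𝓝 0) := by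
    refine squeeze_zero_norm' ?_ (tendsto_zero_iff_norm_tendsto_zero.1 hlim)
    filter_upwards [eventually_ge_atTop 0] with t ht
    rw [norm_mul]
    exact mul_le_of_le_one_left (norm_nonneg _) (IsAccelerant.norm_exp_le_one hκ ht)
  have h4 := integral_Ioi_of_hasDerivAt_of_tendsto' h1
    (integrableOn_exp_mul hA hκ (hx₀.trans hx.le) (hu.mono (Ioi_subset_Ioi hx.le))
      fun t ht => hC t (hx.trans ht)).neg h3
  rw [integral_neg, zero_sub, neg_inj] at h4
  rw [volterra_eq, h4, ← mul_assoc, ← Complex.exp_add]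
  simp

end Krein

namespace Krein

/-! ### Local absolute continuity -/

theorem _root_.AbsolutelyContinuousOnInterval.congr {X : Type*} [PseudoMetricSpace X] {f g : ℝ → X}
    {a b : ℝ} (hf : AbsolutelyContinuousOnInterval f a b) (hfg : EqOn f g (uIcc a b)) :
    AbsolutelyContinuousOnInterval g a b := by
  rw [absolutelyContinuousOnInterval_iff] at hf ⊢
  intro ε hε
  obtain ⟨δ, hδ, h⟩ := hf ε hε
  refine ⟨δ, hδ, fun E hE hs => ?_⟩
  refine (Finset.sum_congr rfl fun i hi => ?_).trans_lt (h E hE hs)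
  have := hE.1 i hi
  rw [hfg this.1, hfg this.2]

theorem uIcc_subset_Ioi_of_pos {a b : ℝ} (ha : 0 < a) (hb : 0 < b) : uIcc a b ⊆ Ioi 0 :=
  fun _ hx => (lt_min ha hb).trans_le hx.1

theorem _root_.LocallyACOnPos.congr {X : Type*} [PseudoMetricSpace X] {f g : ℝ → X}
    (hf : LocallyACOnPos f) (hfg : EqOn f g (Ioi 0)) : LocallyACOnPos g := fun a b ha hab =>
  (hf a b ha hab).congr (hfg.mono (uIcc_subset_Ioi_of_pos ha (ha.trans hab)))

theorem _root_.LocallyACOnPos.continuousOn {E : Type*} [NormedAddCommGroup E] {f : ℝ → E}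
    (hf : LocallyACOnPos f) : ContinuousOn f (Ioi 0) := fun x hx => by
  have hx0 : 0 < x := hx
  have h1 := (hf (x / 2) (2 * x) (by positivity) (by linarith)).continuousOn
  rw [uIcc_of_le (by linarith)] at h1
  exact (h1.continuousAt (Icc_mem_nhds (by linarith) (by linarith))).continuousWithinAt

theorem _root_.LocallyACOnPos.add {E : Type*} [NormedAddCommGroup E] {f g : ℝ → E}
    (hf : LocallyACOnPos f) (hg : LocallyACOnPos g) : LocallyACOnPos fun x => f x + g x :=
  fun a b ha hab => (hf a b ha hab).fun_add (hg a b ha hab)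

theorem _root_.LocallyACOnPos.sub {E : Type*} [NormedAddCommGroup E] {f g : ℝ → E}
    (hf : LocallyACOnPos f) (hg : LocallyACOnPos g) : LocallyACOnPos fun x => f x - g x :=
  fun a b ha hab => (hf a b ha hab).fun_sub (hg a b ha hab)

theorem _root_.LocallyACOnPos.ofReal_mul {f : ℝ → ℝ} {g : ℝ → ℂ} (hf : LocallyACOnPos f)
    (hg : LocallyACOnPos g) : LocallyACOnPos fun x => (f x : ℂ) * g x := fun a b ha hab => by
  simpa only [Complex.real_smul] using (hf a b ha hab).fun_smul (hg a b ha hab)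

theorem locallyACOnPos_of_hasDerivAt {E : Type*} [NormedAddCommGroup E] [NormedSpace ℝ E]
    {f f' : ℝ → E} (hf : ∀ x, 0 < x → HasDerivAt f (f' x) x) (hf' : ContinuousOn f' (Ioi 0)) :
    LocallyACOnPos f := fun a b ha hab => by
  have hsub := uIcc_subset_Ioi_of_pos ha (ha.trans hab)
  obtain ⟨C, hC⟩ := isCompact_uIcc.exists_bound_of_continuousOn (hf'.mono hsub)
  refine LipschitzOnWith.absolutelyContinuousOnInterval (K := C.toNNReal) ?_
  refine (convex_uIcc a b).lipschitzOnWith_of_nnnorm_hasDerivWithin_le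
    (fun x hx => (hf x (hsub hx)).hasDerivWithinAt) fun x hx => ?_
  exact NNReal.le_toNNReal_of_coe_le (hC x hx)

theorem _root_.LocallyACOnPos.ae_differentiableAt {E : Type*} [NormedAddCommGroup E] [NormedSpace ℝ E]
    [FiniteDimensional ℝ E] {f : ℝ → E} (hf : LocallyACOnPos f) :
    ∀ᵐ x ∂(volume.restrict (Ioi (0 : ℝ))), DifferentiableAt ℝ f x := by
  rw [ae_restrict_iff' measurableSet_Ioi]
  -- These intervals exhaust `(0,∞)`; the shift by `2` makes them nondegenerate already for `n = 0`.
  have h1 : ∀ n : ℕ, ∀ᵐ x, x ∈ uIcc (1 / ((n : ℝ) + 2)) ((n : ℝ) + 2) → DifferentiableAt ℝ f x :=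
    fun n => (hf _ _ (by positivity) (by
      rw [div_lt_iff₀ (by positivity)]
      have : (0 : ℝ) ≤ n := n.cast_nonneg
      nlinarith)).boundedVariationOn.ae_differentiableAt_of_mem_uIcc
  filter_upwards [ae_all_iff.2 h1] with x hx hx0
  have hx0' : 0 < x := hx0
  obtain ⟨n, hn⟩ := exists_nat_ge (max x (1 / x))
  refine hx n (Icc_subset_uIcc ⟨?_, (le_max_left _ _).trans (hn.trans (by linarith))⟩)
  rw [div_le_comm₀ (by positivity) hx0']
  exact (le_max_right _ _).trans (hn.trans (by linarith))

/-- A locally absolutely continuous function whose derivative agrees almost everywhere with a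
continuous function is continuously differentiable. -/
theorem _root_.LocallyACOnPos.hasDerivAt_of_ae {E : Type*} [NormedAddCommGroup E] [NormedSpace ℝ E]
    [CompleteSpace E] {f g : ℝ → E} (hf : LocallyACOnPos f) (hg : ContinuousOn g (Ioi 0))
    (hfg : ∀ᵐ x ∂(volume.restrict (Ioi (0 : ℝ))), HasDerivAt f (g x) x) {x : ℝ} (hx : 0 < x) :
    HasDerivAt f (g x) x := by
  set G := fun t => ∫ s in x..t, g s
  have hG : ∀ t, 0 < t → HasDerivAt G (g t) t := fun t ht =>
    intervalIntegral.integral_hasDerivAt_right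
      (hg.mono (uIcc_subset_Ioi_of_pos hx ht)).intervalIntegrable
      (hg.stronglyMeasurableAtFilter isOpen_Ioi t ht) (hg.continuousAt (Ioi_mem_nhds ht))
  have hac := (hf.sub (locallyACOnPos_of_hasDerivAt hG hg)) (x / 2) (2 * x) (by positivity)
    (by linarith)
  have hsub := uIcc_subset_Ioi_of_pos (half_pos hx) (by positivity : 0 < 2 * x)
  obtain ⟨C, hC⟩ := hac.const_of_ae_hasDerivAt_zero (by
    filter_upwards [(ae_restrict_iff' measurableSet_Ioi).1 hfg] with t ht ht'
    rw [← sub_self (g t)]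
    exact (ht (hsub ht')).fun_sub (hG t (hsub ht')))
  refine ((hG x hx).const_add C).congr_of_eventuallyEq ?_
  filter_upwards [Ioo_mem_nhds (half_lt_self hx) (by linarith : x < 2 * x)] with t ht
  rw [← hC t (Icc_subset_uIcc ⟨ht.1.le, ht.2.le⟩), sub_add_cancel]

/-! ### Construction of the Jost solution -/

variable {A : ℝ → ℝ} (hA : IntegrableOn A (Ioi 0)) (hc : ContinuousOn A (Ioi 0))

include hA hc

theorem norm_volterra_le_const {u : ℝ → ℂ} {x C : ℝ} {κ : ℂ} (hκ : 0 ≤ κ.im) (hx : 0 ≤ x)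
    (hC0 : 0 ≤ C) (hu : ContinuousOn u (Ioi 0)) (hC : ∀ t, 0 < t → ‖u t‖ ≤ C) :
    ‖volterra A κ u x‖ ≤ C / 2 * Real.exp (2 * tailMass A 0) := by
  refine (norm_volterra_le hA hc hκ hx hC0 (hu.mono (Ioi_subset_Ioi hx)) fun t ht => ?_).trans ?_
  · refine (hC t (hx.trans_lt ht)).trans (le_mul_of_one_le_right hC0 (Real.one_le_exp ?_))
    have := tailMass_nonneg (A := A) t
    positivity
  · have := tailMass_le hA hx
    gcongr

theorem norm_volterra_volterra_sub_le {u v : ℝ → ℂ} {x C D E : ℝ} {κ κ' : ℂ} (hκ : 0 ≤ κ.im)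
    (hκ' : 0 ≤ κ'.im) (hx : 0 ≤ x) (hu : ContinuousOn u (Ioi 0)) (hC0 : 0 ≤ C)
    (hC : ∀ t, 0 < t → ‖u t‖ ≤ C) (hv : ContinuousOn v (Ioi 0)) (hD0 : 0 ≤ D)
    (hD : ∀ t, 0 < t → ‖v t‖ ≤ D) (hE0 : 0 ≤ E)
    (hE : ∀ t, 0 < t → ‖u t - v t‖ ≤ E * Real.exp (2 * tailMass A t)) :
    ‖volterra A κ' (volterra A κ u) x - volterra A κ' (volterra A κ v) x‖ ≤
      E / 2 / 2 * Real.exp (2 * tailMass A x) := by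
  have hsub := Ioi_subset_Ioi hx
  have hcu := (continuousOn_volterra hA hκ hu hC).mono (hsub.trans Ioi_subset_Ici_self)
  have hcv := (continuousOn_volterra hA hκ hv hD).mono (hsub.trans Ioi_subset_Ici_self)
  rw [← volterra_sub hA hκ' hx hcu
    (fun t ht => norm_volterra_le_const hA hc hκ (hx.trans ht.le) hC0 hu hC) hcv
    (fun t ht => norm_volterra_le_const hA hc hκ (hx.trans ht.le) hD0 hv hD)]
  refine norm_volterra_le hA hc hκ' hx (by positivity) (hcu.sub hcv) fun t ht => ?_
  have ht0 := hx.trans ht.le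
  rw [Pi.sub_apply, ← volterra_sub hA hκ ht0 (hu.mono (Ioi_subset_Ioi ht0))
    (fun s hs => hC s (ht0.trans_lt hs)) (hv.mono (Ioi_subset_Ioi ht0))
    (fun s hs => hD s (ht0.trans_lt hs))]
  exact norm_volterra_le hA hc hκ ht0 hE0 ((hu.sub hv).mono (Ioi_subset_Ioi ht0))
    fun s hs => hE s (ht0.trans_lt hs)

-- With `w = exp (2 tailMass)` and `α = w V`, the two equations become one fixed point equation for
-- a bounded continuous `V`. Two Volterra operators contract by `1/4` in the weighted norm, so
-- Banach's theorem applies without smallness of `A`.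
open scoped BoundedContinuousFunction in
theorem exists_volterra_pair {κ : ℂ} (hκ : 0 ≤ κ.im) : ∃ α β : ℝ → ℂ, ∃ C : ℝ,
    ContinuousOn α (Ici 0) ∧ ContinuousOn β (Ici 0) ∧ (∀ x, 0 ≤ x → ‖α x‖ ≤ C) ∧
    (∀ x, 0 ≤ x → ‖β x‖ ≤ C) ∧ (∀ x, 0 ≤ x → α x = 1 + volterra A 0 β x) ∧
    ∀ x, 0 ≤ x → β x = volterra A κ α x := by
  -- Replacing `x` by `max x 0` extends everything continuously to the line, so that the complete
  -- space of bounded continuous functions on `ℝ` can be used.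
  set w : ℝ → ℝ := fun x => Real.exp (2 * tailMass A (max x 0)) with hw
  have hmax : Continuous fun x : ℝ => max x 0 := by fun_prop
  have hwc : Continuous w := Real.continuous_exp.comp (((continuousOn_tailMass hA).comp_continuous
    hmax fun x => mem_Ici.2 (le_max_right _ _)).const_mul 2)
  have hw1 : ∀ x, 1 ≤ w x := fun x => Real.one_le_exp (by
    have := tailMass_nonneg (A := A) (max x 0); positivity)
  have hw0 : ∀ x, 0 < w x := fun x => zero_lt_one.trans_le (hw1 x)
  set W := Real.exp (2 * tailMass A 0)
  have hwW : ∀ x, w x ≤ W := fun x => by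
    have := tailMass_le hA (le_max_right x 0)
    simp only [hw, W]
    gcongr
  have hweq : ∀ x, 0 ≤ x → w x = Real.exp (2 * tailMass A x) := fun x hx => by
    simp only [hw, max_eq_left hx]
  have hW0 : 0 < W := Real.exp_pos _
  set Φ : (ℝ →ᵇ ℂ) → ℝ → ℂ := fun V x => (w x : ℂ) * V x with hΦ
  have hΦc : ∀ V, Continuous (Φ V) := fun V => (Complex.continuous_ofReal.comp hwc).mul V.continuous
  have hΦw : ∀ V x, ‖Φ V x‖ ≤ ‖V‖ * w x := fun V x => by
    rw [hΦ, norm_mul, Complex.norm_real, Real.norm_of_nonneg (hw0 x).le, mul_comm]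
    exact mul_le_mul_of_nonneg_right (V.norm_coe_le_norm x) (hw0 x).le
  have hΦW : ∀ V x, ‖Φ V x‖ ≤ ‖V‖ * W := fun V x =>
    (hΦw V x).trans (mul_le_mul_of_nonneg_left (hwW x) (norm_nonneg _))
  have hbc : ∀ V, ContinuousOn (volterra A κ (Φ V)) (Ici 0) := fun V =>
    continuousOn_volterra hA hκ (hΦc V).continuousOn fun t _ => hΦW V t
  have hbb : ∀ V x, 0 ≤ x → ‖volterra A κ (Φ V) x‖ ≤ ‖V‖ * W / 2 * W := fun V x hx =>
    norm_volterra_le_const hA hc hκ hx (by positivity) (hΦc V).continuousOn fun t _ => hΦW V t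
  set S : (ℝ →ᵇ ℂ) → ℝ → ℂ := fun V => volterra A 0 (volterra A κ (Φ V)) with hS
  have h0 : 0 ≤ (0 : ℂ).im := le_rfl
  have hSc : ∀ V, ContinuousOn (S V) (Ici 0) := fun V => continuousOn_volterra hA h0
    ((hbc V).mono Ioi_subset_Ici_self) fun t ht => hbb V t ht.le
  have hSsub : ∀ V V' x, 0 ≤ x → ‖S V x - S V' x‖ ≤ ‖V - V'‖ / 2 / 2 * w x := fun V V' x hx => by
    rw [hweq x hx]
    refine norm_volterra_volterra_sub_le hA hc hκ h0 hx (hΦc V).continuousOn (by positivity)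
      (fun t _ => hΦW V t) (hΦc V').continuousOn (by positivity) (fun t _ => hΦW V' t)
      (norm_nonneg _) fun t ht => ?_
    rw [← hweq t ht.le]
    have := hΦw (V - V') t
    simpa only [hΦ, BoundedContinuousFunction.coe_sub, Pi.sub_apply, mul_sub] using this
  have hwmax : ∀ x, w (max x 0) = w x := fun x => by simp only [hw, max_eq_left (le_max_right x 0)]
  have hS0 : S 0 = 0 := by
    funext x
    simp [hS, hΦ, volterra]
  have hTc : ∀ V, Continuous fun x => ((w x)⁻¹ : ℂ) * (1 + S V (max x 0)) := fun V =>
    (((Complex.continuous_ofReal.comp hwc).inv₀ fun x => by simpa using (hw0 x).ne')).mul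
      (continuous_const.add ((hSc V).comp_continuous hmax fun x => mem_Ici.2 (le_max_right _ _)))
  have hwinv : ∀ x, ‖((w x)⁻¹ : ℂ)‖ = (w x)⁻¹ := fun x => by
    rw [norm_inv, Complex.norm_real, Real.norm_of_nonneg (hw0 x).le]
  have hTb : ∀ V x, ‖((w x)⁻¹ : ℂ) * (1 + S V (max x 0))‖ ≤ 1 + ‖V‖ / 2 / 2 := fun V x => by
    have h1 := hSsub V 0 (max x 0) (le_max_right _ _)
    rw [hS0, hwmax, sub_zero, Pi.zero_apply, sub_zero] at h1
    rw [norm_mul, hwinv, inv_mul_le_iff₀ (hw0 x)]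
    refine (norm_add_le _ _).trans ?_
    rw [norm_one, mul_add, mul_one, mul_comm (w x)]
    exact add_le_add (hw1 x) h1
  set T : (ℝ →ᵇ ℂ) → (ℝ →ᵇ ℂ) := fun V =>
    BoundedContinuousFunction.ofNormedAddCommGroup _ (hTc V) _ (hTb V) with hT
  have hcontr : ContractingWith (1 / 2) T := by
    refine ⟨by
      rw [← NNReal.coe_lt_coe]; norm_num, LipschitzWith.of_dist_le_mul fun V V' => ?_⟩
    refine (BoundedContinuousFunction.dist_le (by positivity)).2 fun x => ?_
    have h1 := hSsub V V' (max x 0) (le_max_right _ _)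
    rw [hwmax] at h1
    rw [dist_eq_norm, dist_eq_norm]
    have : T V x - T V' x = ((w x)⁻¹ : ℂ) * (S V (max x 0) - S V' (max x 0)) := by
      simp only [hT, BoundedContinuousFunction.coe_ofNormedAddCommGroup]
      ring
    rw [this, norm_mul, hwinv, inv_mul_le_iff₀ (hw0 x), mul_comm (w x)]
    refine h1.trans (mul_le_mul_of_nonneg_right ?_ (hw0 x).le)
    push_cast
    linarith [norm_nonneg (V - V')]
  set V := hcontr.fixedPoint
  have hV : T V = V := hcontr.fixedPoint_isFixedPt
  have hα : ∀ x, 0 ≤ x → Φ V x = 1 + S V x := fun x hx => by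
    have h1 : T V x = V x := by rw [hV]
    simp only [hT, BoundedContinuousFunction.coe_ofNormedAddCommGroup, max_eq_left hx] at h1
    rw [hΦ]
    simp only [← h1]
    rw [mul_inv_cancel_left₀ (by simpa using (hw0 x).ne')]
  refine ⟨Φ V, volterra A κ (Φ V), max (‖V‖ * W) (‖V‖ * W / 2 * W), (hΦc V).continuousOn, hbc V,
    fun x _ => (hΦW V x).trans (le_max_left _ _), fun x hx => (hbb V x hx).trans (le_max_right _ _),
    hα, fun _ _ => rfl⟩

end Krein

namespace Krein

theorem hasDerivAt_exp_mul (k : ℂ) (x : ℝ) :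
    HasDerivAt (fun x : ℝ => Complex.exp (Complex.I * k * x))
      (Complex.I * k * Complex.exp (Complex.I * k * x)) x := by
  have := ((Complex.ofRealCLM.hasDerivAt (x := x)).const_mul (Complex.I * k)).cexp
  refine this.congr_deriv ?_
  simp; ring

theorem exp_mul_isLittleO_iff {k : ℂ} {u : ℝ → ℂ} :
    (u =o[atTop] fun x : ℝ => Complex.exp (Complex.I * k * x)) ↔
      Tendsto (fun x : ℝ => Complex.exp (-(Complex.I * k * x)) * u x) atTop (𝓝 0) := by
  rw [isLittleO_iff_tendsto fun x hx => absurd hx (Complex.exp_ne_zero _)]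
  refine iff_of_eq (congrArg (Tendsto · _ _) (funext fun x => ?_))
  rw [Complex.exp_neg, div_eq_inv_mul]

/-! ### Existence of the Jost solution -/

variable {A : ℝ → ℝ} {k : ℂ}

/-- A solution of the first order system `α' = -A β`, `β' = -2ik β - A α` on the half-line,
normalised at infinity. -/
structure IsJostPair (A : ℝ → ℝ) (k : ℂ) (α β : ℝ → ℂ) : Prop where
  continuousOn_fst : ContinuousOn α (Ici 0)
  continuousOn_snd : ContinuousOn β (Ici 0)
  hasDerivAt_fst : ∀ x, 0 < x → HasDerivAt α (-(A x * β x)) x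
  hasDerivAt_snd : ∀ x, 0 < x → HasDerivAt β (-(2 * Complex.I * k * β x) - A x * α x) x
  tendsto_fst : Tendsto α atTop (𝓝 1)
  tendsto_snd : Tendsto β atTop (𝓝 0)

theorem exists_isJostPair (hA : IntegrableOn A (Ioi 0)) (hc : ContinuousOn A (Ioi 0))
    (hk : 0 ≤ k.im) : ∃ α β, IsJostPair A k α β := by
  have h2k : 0 ≤ (2 * k).im := by simpa using hk
  have h0 : 0 ≤ (0 : ℂ).im := le_rfl
  obtain ⟨α, β, C, hαc, hβc, hαC, hβC, hα, hβ⟩ := exists_volterra_pair hA hc h2k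
  have hαc' := hαc.mono Ioi_subset_Ici_self
  have hβc' := hβc.mono Ioi_subset_Ici_self
  have hαC' : ∀ t, 0 < t → ‖α t‖ ≤ C := fun t ht => hαC t ht.le
  have hβC' : ∀ t, 0 < t → ‖β t‖ ≤ C := fun t ht => hβC t ht.le
  refine ⟨α, β, hαc, hβc, fun x hx => ?_, fun x hx => ?_, ?_, ?_⟩
  · have h1 := (hasDerivAt_volterra hA hc h0 hβc' hβC' hx).const_add 1
    refine (h1.congr_of_eventuallyEq ?_).congr_deriv (by ring)
    filter_upwards [Ioi_mem_nhds hx] with y hy using hα y (le_of_lt hy)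
  · have h1 := hasDerivAt_volterra hA hc h2k hαc' hαC' hx
    refine (h1.congr_of_eventuallyEq ?_).congr_deriv (by rw [hβ x hx.le]; ring)
    filter_upwards [Ioi_mem_nhds hx] with y hy using hβ y (le_of_lt hy)
  · have h1 := (tendsto_volterra_atTop hA h0 hβc' hβC').const_add 1
    rw [add_zero] at h1
    refine h1.congr' ?_
    filter_upwards [eventually_ge_atTop 0] with y hy using (hα y hy).symm
  · refine (tendsto_volterra_atTop hA h2k hαc' hαC').congr' ?_
    filter_upwards [eventually_ge_atTop 0] with y hy using (hβ y hy).symm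

/-- With `u = e^{ikx}(α + β)` the system reads `y' = iku + Ay`, `u' = iky - Au`. Differentiating
`y'` once more, the terms with `Au` cancel and `A² + A'` appears. -/
theorem IsJostPair.isJostSolution {α β : ℝ → ℂ} (h : IsJostPair A k α β) (hA : LocallyACOnPos A) :
    IsJostSolution (fun x => A x ^ 2 + deriv A x) k
      (fun x => Complex.exp (Complex.I * k * x) * (α x - β x)) := by
  set y : ℝ → ℂ := fun x => Complex.exp (Complex.I * k * x) * (α x - β x)
  set u : ℝ → ℂ := fun x => Complex.exp (Complex.I * k * x) * (α x + β x)
  have hE : Continuous fun x : ℝ => Complex.exp (Complex.I * k * x) := by fun_prop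
  have hy : ∀ x, 0 < x → HasDerivAt y (Complex.I * k * u x + A x * y x) x := fun x hx => by
    refine ((hasDerivAt_exp_mul k x).mul
      ((h.hasDerivAt_fst x hx).sub (h.hasDerivAt_snd x hx))).congr_deriv ?_
    simp only [y, u, Pi.sub_apply]; ring
  have hu : ∀ x, 0 < x → HasDerivAt u (Complex.I * k * y x - A x * u x) x := fun x hx => by
    refine ((hasDerivAt_exp_mul k x).mul
      ((h.hasDerivAt_fst x hx).add (h.hasDerivAt_snd x hx))).congr_deriv ?_
    simp only [y, u, Pi.add_apply]; ring
  have hyc : ContinuousOn y (Ici 0) :=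
    hE.continuousOn.mul (h.continuousOn_fst.sub h.continuousOn_snd)
  have huc : ContinuousOn u (Ici 0) :=
    hE.continuousOn.mul (h.continuousOn_fst.add h.continuousOn_snd)
  have hyc' := hyc.mono Ioi_subset_Ici_self
  have huc' := huc.mono Ioi_subset_Ici_self
  have hAc : ContinuousOn (fun x => (A x : ℂ)) (Ioi 0) :=
    Complex.continuous_ofReal.comp_continuousOn hA.continuousOn
  have hyac : LocallyACOnPos y := locallyACOnPos_of_hasDerivAt hy
    ((continuousOn_const.mul huc').add (hAc.mul hyc'))
  have huac : LocallyACOnPos fun x => Complex.I * k * u x := locallyACOnPos_of_hasDerivAt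
    (fun x hx => (hu x hx).const_mul (Complex.I * k))
    (continuousOn_const.mul ((continuousOn_const.mul hyc').sub (hAc.mul huc')))
  have hdy : EqOn (fun x => Complex.I * k * u x + A x * y x) (deriv y) (Ioi 0) :=
    fun x hx => (hy x hx).deriv.symm
  refine ⟨⟨hyc, fun x hx => (hy x hx).differentiableAt,
    (huac.add (hA.ofReal_mul hyac)).congr hdy, ?_⟩, exp_mul_isLittleO_iff.2 ?_⟩
  · filter_upwards [hA.ae_differentiableAt, ae_restrict_mem measurableSet_Ioi] with x hAx hx
    have h1 := ((hu x hx).const_mul (Complex.I * k)).add (hAx.hasDerivAt.ofReal_comp.mul (hy x hx))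
    have h2 := (h1.congr_of_eventuallyEq
      ((hdy.symm.eventuallyEq_of_mem (Ioi_mem_nhds hx)))).deriv
    rw [h2]
    push_cast
    linear_combination (k ^ 2 * y x) * Complex.I_sq
  · have h1 := (h.tendsto_fst.sub h.tendsto_snd).sub_const 1
    rw [sub_zero, sub_self] at h1
    refine h1.congr fun x => ?_
    have : Complex.exp (-(Complex.I * k * x)) * Complex.exp (Complex.I * k * x) = 1 := by
      rw [← Complex.exp_add]; simp
    simp only [y]
    linear_combination (1 - (α x - β x)) * this

/-! ### Uniqueness of the Jost solution -/

theorem _root_.IsSchrodingerSolution.sub {q : ℝ → ℝ} {y z : ℝ → ℂ}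
    (hy : IsSchrodingerSolution q k y) (hz : IsSchrodingerSolution q k z) :
    IsSchrodingerSolution q k (fun x => y x - z x) := by
  have hd : EqOn (fun x => deriv y x - deriv z x) (deriv fun x => y x - z x) (Ioi 0) := fun x hx =>
    (deriv_fun_sub (hy.differentiableAt x hx) (hz.differentiableAt x hx)).symm
  refine ⟨hy.continuousOn.sub hz.continuousOn,
    fun x hx => (hy.differentiableAt x hx).sub (hz.differentiableAt x hx),
    (hy.deriv_ac.sub hz.deriv_ac).congr hd, ?_⟩
  filter_upwards [hy.equation, hz.equation, hy.deriv_ac.ae_differentiableAt,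
    hz.deriv_ac.ae_differentiableAt, ae_restrict_mem measurableSet_Ioi] with x h1 h2 h3 h4 hx
  have : deriv (deriv fun x => y x - z x) x = deriv (deriv y) x - deriv (deriv z) x := by
    rw [(hd.symm.eventuallyEq_of_mem (Ioi_mem_nhds hx)).deriv_eq]
    exact deriv_fun_sub h3 h4
  rw [this]
  linear_combination h1 - h2

/-- Let `y` solve `y'' + k² y = (A² + A') y`. Then `w = y' - A y` is continuously differentiable. -/
theorem hasDerivAt_quasiDeriv {y : ℝ → ℂ} (hA : LocallyACOnPos A)
    (hy : IsSchrodingerSolution (fun x => A x ^ 2 + deriv A x) k y) {x : ℝ} (hx : 0 < x) :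
    HasDerivAt (fun x => deriv y x - A x * y x)
      (-(A x * (deriv y x - A x * y x)) - k ^ 2 * y x) x := by
  have hyc := hy.continuousOn.mono Ioi_subset_Ici_self
  have hdc := hy.deriv_ac.continuousOn
  have hAc : ContinuousOn (fun x => (A x : ℂ)) (Ioi 0) :=
    Complex.continuous_ofReal.comp_continuousOn hA.continuousOn
  have hyd : ∀ x, 0 < x → HasDerivAt y (deriv y x) x := fun x hx =>
    (hy.differentiableAt x hx).hasDerivAt
  refine LocallyACOnPos.hasDerivAt_of_ae (f := fun x => deriv y x - A x * y x)
    (g := fun x => -(A x * (deriv y x - A x * y x)) - k ^ 2 * y x)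
    (hy.deriv_ac.sub (hA.ofReal_mul (locallyACOnPos_of_hasDerivAt hyd hdc)))
    (((hAc.mul (hdc.sub (hAc.mul hyc))).neg).sub (continuousOn_const.mul hyc)) ?_ hx
  -- Almost everywhere the term `A' y` from the equation cancels the one from the product rule,
  -- leaving a continuous expression.
  filter_upwards [hA.ae_differentiableAt, hy.deriv_ac.ae_differentiableAt, hy.equation,
    ae_restrict_mem measurableSet_Ioi] with t h1 h2 h3 ht
  refine (h2.hasDerivAt.sub (h1.hasDerivAt.ofReal_comp.mul (hyd t ht))).congr_deriv ?_
  push_cast at h3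
  linear_combination h3

theorem exists_bound_of_tendsto {E : Type*} [NormedAddCommGroup E] {f : ℝ → E} {l : E} {x₀ : ℝ}
    (hf : ContinuousOn f (Ici x₀)) (hl : Tendsto f atTop (𝓝 l)) :
    ∃ C, ∀ x, x₀ ≤ x → ‖f x‖ ≤ C := by
  obtain ⟨X, hX⟩ := eventually_atTop.1 (hl.norm.eventually (ge_mem_nhds (lt_add_one ‖l‖)))
  obtain ⟨C, hC⟩ := isCompact_Icc.exists_bound_of_continuousOn
    (hf.mono (show Icc x₀ X ⊆ Ici x₀ from Icc_subset_Ici_self))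
  refine ⟨max C (‖l‖ + 1), fun x hx => ?_⟩
  rcases le_total x X with h | h
  · exact (hC x ⟨hx, h⟩).trans (le_max_left _ _)
  · exact (hX x h).trans (le_max_right _ _)

/-- The increment over a unit step tends to `0` because `f` converges, and to `m` by the mean value
inequality. -/
theorem eq_zero_of_tendsto_of_tendsto_deriv {f f' : ℝ → ℂ} {l m : ℂ}
    (hd : ∀ᶠ x in atTop, HasDerivAt f (f' x) x) (hf : Tendsto f atTop (𝓝 l))
    (hf' : Tendsto f' atTop (𝓝 m)) : m = 0 := by
  have h1 : Tendsto (fun x => f (x + 1) - f x - m) atTop (𝓝 (-m)) := by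
    have := ((hf.comp (tendsto_atTop_add_const_right _ 1 tendsto_id)).sub hf).sub_const m
    simpa using this
  have h2 : Tendsto (fun x => f (x + 1) - f x - m) atTop (𝓝 0) := by
    rw [Metric.tendsto_atTop]
    intro ε hε
    obtain ⟨X, hX⟩ := eventually_atTop.1
      (hd.and ((tendsto_iff_norm_sub_tendsto_zero.1 hf').eventually (gt_mem_nhds (half_pos hε))))
    refine ⟨X, fun x hx => ?_⟩
    have h3 := (convex_Icc x (x + 1)).norm_image_sub_le_of_norm_hasDerivWithin_le
      (f := fun t : ℝ => f t - t * m) (f' := fun t => f' t - m) (C := ε / 2)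
      (fun t ht => (((hX t (hx.trans ht.1)).1.sub
        ((Complex.ofRealCLM.hasDerivAt (x := t)).mul_const m)).congr_deriv
          (by simp)).hasDerivWithinAt)
      (fun t ht => (hX t (hx.trans ht.1)).2.le)
      (left_mem_Icc.2 (by linarith)) (right_mem_Icc.2 (by linarith))
    rw [dist_eq_norm, sub_zero]
    have e : f (x + 1) - f x - m = f (x + 1) - ((x + 1 : ℝ) : ℂ) * m - (f x - (x : ℂ) * m) := by
      push_cast; ring
    rw [e]
    refine h3.trans_lt ?_
    rw [add_sub_cancel_left, norm_one]
    linarith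
  have := tendsto_nhds_unique h1 h2
  simpa using this

/-- A solution of the Schrödinger equation that is `o(e^{ikx})` vanishes. -/
theorem eq_zero_of_isLittleO {y : ℝ → ℂ} (hA : LocallyACOnPos A) (hAi : IntegrableOn A (Ioi 0))
    (hk : 0 ≤ k.im) (hy : IsSchrodingerSolution (fun x => A x ^ 2 + deriv A x) k y)
    (hlim : y =o[atTop] fun x : ℝ => Complex.exp (Complex.I * k * x)) {x : ℝ} (hx : 0 < x) :
    y x = 0 := by
  have hAc := hA.continuousOn
  have hAc' : ContinuousOn (fun x => (A x : ℂ)) (Ioi 0) :=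
    Complex.continuous_ofReal.comp_continuousOn hAc
  have h2k : 0 ≤ (2 * k).im := by simpa using hk
  have h0 : 0 ≤ (0 : ℂ).im := le_rfl
  set E : ℝ → ℂ := fun x => Complex.exp (-(Complex.I * k * x)) with hE
  set Y : ℝ → ℂ := fun x => E x * y x with hYdef
  -- With `b = a - 2ikY`, the pair `(a, b)` satisfies the homogeneous Jost system. Only `Y → 0` is
  -- known; decay of `a` and `b` has to be derived.
  set a : ℝ → ℂ := fun x => E x * (deriv y x - A x * y x) + Complex.I * k * Y x with hadef
  have hEd : ∀ x, HasDerivAt E (-(Complex.I * k) * E x) x := fun x => by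
    have := hasDerivAt_exp_mul (-k) x
    simpa only [hE, mul_neg, neg_mul] using this
  have hYd : ∀ x, 0 < x → HasDerivAt Y (A x * Y x + (a x - 2 * Complex.I * k * Y x)) x :=
    fun x hx => by
      refine ((hEd x).mul (hy.differentiableAt x hx).hasDerivAt).congr_deriv ?_
      simp only [hYdef, hadef]; ring
  have had : ∀ x, 0 < x → HasDerivAt a (-(A x * (a x - 2 * Complex.I * k * Y x))) x :=
    fun x hx => by
      refine (((hEd x).mul (hasDerivAt_quasiDeriv hA hy hx)).add
        ((hYd x hx).const_mul (Complex.I * k))).congr_deriv ?_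
      simp only [hYdef, hadef]
      linear_combination (-(k ^ 2 * E x * y x)) * Complex.I_sq
  have hY0 : Tendsto Y atTop (𝓝 0) := exp_mul_isLittleO_iff.1 hlim
  have hEc : Continuous E := by fun_prop
  have hYc : ContinuousOn Y (Ici 0) := hEc.continuousOn.mul hy.continuousOn
  have hYc' := hYc.mono Ioi_subset_Ici_self
  have hac : ContinuousOn a (Ioi 0) := fun t ht => (had t ht).continuousAt.continuousWithinAt
  obtain ⟨x₀, hx₀, hx₀x⟩ := exists_between hx
  have hsub : Ici x₀ ⊆ Ioi 0 := fun t ht => hx₀.trans_le ht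
  have hsub' : Ioi x₀ ⊆ Ioi 0 := Ioi_subset_Ioi hx₀.le
  obtain ⟨C, hC⟩ := exists_bound_of_tendsto hYc hY0
  -- The integrating factor `P` removes `a` from the right-hand side: `(aP)' = A · 2ikYP` is
  -- integrable, since `Y` and `P` are bounded near infinity. Hence `aP` converges, and `P → 1`.
  obtain ⟨L, haL⟩ : ∃ L, Tendsto a atTop (𝓝 L) := by
    set P : ℝ → ℂ := fun t => Complex.exp (-∫ s in Ioi t, (A s : ℂ)) with hP
    have hPd : ∀ t, 0 < t → HasDerivAt P (A t * P t) t := fun t ht => by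
      refine ((hasDerivAt_integral_Ioi (F := fun s => (A s : ℂ)) hAi.ofReal hAc'
        ht).fun_neg.cexp).congr_deriv ?_
      simp only [hP]; ring
    have hPl : Tendsto P atTop (𝓝 1) := by
      have := (Complex.continuous_exp.tendsto _).comp
        (tendsto_integral_Ioi_atTop (F := fun s => (A s : ℂ)) hAi.ofReal).neg
      rw [neg_zero, Complex.exp_zero] at this
      exact this
    have hPc : ContinuousOn P (Ioi 0) := fun t ht => (hPd t ht).continuousAt.continuousWithinAt
    have hQc : ContinuousOn (fun t => 2 * Complex.I * k * Y t * P t) (Ioi 0) :=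
      (continuousOn_const.mul hYc').mul hPc
    obtain ⟨D, hD⟩ := exists_bound_of_tendsto (hQc.mono hsub) ((hY0.const_mul _).mul hPl)
    have h1 := tendsto_limUnder_of_hasDerivAt_of_integrableOn_Ioi (a := x₀)
      (f := fun t => a t * P t) (f' := fun t => (A t : ℂ) * (2 * Complex.I * k * Y t * P t))
      (fun t ht => ((had t (hsub' ht)).mul (hPd t (hsub' ht))).congr_deriv (by ring))
      (integrableOn_mul_of_bounded hAi hx₀.le (hQc.mono hsub') fun t ht => hD t ht.le)
    refine ⟨_, (h1.div hPl one_ne_zero).congr fun t => ?_⟩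
    exact mul_div_cancel_right₀ _ (Complex.exp_ne_zero _)
  -- `Y + ∫_t^∞ A Y` tends to `0`, and its derivative `a - 2ikY` tends to `L`.
  have hL : L = 0 := by
    have hi := integrableOn_mul_of_bounded hAi le_rfl hYc' fun t ht => hC t ht.le
    have h1 := hY0.add (tendsto_integral_Ioi_atTop hi)
    have h2 := haL.sub (hY0.const_mul (2 * Complex.I * k))
    rw [mul_zero, sub_zero] at h2
    refine eq_zero_of_tendsto_of_tendsto_deriv ?_ h1 h2
    filter_upwards [eventually_gt_atTop 0] with t ht
    exact ((hYd t ht).fun_add (hasDerivAt_integral_Ioi hi (hAc'.mul hYc') ht)).congr_deriv (by ring)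
  rw [hL] at haL
  set b : ℝ → ℂ := fun t => a t - 2 * Complex.I * k * Y t with hb
  have hbc : ContinuousOn b (Ioi 0) := hac.sub (continuousOn_const.mul hYc')
  have hb0 : Tendsto b atTop (𝓝 0) := by simpa using haL.sub (hY0.const_mul (2 * Complex.I * k))
  have hbd : ∀ t, 0 < t → HasDerivAt b (-(Complex.I * (2 * k) * b t) - A t * a t) t :=
    fun t ht => by
      refine ((had t ht).fun_sub ((hYd t ht).const_mul (2 * Complex.I * k))).congr_deriv ?_
      simp only [hb]; ring
  obtain ⟨Ca, hCa⟩ := exists_bound_of_tendsto (hac.mono hsub) haL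
  obtain ⟨Cb, hCb⟩ := exists_bound_of_tendsto (hbc.mono hsub) hb0
  have hab : ∀ t, x₀ < t → a t = 0 ∧ b t = 0 := fun _ =>
    eq_zero_of_norm_le_volterra hAi hAc h0 h2k hx₀.le (hac.mono hsub') (hbc.mono hsub')
    (fun t ht => (hCa t ht.le).trans (le_max_left Ca Cb))
    (fun t ht => (hCb t ht.le).trans (le_max_right Ca Cb))
    (fun t ht => (congrArg norm (eq_volterra_of_hasDerivAt hAi h0 hx₀.le (hbc.mono hsub')
      (fun s hs => hCb s hs.le) (fun s hs => (had s (hsub' hs)).congr_deriv (by simp [hb])) haL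
      ht)).le)
    (fun t ht => (congrArg norm (eq_volterra_of_hasDerivAt hAi h2k hx₀.le (hac.mono hsub')
      (fun s hs => hCa s hs.le) (fun s hs => hbd s (hsub' hs)) hb0 ht)).le)
  have hYx : Y x = 0 := by
    obtain ⟨ha1, hb1⟩ := hab x hx₀x
    -- For `k ≠ 0`, `Y` is recovered from `a - b = 2ikY`. For `k = 0` this says nothing, but `a = 0`
    -- becomes `Y' = AY`, and the Volterra argument is repeated with the pair `(Y, -Y)`.
    by_cases hk0 : k = 0
    · have hYd' : ∀ t, x₀ < t → HasDerivAt Y (A t * Y t) t := fun t ht =>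
        (hYd t (hsub' ht)).congr_deriv (by rw [(hab t ht).1, hk0]; ring)
      have hC' : ∀ t, x₀ < t → ‖Y t‖ ≤ C := fun t ht => hC t (hx₀.trans ht).le
      have hCn : ∀ t, x₀ < t → ‖-Y t‖ ≤ C := fun t ht => (norm_neg _).trans_le (hC' t ht)
      refine (eq_zero_of_norm_le_volterra (b := fun t => -Y t) hAi hAc h0 h0 hx₀.le
        (hYc'.mono hsub') (hYc'.mono hsub').neg hC' hCn (fun t ht => ?_) (fun t ht => ?_) hx₀x).1
      · exact (congrArg norm (eq_volterra_of_hasDerivAt hAi h0 hx₀.le (hYc'.mono hsub').neg hCn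
          (fun s hs => (hYd' s hs).congr_deriv (by simp)) hY0 ht)).le
      · exact (congrArg norm (eq_volterra_of_hasDerivAt (b := fun t => -Y t) hAi h0 hx₀.le
          (hYc'.mono hsub') hC' (fun s hs => (hYd' s hs).fun_neg.congr_deriv (by simp))
          (by simpa using hY0.neg) ht)).le
    · rw [hb] at hb1
      simpa [ha1, hk0] using hb1
  exact (mul_eq_zero.1 hYx).resolve_left (Complex.exp_ne_zero _)

theorem _root_.IsJostSolution.eqOn {y z : ℝ → ℂ} (hA : LocallyACOnPos A)
    (hAi : IntegrableOn A (Ioi 0)) (hk : 0 ≤ k.im)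
    (hy : IsJostSolution (fun x => A x ^ 2 + deriv A x) k y)
    (hz : IsJostSolution (fun x => A x ^ 2 + deriv A x) k z) : EqOn z y (Ici 0) := by
  have h1 : EqOn z y (Ioi 0) := fun x hx => by
    refine sub_eq_zero.1 (eq_zero_of_isLittleO hA hAi hk (hz.solution.sub hy.solution) ?_ hx)
    exact (hz.asymptotics.sub hy.asymptotics).congr_left fun x => by ring
  exact h1.of_subset_closure hz.solution.continuousOn hy.solution.continuousOn Ioi_subset_Ici_self
    (closure_Ioi (0 : ℝ)).ge

end Krein

/-! ### The Krein system matched with the Jost system -/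

namespace Krein

namespace IsAccelerant

variable {H : ℝ → ℝ} {δ : ℝ} (h : IsAccelerant H δ)
include h

theorem kreinA_eq {Γ : ℝ → ℝ → ℝ → ℝ} (hΓ : ∀ x : ℝ, 0 ≤ x → IsKreinKernel H x (Γ x)) {x : ℝ}
    (hx : 0 ≤ x) : kreinA Γ x = 2 * h.a (2 * x) := by
  have h2x : 0 ≤ 2 * x := by positivity
  rw [kreinA, (h.kernel_zero h2x (hΓ _ h2x)).2 _ ⟨h2x, le_rfl⟩]
  rfl

/-- `H(x)` equals `Γ_x(x,0)` plus a term that is continuous for every `H ∈ L²`, so continuity of `A`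
passes to `H`. -/
theorem continuousOn_of_kreinA {Γ : ℝ → ℝ → ℝ → ℝ}
    (hΓ : ∀ x : ℝ, 0 ≤ x → IsKreinKernel H x (Γ x)) (hA : ContinuousOn (kreinA Γ) (Ioi 0)) :
    ContinuousOn H (Ioi 0) := by
  have h1 : ContinuousOn (fun x => kreinA Γ (x / 2) / 2) (Ioi 0) :=
    ContinuousOn.div_const (ContinuousOn.comp hA (by fun_prop : ContinuousOn (fun x : ℝ => x / 2)
      (Ioi 0)) fun x hx => mem_Ioi.2 (half_pos (mem_Ioi.1 hx))) 2
  have h2 : Continuous fun x => h.conv (h.g x) x :=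
    h.continuous_conv_pair.comp (continuous_id.prodMk h.continuous_g)
  refine (h1.add h2.continuousOn).congr fun x hx => ?_
  simp only [Pi.add_apply]
  rw [h.kreinA_eq hΓ (half_pos hx).le, mul_div_cancel₀ _ two_ne_zero, mul_div_cancel_left₀ _
    two_ne_zero, a, gPt]
  ring

theorem integrableOn_kreinA {Γ : ℝ → ℝ → ℝ → ℝ}
    (hΓ : ∀ x : ℝ, 0 ≤ x → IsKreinKernel H x (Γ x)) (hc : ContinuousOn H (Ioi 0)) :
    IntegrableOn (kreinA Γ) (Ioi 0) := by
  have h1 : IntegrableOn (fun x => 2 * h.a (2 * x)) (Ioi 0) := by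
    refine Integrable.const_mul ?_ 2
    exact (integrableOn_Ioi_comp_mul_left_iff h.a 0 two_pos).2 (by simpa using h.integrableOn_a hc)
  exact h1.congr_fun (fun x hx => (h.kreinA_eq hΓ (le_of_lt hx)).symm) measurableSet_Ioi

/-- The Jost function is read off from the limit of the Krein system. -/
theorem kreinF_eq {Γ : ℝ → ℝ → ℝ → ℝ} (hΓ : ∀ x : ℝ, 0 ≤ x → IsKreinKernel H x (Γ x))
    (hc : ContinuousOn H (Ioi 0)) {k : ℂ} (hk : 0 ≤ k.im) {α β : ℝ → ℂ}
    (hαβ : IsJostPair (kreinA Γ) k α β) : kreinF h.gammaLim k = α 0 - β 0 := by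
  obtain ⟨K, hK0, hK⟩ := h.exists_integral_g_le
  set P : ℝ → ℂ := fun x => Complex.exp (Complex.I * k * x) * (1 - h.gHat (-k) x) with hP
  set Q : ℝ → ℂ := fun x => 1 - h.gHat k x with hQ
  have hexp : ∀ x : ℝ, Complex.exp (Complex.I * k * x) * Complex.exp (Complex.I * -k * x) = 1 :=
    fun x => by rw [← Complex.exp_add]; ring_nf; simp
  have hQd : ∀ x, 0 < x → HasDerivAt Q (-(h.a x * P x)) x := fun x hx =>
    (h.hasDerivAt_gHat hc k hx).const_sub 1
  have hPd : ∀ x, 0 < x → HasDerivAt P (Complex.I * k * P x - h.a x * Q x) x := fun x hx => by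
    refine ((hasDerivAt_exp_mul k x).mul ((h.hasDerivAt_gHat hc (-k) hx).const_sub 1)).congr_deriv ?_
    simp only [hP, hQ, neg_neg]
    linear_combination (-(h.a x : ℂ) * (1 - h.gHat k x)) * hexp x
  have hscale : ∀ x : ℝ, HasDerivAt (fun x : ℝ => 2 * x) 2 x := fun x => by
    simpa using (hasDerivAt_id x).const_mul (2 : ℝ)
  -- After rescaling with `A(x) = 2a(2x)`, the pair `(P(2x), Q(2x))` solves a system dual to that of
  -- `(α, β)`, and all terms of `W'` cancel.
  set W : ℝ → ℂ := fun x => P (2 * x) * β x - Q (2 * x) * α x with hW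
  have hWd : ∀ x, 0 < x → HasDerivAt W 0 x := fun x hx => by
    have h2x : 0 < 2 * x := by positivity
    have h1 := (HasDerivAt.scomp x (hPd _ h2x) (hscale x)).mul (hαβ.hasDerivAt_snd x hx)
    have h2 := (HasDerivAt.scomp x (hQd _ h2x) (hscale x)).mul (hαβ.hasDerivAt_fst x hx)
    refine (h1.sub h2).congr_deriv ?_
    simp only [h.kreinA_eq hΓ hx.le, Function.comp_apply, Complex.real_smul]
    push_cast
    ring
  have hconst : ∀ x, 0 < x → W x = W 1 := fun x hx =>
    isOpen_Ioi.is_const_of_deriv_eq_zero isPreconnected_Ioi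
      (fun t ht => (hWd t ht).differentiableAt.differentiableWithinAt)
      (fun t ht => (hWd t ht).deriv) hx (mem_Ioi.2 one_pos)
  have h2zero : Tendsto (fun x : ℝ => 2 * x) (𝓝[>] 0) (𝓝[>] 0) :=
    tendsto_nhdsWithin_iff.2 ⟨((by fun_prop : Continuous fun x : ℝ => 2 * x).tendsto' 0 0
      (by simp)).mono_left nhdsWithin_le_nhds, by
        filter_upwards [self_mem_nhdsWithin] with x hx using mem_Ioi.2 (mul_pos two_pos (mem_Ioi.1 hx))⟩
  have hαz : Tendsto α (𝓝[>] 0) (𝓝 (α 0)) :=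
    (hαβ.continuousOn_fst 0 self_mem_Ici).mono_left (nhdsWithin_mono _ Ioi_subset_Ici_self)
  have hβz : Tendsto β (𝓝[>] 0) (𝓝 (β 0)) :=
    (hαβ.continuousOn_snd 0 self_mem_Ici).mono_left (nhdsWithin_mono _ Ioi_subset_Ici_self)
  have hPz : Tendsto P (𝓝[>] 0) (𝓝 1) := by
    have h1 : Tendsto (fun x : ℝ => Complex.exp (Complex.I * k * x)) (𝓝[>] 0) (𝓝 1) :=
      ((by fun_prop : Continuous fun x : ℝ => Complex.exp (Complex.I * k * x)).tendsto' 0 1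
        (by simp)).mono_left nhdsWithin_le_nhds
    simpa using h1.mul ((h.tendsto_gHat_zero (-k)).const_sub 1)
  have hQz : Tendsto Q (𝓝[>] 0) (𝓝 1) := by
    simpa using (h.tendsto_gHat_zero k).const_sub 1
  have hWz : Tendsto W (𝓝[>] 0) (𝓝 (β 0 - α 0)) := by
    have := ((hPz.comp h2zero).mul hβz).sub ((hQz.comp h2zero).mul hαz)
    rw [one_mul, one_mul] at this
    exact this
  -- At infinity `P` is only bounded, but `β → 0` removes it; `Q` tends to the Jost function and `α`
  -- to `1`.
  have hWi : Tendsto W atTop (𝓝 (-kreinF h.gammaLim k)) := by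
    have h2inf : Tendsto (fun x : ℝ => 2 * x) atTop atTop := tendsto_id.const_mul_atTop two_pos
    have h1 : Tendsto (fun x => P (2 * x) * β x) atTop (𝓝 0) := by
      refine squeeze_zero_norm' (a := fun x => (1 + K) * ‖β x‖) ?_ ?_
      · filter_upwards [eventually_ge_atTop 0] with x hx
        rw [norm_mul]
        have := h.norm_exp_mul_one_sub_gHat_le hK hk (x := 2 * x) (by positivity)
        exact mul_le_mul_of_nonneg_right this (norm_nonneg _)
      · simpa using hαβ.tendsto_snd.norm.const_mul (1 + K)
    have h2 := ((h.tendsto_one_sub_gHat hk).comp h2inf).mul hαβ.tendsto_fst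
    have := h1.sub h2
    rw [mul_one, zero_sub] at this
    exact this
  have e1 : W 1 = β 0 - α 0 := tendsto_nhds_unique (tendsto_const_nhds.congr' (by
    filter_upwards [self_mem_nhdsWithin] with x hx using (hconst x hx).symm)) hWz
  have e2 : W 1 = -kreinF h.gammaLim k := tendsto_nhds_unique (tendsto_const_nhds.congr' (by
    filter_upwards [eventually_gt_atTop 0] with x hx using (hconst x hx).symm)) hWi
  linear_combination e2 - e1

theorem isJostFunction {Γ : ℝ → ℝ → ℝ → ℝ} (hΓ : ∀ x : ℝ, 0 ≤ x → IsKreinKernel H x (Γ x))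
    (hA : LocallyACOnPos (kreinA Γ)) :
    IsJostFunction (kreinPotential Γ) (kreinF h.gammaLim) := fun k hk => by
  have hc := h.continuousOn_of_kreinA hΓ hA.continuousOn
  have hAi := h.integrableOn_kreinA hΓ hc
  obtain ⟨α, β, hαβ⟩ := exists_isJostPair hAi hA.continuousOn hk
  have hy := hαβ.isJostSolution hA
  refine ⟨_, hy, fun z hz => IsJostSolution.eqOn hA hAi hk hy hz, ?_⟩
  rw [h.kreinF_eq hΓ hc hk hαβ]
  simp

end IsAccelerant

end Krein

theorem theorem1p2 (H : ℝ → ℝ)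
    (H_even : ∀ t : ℝ, H (-t) = H t)
    (H_integrable : Integrable H)
    (H_sq_integrable : MemLp H 2)
    (H_pos : ∀ k : ℝ, 0 < 1 + (kreinTransform H k).re) :
    (∀ x : ℝ, 0 ≤ x → ∃ G : ℝ → ℝ → ℝ, IsKreinKernel H x G ∧
      ∀ G' : ℝ → ℝ → ℝ, IsKreinKernel H x G' →
        ∀ t ∈ Icc 0 x, ∀ s ∈ Icc 0 x, G' t s = G t s) ∧
    ∀ Γ : ℝ → ℝ → ℝ → ℝ, (∀ x : ℝ, 0 ≤ x → IsKreinKernel H x (Γ x)) →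
      ∃ Γlim : ℝ → ℝ,
        (∀ s : ℝ, 0 ≤ s → Tendsto (fun x : ℝ => Γ x s 0) atTop (𝓝 (Γlim s))) ∧
        IntegrableOn Γlim (Ioi 0) ∧
        (LocallyACOnPos (kreinA Γ) →
          IsJostFunction (kreinPotential Γ) (kreinF Γlim)) := by
  obtain ⟨δ, hδ, hδ1, hb⟩ := Krein.exists_coercive H_integrable H_pos
  have h : Krein.IsAccelerant H δ := ⟨H_even, H_integrable, H_sq_integrable, hδ, hδ1, hb⟩
  exact ⟨fun x hx => h.exists_unique_kernel hx, fun Γ hΓ =>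
    ⟨h.gammaLim, fun s hs => h.tendsto_kernel hΓ hs,
      h.integrableOn_gammaLim.mono_set Ioi_subset_Ici_self, h.isJostFunction hΓ⟩⟩
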